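/- Let $\Delta$ be a simply laced Dynkin diagram, that is, an irreducible diagram of type $A_n$ ($n\ge 1$), $D_n$ ($n\ge 4$), $E_6$, $E_7$ or $E_8$, with labels $m_{ij}\in\{2,3\}$ for nodes $i\ne j$. Let $A$ be a non-trivial subgroup of its automorphism group $\mathrm{Aut}(\Delta)$, where the case $(\Delta,A)=(A_{2n},\mathbb{Z}/2)$ is excluded. For a diagram $D$ with labels $m_{ij}$, the Artin group $B_D$ is the group with generators $R_i$ ($i$ a node of $D$) and the braid relations $R_iR_jR_i\cdots=R_jR_iR_j\cdots$ ($m_{ij}$ factors on each side) for $i\neq j$. The reflection group $W_D$ is the subgroup of $\mathrm{GL}(\mathfrak{h}_{D,\mathbb{R}})$ generated by the reflections $r_i$ in the simple roots $\lambda_i$; here $\mathfrak{h}_{D,\mathbb{R}}$ is the real vector space with the $\lambda_i$ as a basis and the inner product with $\langle\lambda_i,\lambda_i\rangle=1$ and $\langle\lambda_i,\lambda_j\rangle=-\cos(\pi/m_{ij})$ for $i\ne j$. There is a homomorphism $B_D\to W_D$ with $R_i\mapsto r_i$. The quotient diagram $\Xi=\Delta/A$ has the $A$-orbits of nodes of $\Delta$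 as its nodes. To an orbit $k$ belongs the vector $\mu_k=\sum_{i\in k}\lambda_i\in(\mathfrak{h}_{\Delta,\mathbb{R}})^A$, and the label of two different orbits $k,l$ is the number $m_{kl}\in\{2,3,4,6\}$ for which $4\cos^2(\pi/m_{kl})=\dfrac{4\langle\mu_k,\mu_l\rangle^2}{\langle\mu_k,\mu_k\rangle\langle\mu_l,\mu_l\rangle}$. **Lemma 1.1.** The group $A$ acts by automorphisms on $B_\Delta$ and on $W_\Delta$, with $a\cdot R_i=R_{a(i)}$ and $a\cdot r_i=r_{a(i)}$ for all $a\in A$ and all nodes $i$ of $\Delta$, and the homomorphism $B_\Delta\to W_\Delta$ is $A$-equivariant. The fixed subgroups $(B_\Delta)^A$ and $(W_\Delta)^A$ are isomorphic to $B_\Xi$ and $W_\Xi$ respectively. -/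

import Mathlib

noncomputable section

namespace CoxeterMatrix

/-! ### Simply laced Dynkin diagrams

A diagram is recorded by the matrix of its labels `M i j`: the nodes `i ≠ j` span an edge when
`3 ≤ M i j`, and the absence of an edge is the label `2`. -/

/-- The diagram of type `Dₙ` (used for `4 ≤ n`): the nodes `0, 1, …, n - 2` form a chain, and the
node `n - 1` is attached to the node `n - 3`. -/
def typeD (n : ℕ) : CoxeterMatrix (Fin n) where
  M := Matrix.of fun i j : Fin n ↦
    if i = j then 1
    else if ((i : ℕ) + 1 = j ∧ (j : ℕ) + 1 < n) ∨ ((j : ℕ) + 1 = i ∧ (i : ℕ) + 1 < n)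
      ∨ ((i : ℕ) + 3 = n ∧ (j : ℕ) + 1 = n) ∨ ((j : ℕ) + 3 = n ∧ (i : ℕ) + 1 = n) then 3
    else 2
  isSymm := by
    ext i j
    simp only [Matrix.transpose_apply, Matrix.of_apply]
    grind
  diagonal := by simp
  off_diagonal := by
    intro i j h
    simp only [Matrix.of_apply, if_neg h]
    split_ifs <;> decide

/-- `M` and `N` are the same diagram up to a renaming of the nodes. -/
def IsIsomorphic {I J : Type*} (M : CoxeterMatrix I) (N : CoxeterMatrix J) : Prop :=
  ∃ e : I ≃ J, M.reindex e = N

/-- `M` is a simply laced Dynkin diagram (irreducible of finite type), that is, one of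
`Aₙ` (`n ≥ 1`), `Dₙ` (`n ≥ 4`), `E₆`, `E₇`, `E₈`. -/
def IsSimplyLacedDynkin {I : Type*} (M : CoxeterMatrix I) : Prop :=
  (∃ n, 1 ≤ n ∧ M.IsIsomorphic (CoxeterMatrix.A n)) ∨
  (∃ n, 4 ≤ n ∧ M.IsIsomorphic (typeD n)) ∨
  M.IsIsomorphic E₆ ∨ M.IsIsomorphic E₇ ∨ M.IsIsomorphic E₈

/-- The group `Aut(Δ)` of automorphisms of a diagram: the permutations of the nodes that preserve
all labels. -/
def diagramAut {I : Type*} (M : CoxeterMatrix I) : Subgroup (Equiv.Perm I) where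
  carrier := {σ | ∀ i j, M (σ i) (σ j) = M i j}
  mul_mem' := fun {σ τ} hσ hτ i j ↦ by
    rw [Equiv.Perm.mul_apply, Equiv.Perm.mul_apply, hσ, hτ]
  one_mem' := fun _ _ ↦ rfl
  inv_mem' := fun {σ} hσ i j ↦ by
    have h := hσ (σ⁻¹ i) (σ⁻¹ j)
    simpa only [Equiv.Perm.inv_def, Equiv.apply_symm_apply] using h.symm

/-! ### The Artin group -/

/-- The braid relators: for nodes `i, j` the quotient of the two alternating products of the
generators `R_i, R_j` with `M i j` factors each. (For `i = j` and for `M i j = 0`, which encodes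
the label `∞`, this is the trivial relator `1`.) -/
def braidRelators {I : Type*} (M : CoxeterMatrix I) : Set (FreeGroup I) :=
  Set.range fun p : I × I ↦
    ((CoxeterSystem.braidWord M p.1 p.2).map FreeGroup.of).prod *
      (((CoxeterSystem.braidWord M p.2 p.1).map FreeGroup.of).prod)⁻¹

/-- The Artin group (generalized braid group) of a diagram. -/
abbrev ArtinGroup {I : Type*} (M : CoxeterMatrix I) : Type _ := PresentedGroup M.braidRelators

/-- The generator `R_i` of the Artin group. -/
def artinGen {I : Type*} (M : CoxeterMatrix I) (i : I) : M.ArtinGroup := PresentedGroup.of i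

/-! ### The reflection group -/

/-- The canonical symmetric bilinear form on the real vector space with basis the simple roots
`e_i`, normalized to unit length: `⟨e_i, e_j⟩ = -cos (π / M i j)`. For a Dynkin diagram it is
positive definite. -/
def rootForm {I : Type*} (M : CoxeterMatrix I) : LinearMap.BilinForm ℝ (I →₀ ℝ) :=
  Finsupp.linearCombination ℝ fun i ↦
    Finsupp.linearCombination ℝ fun j ↦ -Real.cos (Real.pi / (M i j : ℝ))

theorem rootForm_single {I : Type*} (M : CoxeterMatrix I) (i j : I) :
    M.rootForm (Finsupp.single i 1) (Finsupp.single j 1) = -Real.cos (Real.pi / (M i j : ℝ)) := by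
  simp [rootForm]

theorem rootForm_comm {I : Type*} (M : CoxeterMatrix I) (x y : I →₀ ℝ) :
    M.rootForm x y = M.rootForm y x := by
  suffices h : M.rootForm = M.rootForm.flip by
    conv_lhs => rw [h]
    rfl
  ext i j
  simp [rootForm, M.symmetric i j]

theorem two_smul_rootForm_self {I : Type*} (M : CoxeterMatrix I) (i : I) :
    ((2 : ℝ) • M.rootForm (Finsupp.single i 1)) (Finsupp.single i 1) = 2 := by
  rw [LinearMap.smul_apply, rootForm_single]
  simp

/-- The reflection `r_i` defined by the simple root `e_i`, `v ↦ v - 2 ⟨e_i, v⟩ e_i`. -/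
def simpleReflection {I : Type*} (M : CoxeterMatrix I) (i : I) : (I →₀ ℝ) ≃ₗ[ℝ] (I →₀ ℝ) :=
  Module.reflection (M.two_smul_rootForm_self i)

/-- The reflection group of a diagram, the group of linear automorphisms generated by the
reflections in the simple roots. -/
def reflectionGroup {I : Type*} (M : CoxeterMatrix I) : Subgroup ((I →₀ ℝ) ≃ₗ[ℝ] (I →₀ ℝ)) :=
  Subgroup.closure (Set.range M.simpleReflection)

/-- The reflection `r_i` as an element of the reflection group. -/
def reflectionGen {I : Type*} (M : CoxeterMatrix I) (i : I) : M.reflectionGroup :=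
  ⟨M.simpleReflection i, Subgroup.subset_closure ⟨i, rfl⟩⟩

open Polynomial.Chebyshev in
theorem eval_S_mul_sin (k : ℤ) (θ : ℝ) :
    (S ℝ k).eval (2 * Real.cos θ) * Real.sin θ = Real.sin ((k + 1) * θ) := by
  rw [← U_real_cos, ← S_comp_two_mul_X]
  simp

/-- The relations `(r_i r_j)^{m_ij} = 1` in the reflection group. -/
theorem isLiftable_reflectionGen {I : Type*} (M : CoxeterMatrix I) :
    M.IsLiftable M.reflectionGen := by
  intro i j
  apply Subtype.ext
  simp only [Subgroup.coe_pow, Subgroup.coe_mul, Subgroup.coe_one, reflectionGen]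
  rcases eq_or_ne i j with rfl | hij
  · rw [M.diagonal, pow_one]
    ext1 x
    exact Module.involutive_reflection (M.two_smul_rootForm_self i) x
  obtain ⟨m, hm⟩ : ∃ m, m = M i j := ⟨_, rfl⟩
  have hm1 : m ≠ 1 := hm ▸ M.off_diagonal i j hij
  have hc : ((2 : ℝ) • M.rootForm (Finsupp.single i 1)) (Finsupp.single j 1) =
      -(2 * Real.cos (Real.pi / m)) := by
    rw [LinearMap.smul_apply, rootForm_single, hm]; simp
  have hc' : ((2 : ℝ) • M.rootForm (Finsupp.single j 1)) (Finsupp.single i 1) =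
      -(2 * Real.cos (Real.pi / m)) := by
    rw [LinearMap.smul_apply, rootForm_single, hm, M.symmetric j i]; simp
  rw [← hm]
  obtain rfl | rfl | hm3 : m = 0 ∨ m = 2 ∨ 3 ≤ m := by omega
  · simp
  · have hz : Real.cos (Real.pi / (2 : ℕ)) = 0 := by simp
    rw [hz, mul_zero, neg_zero] at hc hc'
    ext1 x
    rw [pow_two]
    simp only [simpleReflection, LinearEquiv.mul_apply, Module.reflection_apply, map_sub,
      map_smul, hc, hc', two_smul_rootForm_self, LinearEquiv.coe_one, id]
    module
  · obtain ⟨θ, hθ⟩ : ∃ θ : ℝ, θ = 2 * (Real.pi / m) := ⟨_, rfl⟩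
    have hm0 : (0 : ℝ) < m := by positivity
    have hmθ : (m : ℝ) * θ = 2 * Real.pi := by rw [hθ]; field_simp
    have hs : Real.sin θ ≠ 0 := by
      apply ne_of_gt
      apply Real.sin_pos_of_pos_of_lt_pi
      · rw [hθ]; positivity
      · have : (3 : ℝ) ≤ m := by exact_mod_cast hm3
        nlinarith [Real.pi_pos]
    have ht : 2 * Real.cos θ =
        ((2 : ℝ) • M.rootForm (Finsupp.single i 1)) (Finsupp.single j 1) *
        ((2 : ℝ) • M.rootForm (Finsupp.single j 1)) (Finsupp.single i 1) - 2 := by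
      rw [hc, hc', hθ, Real.cos_two_mul]; ring
    have key : ∀ z, ((M.simpleReflection i * M.simpleReflection j) ^ m) z = z := by
      intro z
      rw [simpleReflection, simpleReflection,
        Module.reflection_mul_reflection_pow_apply _ _ m z _ ht]
      obtain ⟨k, hk | hk⟩ := Nat.even_or_odd' m
      · have e1 : ((m : ℤ) - 2) / 2 = k - 1 := by omega
        have e2 : ((m : ℤ) - 1) / 2 = k - 1 := by omega
        have h0 : (Polynomial.Chebyshev.S ℝ ((k : ℤ) - 1)).eval (2 * Real.cos θ) = 0 := by
          have := eval_S_mul_sin ((k : ℤ) - 1) θ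
          have e3 : ((((k : ℤ) - 1 : ℤ) : ℝ) + 1) * θ = Real.pi := by
            rw [hk] at hmθ; push_cast at hmθ ⊢; linarith
          rw [e3, Real.sin_pi] at this
          exact (mul_eq_zero.mp this).resolve_right hs
        rw [e1, e2, h0]
        simp
      · have e1 : ((m : ℤ) - 2) / 2 = k - 1 := by omega
        have e2 : ((m : ℤ) - 1) / 2 = k := by omega
        have e3 : ((m : ℤ) - 3) / 2 = k - 1 := by omega
        have e4 : (m : ℤ) / 2 = k := by omega
        have h0 : (Polynomial.Chebyshev.S ℝ (k : ℤ)).eval (2 * Real.cos θ) +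
            (Polynomial.Chebyshev.S ℝ ((k : ℤ) - 1)).eval (2 * Real.cos θ) = 0 := by
          have h1 := eval_S_mul_sin ((k : ℤ) - 1) θ
          have h2 := eval_S_mul_sin (k : ℤ) θ
          have e5 : (((k : ℤ) : ℝ) + 1) * θ =
              2 * Real.pi - ((((k : ℤ) - 1 : ℤ) : ℝ) + 1) * θ := by
            rw [hk] at hmθ; push_cast at hmθ ⊢; linarith
          rw [e5, Real.sin_two_pi_sub] at h2
          refine (mul_eq_zero.mp ?_).resolve_right hs
          rw [add_mul, h1, h2]; ring
        rw [e1, e2, e3, e4, h0]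
        simp
    ext1 z
    exact key z

theorem braidRelators_reflectionGen {I : Type*} (M : CoxeterMatrix I) :
    ∀ r ∈ M.braidRelators, FreeGroup.lift M.reflectionGen r = 1 := by
  rintro _ ⟨⟨i, j⟩, rfl⟩
  have h := congrArg (M.toCoxeterSystem.lift ⟨_, M.isLiftable_reflectionGen⟩)
    (M.toCoxeterSystem.wordProd_braidWord_eq i j)
  simp only [CoxeterSystem.wordProd, map_list_prod, List.map_map, Function.comp_def,
    CoxeterSystem.lift_apply_simple] at h
  simp only [map_mul, map_inv, map_list_prod, List.map_map, Function.comp_def,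
    FreeGroup.lift_apply_of, h, mul_inv_cancel]

/-- The homomorphism from the Artin group to the reflection group with `R_i ↦ r_i`. -/
def artinToReflection {I : Type*} (M : CoxeterMatrix I) : M.ArtinGroup →* M.reflectionGroup :=
  PresentedGroup.toGroup M.braidRelators_reflectionGen

/-! ### The quotient diagram -/

/-- The nodes of the quotient diagram `Δ/A`: the orbits of `A` on the nodes of `Δ`. -/
abbrev QuotientNode {I : Type*} (M : CoxeterMatrix I) (A : Subgroup M.diagramAut) : Type _ :=
  MulAction.orbitRel.Quotient A I

/-- The simple root `μ_k` attached to an orbit `k`: the sum of the simple roots in the orbit, an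
`A`-invariant vector. (A positive multiple of it, such as the mean over the orbit, gives the same
angles below.) -/
def orbitRoot {I : Type*} (M : CoxeterMatrix I) (A : Subgroup M.diagramAut)
    (k : M.QuotientNode A) : I →₀ ℝ :=
  ∑ᶠ i ∈ k.orbit, Finsupp.single i (1 : ℝ)

/-- The number `4 cos² φ`, where `φ` is the angle between `μ_k` and `μ_l`; equivalently, the
product of the two Cartan integers of the pair. -/
def orbitWeight {I : Type*} (M : CoxeterMatrix I) (A : Subgroup M.diagramAut)
    (k l : M.QuotientNode A) : ℝ :=
  4 * M.rootForm (M.orbitRoot A k) (M.orbitRoot A l) ^ 2 /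
    (M.rootForm (M.orbitRoot A k) (M.orbitRoot A k) *
      M.rootForm (M.orbitRoot A l) (M.orbitRoot A l))

theorem orbitWeight_comm {I : Type*} (M : CoxeterMatrix I) (A : Subgroup M.diagramAut)
    (k l : M.QuotientNode A) : M.orbitWeight A k l = M.orbitWeight A l k := by
  rw [orbitWeight, orbitWeight, M.rootForm_comm (M.orbitRoot A k) (M.orbitRoot A l),
    mul_comm (M.rootForm (M.orbitRoot A k) (M.orbitRoot A k))]

/-- The label `m` with `4 cos² (π / m) = w`: the values `w = 0, 1, 2, 3` give `m = 2, 3, 4, 6`.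
Other values do not occur for a pair of distinct simple roots of a finite root system. -/
def labelOfWeight (w : ℝ) : ℕ :=
  open scoped Classical in
  if w = 0 then 2 else if w = 1 then 3 else if w = 2 then 4 else if w = 3 then 6 else 0

theorem labelOfWeight_ne_one (w : ℝ) : labelOfWeight w ≠ 1 := by
  unfold labelOfWeight
  split_ifs <;> decide

/-- The quotient diagram `Ξ = Δ/A`: its nodes are the `A`-orbits of nodes of `Δ`, and the label of
two different nodes `k, l` is determined by the angle between the simple roots `μ_k` and `μ_l` in
the space of `A`-invariant vectors. -/
def quotientDiagram {I : Type*} (M : CoxeterMatrix I) (A : Subgroup M.diagramAut) :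
    CoxeterMatrix (M.QuotientNode A) where
  M := open scoped Classical in
    Matrix.of fun k l ↦ if k = l then 1 else labelOfWeight (M.orbitWeight A k l)
  isSymm := by
    ext k l
    rw [Matrix.transpose_apply, Matrix.of_apply, Matrix.of_apply, M.orbitWeight_comm A l k]
    by_cases h : k = l
    · rw [if_pos h, if_pos h.symm]
    · rw [if_neg h, if_neg (Ne.symm h)]
  diagonal := by simp
  off_diagonal := by
    intro k l h
    simp only [Matrix.of_apply, if_neg h]
    exact labelOfWeight_ne_one _

end CoxeterMatrix

/-- The subgroup of elements of `G` fixed by an action of `A` on `G` by group automorphisms. -/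
def fixedSubgroup {A G : Type*} [Group A] [Group G] (α : A →* MulAut G) : Subgroup G where
  carrier := {x | ∀ a, α a x = x}
  mul_mem' := fun hx hy a ↦ by rw [map_mul, hx a, hy a]
  one_mem' := fun a ↦ map_one (α a)
  inv_mem' := fun hx a ↦ by rw [map_inv, hx a]

end

noncomputable section

namespace CoxeterMatrix

open CoxeterSystem (alternatingWord braidWord)

/-! Everything takes place in the Artin monoid of Δ, where being fixed by A becomes a question of
divisibility. Garside's lemma (`IsSimplyLaced.lcmPair`) makes this monoid cancellative and describes
the common multiples of two generators. Since the form is positive definite, every root is positive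
or negative. It follows that the reduced elements form a section of the map to the reflection group
(`IsFiniteSimplyLaced.red_ext`) and that there is a longest one, the Garside element `D`. Its powers
provide common multiples, so the monoid embeds in the Artin group
(`IsFiniteSimplyLaced.toArtinGroup_injective`) and every group element is a fraction `D⁻ᵏ y`.

Outside type A₂ₙ no diagram automorphism moves a node to a neighbor (`IsSimplyLacedDynkin.noFlip`),
so the generators in an A-orbit commute and their product `orbitGen k` is fixed. A rank-two
computation with Cartan integers shows that the alternating product of two orbit generators, with as
many factors as the label in Ξ, is their least common multiple. So the braid relations of Ξ hold and
define `unfold`, from the Artin monoid of Ξ to that of Δ. Its image is the whole fixed submonoid,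
because a fixed element divisible by a generator is divisible by the full orbit. It is injective,
because equal products starting with different orbit generators share their least common multiple.
As `D` is fixed by A, the bijection passes to fractions, that is, to the Artin groups.

For the reflection groups, a fixed element lifts to its reduced element, which is fixed by
uniqueness and hence unfolds from Ξ. The A-invariant vectors contain an isometric copy of the
reflection representation of Ξ, compatible with `unfold`. A fixed element that is trivial on this
copy is trivial, because a nontrivial reduced fixed element makes some `μ_k` negative. So both
groups are quotients of the monoid of Ξ by the same congruence (`act_unfold_eq_iff`). -/

theorem map_alternatingWord {I J : Type*} (f : I → J) (i j : I) (n : ℕ) :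
    (alternatingWord i j n).map f = alternatingWord (f i) (f j) n := by
  induction n generalizing i j with
  | zero => rfl
  | succ n ih => simp [CoxeterSystem.alternatingWord_succ, ih]

/-- An alternating word ends in its second letter. It is a palindrome for odd length, while for even
length reversal exchanges the two letters. Hence reversal respects the braid relations. -/
theorem reverse_alternatingWord {I : Type*} (i j : I) (n : ℕ) :
    (alternatingWord i j n).reverse =
      if Even n then alternatingWord j i n else alternatingWord i j n := by
  induction n generalizing i j with
  | zero => rfl
  | succ n ih =>
    have h : (alternatingWord i j (n + 1)).reverse =
        j :: if Even n then alternatingWord i j n else alternatingWord j i n := by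
      rw [CoxeterSystem.alternatingWord_succ, List.concat_eq_append, List.reverse_append, ih]
      rfl
    rw [h]
    by_cases hn : Even n
    · rw [if_pos hn, if_neg (by simpa [Nat.even_add_one] using hn),
        CoxeterSystem.alternatingWord_succ' i j, if_pos hn]
    · rw [if_neg hn, if_pos (by simpa [Nat.even_add_one] using hn),
        CoxeterSystem.alternatingWord_succ' j i, if_neg hn]

/-! ### The Artin monoid -/

/-- The braid relations, as relations between positive words. -/
def BraidRel {I : Type*} (M : CoxeterMatrix I) (a b : FreeMonoid I) : Prop :=
  ∃ i j, a = FreeMonoid.ofList (braidWord M i j) ∧ b = FreeMonoid.ofList (braidWord M j i)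

/-- The Artin monoid of a diagram. -/
abbrev ArtinMonoid {I : Type*} (M : CoxeterMatrix I) : Type _ := PresentedMonoid M.BraidRel

/-- The generators of the Artin monoid. -/
def gen {I : Type*} (M : CoxeterMatrix I) (i : I) : M.ArtinMonoid := PresentedMonoid.of _ i

variable {I : Type*} {M : CoxeterMatrix I} {N : Type*} [Monoid N]

theorem prod_map_gen (w : List I) :
    (w.map M.gen).prod = PresentedMonoid.mk M.BraidRel (FreeMonoid.ofList w) := by
  induction w with
  | nil => rfl
  | cons i w ih =>
    rw [List.map_cons, List.prod_cons, ih, FreeMonoid.ofList_cons, map_mul]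
    rfl

theorem prod_braidWord_gen (i j : I) :
    ((braidWord M i j).map M.gen).prod = ((braidWord M j i).map M.gen).prod := by
  rw [prod_map_gen, prod_map_gen]
  exact PresentedMonoid.mk_eq_mk_of_rel ⟨i, j, rfl, rfl⟩

/-- The universal property of the Artin monoid. -/
def monoidLift (f : I → N)
    (h : ∀ i j, ((braidWord M i j).map f).prod = ((braidWord M j i).map f).prod) :
    M.ArtinMonoid →* N :=
  PresentedMonoid.lift f (by
    rintro _ _ ⟨i, j, rfl, rfl⟩
    rw [FreeMonoid.lift_ofList, FreeMonoid.lift_ofList]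
    exact h i j)

@[simp]
theorem monoidLift_gen (f : I → N)
    (h : ∀ i j, ((braidWord M i j).map f).prod = ((braidWord M j i).map f).prod) (i : I) :
    monoidLift f h (M.gen i) = f i :=
  PresentedMonoid.lift_of f _

theorem exists_word (x : M.ArtinMonoid) : ∃ w : List I, x = (w.map M.gen).prod := by
  obtain ⟨w, rfl⟩ := PresentedMonoid.surjective_mk x
  exact ⟨w.toList, (prod_map_gen _).symm⟩

theorem monoidHom_ext {f g : M.ArtinMonoid →* N} (h : ∀ i, f (M.gen i) = g (M.gen i)) : f = g :=
  PresentedMonoid.ext _ h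

theorem gen_mul_induction {p : M.ArtinMonoid → Prop} (x : M.ArtinMonoid) (one : p 1)
    (mul : ∀ i x, p x → p (M.gen i * x)) : p x := by
  obtain ⟨w, rfl⟩ := exists_word x
  induction w with
  | nil => exact one
  | cons i w ih => simpa using mul i _ ih

theorem mul_gen_induction {p : M.ArtinMonoid → Prop} (x : M.ArtinMonoid) (one : p 1)
    (mul : ∀ i x, p x → p (x * M.gen i)) : p x := by
  obtain ⟨w, rfl⟩ := exists_word x
  induction w using List.reverseRecOn with
  | nil => exact one
  | append_singleton w i ih => simpa using mul i _ ih

variable (M) in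
/-- The word length on the Artin monoid. -/
def lenHom : M.ArtinMonoid →* Multiplicative ℕ :=
  monoidLift (fun _ ↦ Multiplicative.ofAdd 1) fun i j ↦ by
    simp [M.symmetric j i]

/-- The word length of an element of the Artin monoid. -/
def len (x : M.ArtinMonoid) : ℕ := (M.lenHom x).toAdd

@[simp] theorem len_one : len (1 : M.ArtinMonoid) = 0 := by simp [len]

@[simp] theorem len_mul (x y : M.ArtinMonoid) : len (x * y) = len x + len y := by simp [len]

@[simp] theorem len_gen (i : I) : len (M.gen i) = 1 := by simp [len, lenHom]

theorem eq_one_of_len {x : M.ArtinMonoid} (h : len x = 0) : x = 1 := by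
  induction x using gen_mul_induction with
  | one => rfl
  | mul i x _ => simp at h

theorem exists_eq_gen_mul {x : M.ArtinMonoid} (h : x ≠ 1) : ∃ i y, x = M.gen i * y := by
  induction x using gen_mul_induction with
  | one => exact absurd rfl h
  | mul i x _ => exact ⟨i, x, rfl⟩

theorem exists_eq_mul_gen {x : M.ArtinMonoid} (h : x ≠ 1) : ∃ i y, x = y * M.gen i := by
  induction x using mul_gen_induction with
  | one => exact absurd rfl h
  | mul i x _ => exact ⟨i, x, rfl⟩

variable (M) in
/-- Reversal of words, as an anti-homomorphism. -/
def revHom : M.ArtinMonoid →* M.ArtinMonoidᵐᵒᵖ :=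
  monoidLift (fun i ↦ MulOpposite.op (M.gen i)) fun i j ↦ by
    have h (w : List I) : (w.map fun i ↦ MulOpposite.op (M.gen i)).prod =
        MulOpposite.op (w.reverse.map M.gen).prod := by
      rw [MulOpposite.op_list_prod]
      simp [Function.comp_def]
    have e := prod_braidWord_gen (M := M) i j
    rw [h, h]
    congr 1
    simp only [braidWord] at e ⊢
    rw [reverse_alternatingWord, reverse_alternatingWord, M.symmetric j i] at *
    split_ifs
    · exact e.symm
    · exact e

/-- Reversal of words. -/
def rev (x : M.ArtinMonoid) : M.ArtinMonoid := (M.revHom x).unop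

@[simp] theorem rev_one : rev (1 : M.ArtinMonoid) = 1 := by simp [rev]

@[simp] theorem rev_mul (x y : M.ArtinMonoid) : rev (x * y) = rev y * rev x := by simp [rev]

@[simp] theorem rev_gen (i : I) : rev (M.gen i) = M.gen i := by simp [rev, revHom]

@[simp] theorem rev_rev (x : M.ArtinMonoid) : rev (rev x) = x := by
  induction x using gen_mul_induction with
  | one => simp
  | mul i x ih => simp [ih]

@[simp] theorem len_rev (x : M.ArtinMonoid) : len (rev x) = len x := by
  induction x using gen_mul_induction with
  | one => simp
  | mul i x ih => simp [ih, add_comm]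

variable (M) in
/-- The homomorphism from the Artin monoid to the Artin group. -/
def toArtinGroup : M.ArtinMonoid →* M.ArtinGroup :=
  monoidLift M.artinGen fun i j ↦ by
    have h : PresentedGroup.mk M.braidRelators
        (((braidWord M i j).map FreeGroup.of).prod *
          (((braidWord M j i).map FreeGroup.of).prod)⁻¹) = 1 :=
      (QuotientGroup.eq_one_iff _).2 (Subgroup.subset_normalClosure ⟨(i, j), rfl⟩)
    rw [map_mul, map_inv, mul_inv_eq_one, map_list_prod, map_list_prod, List.map_map,
      List.map_map] at h
    exact h

@[simp] theorem toArtinGroup_gen (i : I) : M.toArtinGroup (M.gen i) = M.artinGen i :=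
  monoidLift_gen _ _ i

variable (M) in
/-- The homomorphism from the Artin monoid to the reflection group. -/
def toReflectionGroup : M.ArtinMonoid →* M.reflectionGroup :=
  M.artinToReflection.comp M.toArtinGroup

@[simp] theorem artinToReflection_artinGen (i : I) :
    M.artinToReflection (M.artinGen i) = M.reflectionGen i :=
  PresentedGroup.toGroup.of M.braidRelators_reflectionGen

@[simp] theorem toReflectionGroup_gen (i : I) :
    M.toReflectionGroup (M.gen i) = M.reflectionGen i := by
  simp [toReflectionGroup]

theorem reflectionGen_mul_self (i : I) : M.reflectionGen i * M.reflectionGen i = 1 := by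
  have h := M.isLiftable_reflectionGen i i
  rwa [M.diagonal, pow_one] at h

theorem toReflectionGroup_rev (x : M.ArtinMonoid) :
    M.toReflectionGroup (rev x) = (M.toReflectionGroup x)⁻¹ := by
  induction x using gen_mul_induction with
  | one => simp
  | mul i x ih =>
    rw [rev_mul, map_mul, map_mul, mul_inv_rev, ih, rev_gen, toReflectionGroup_gen,
      ← eq_inv_of_mul_eq_one_left (reflectionGen_mul_self i)]

/-- Positive words suffice: the generators are involutions, so reversal supplies inverses. -/
theorem toReflectionGroup_surjective : Function.Surjective M.toReflectionGroup := by
  rintro ⟨w, hw⟩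
  induction hw using Subgroup.closure_induction with
  | mem w h =>
    obtain ⟨i, rfl⟩ := h
    exact ⟨M.gen i, by simp [reflectionGen]⟩
  | one => exact ⟨1, map_one _⟩
  | mul v w hv hw ihv ihw =>
    obtain ⟨x, hx⟩ := ihv
    obtain ⟨y, hy⟩ := ihw
    exact ⟨x * y, by rw [map_mul, hx, hy]; rfl⟩
  | inv w hw ih =>
    obtain ⟨x, hx⟩ := ih
    exact ⟨rev x, by rw [toReflectionGroup_rev, hx]; rfl⟩

/-! ### Diagram automorphisms -/

theorem apply_diagramAut (σ : M.diagramAut) (i j : I) : M (σ • i) (σ • j) = M i j := σ.2 i j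

variable (M) in
/-- The action of a diagram automorphism on the Artin monoid. -/
def monoidMap (σ : M.diagramAut) : M.ArtinMonoid →* M.ArtinMonoid :=
  monoidLift (fun i ↦ M.gen (σ • i)) fun i j ↦ by
    have e := prod_braidWord_gen (M := M) (σ • i) (σ • j)
    simp only [braidWord, apply_diagramAut, ← map_alternatingWord (σ • ·), List.map_map,
      Function.comp_def] at e
    exact e

@[simp] theorem monoidMap_gen (σ : M.diagramAut) (i : I) :
    M.monoidMap σ (M.gen i) = M.gen (σ • i) := by
  simp [monoidMap]

@[simp] theorem len_monoidMap (σ : M.diagramAut) (x : M.ArtinMonoid) :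
    len (M.monoidMap σ x) = len x := by
  induction x using gen_mul_induction with
  | one => simp
  | mul i x ih => simp [ih]

/-! ### Cancellation and least common multiples in simply laced Artin monoids -/

/-- All labels are `2` or `3`, and there are no triangles of edges. -/
structure IsSimplyLaced {I : Type*} (M : CoxeterMatrix I) : Prop where
  label : ∀ i j, i ≠ j → M i j = 2 ∨ M i j = 3
  no_triangle : ∀ i j k, M i j = 3 → M j k = 3 → M i k ≠ 3

variable {I : Type*} {M : CoxeterMatrix I}

theorem gen_comm {i j : I} (h : M i j = 2) : M.gen i * M.gen j = M.gen j * M.gen i := by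
  have e := prod_braidWord_gen (M := M) i j
  simpa [braidWord, M.symmetric j i, h, alternatingWord] using e

theorem gen_braid {i j : I} (h : M i j = 3) :
    M.gen i * (M.gen j * M.gen i) = M.gen j * (M.gen i * M.gen j) := by
  have e := prod_braidWord_gen (M := M) i j
  simpa [braidWord, M.symmetric j i, h, alternatingWord, mul_assoc] using e.symm

theorem gen_comm_assoc {i j : I} (h : M i j = 2) (x : M.ArtinMonoid) :
    M.gen i * (M.gen j * x) = M.gen j * (M.gen i * x) := by
  rw [← mul_assoc, gen_comm h, mul_assoc]

theorem gen_braid_assoc {i j : I} (h : M i j = 3) (x : M.ArtinMonoid) :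
    M.gen i * (M.gen j * (M.gen i * x)) = M.gen j * (M.gen i * (M.gen j * x)) := by
  have := congrArg (· * x) (gen_braid h)
  simpa [mul_assoc] using this

/-- The pair `(i, X)`, `(j, Y)` arises from a common right multiple of the least common multiple
of the generators `i` and `j`, after removing the leading letters. -/
inductive LcmPair (M : CoxeterMatrix I) : I → M.ArtinMonoid → I → M.ArtinMonoid → Prop
  | refl (i : I) (X : M.ArtinMonoid) : LcmPair M i X i X
  | comm (i j : I) (Z : M.ArtinMonoid) (h : M i j = 2) :
      LcmPair M i (M.gen j * Z) j (M.gen i * Z)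
  | braid (i j : I) (Z : M.ArtinMonoid) (h : M i j = 3) :
      LcmPair M i (M.gen j * (M.gen i * Z)) j (M.gen i * (M.gen j * Z))

namespace LcmPair

variable {i j k : I} {X Y Z : M.ArtinMonoid}

theorem symm (h : LcmPair M i X j Y) : LcmPair M j Y i X := by
  cases h with
  | refl => exact refl _ _
  | comm j Z h => exact comm _ _ _ (M.symmetric i j ▸ h)
  | braid j Z h => exact braid _ _ _ (M.symmetric i j ▸ h)

theorem mul_right (h : LcmPair M i X j Y) (z : M.ArtinMonoid) :
    LcmPair M i (X * z) j (Y * z) := by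
  cases h with
  | refl => exact refl _ _
  | comm j Z h => simpa only [mul_assoc] using comm i j (Z * z) h
  | braid j Z h => simpa only [mul_assoc] using braid i j (Z * z) h

theorem eq (h : LcmPair M i X j Y) : M.gen i * X = M.gen j * Y := by
  cases h with
  | refl => rfl
  | comm j Z h => exact gen_comm_assoc h Z
  | braid j Z h => exact gen_braid_assoc h Z

theorem eq_of_refl (h : LcmPair M i X i Y) : X = Y := by
  cases h with
  | refl => rfl
  | comm j Z h => simp at h
  | braid j Z h => simp at h

theorem of_label_two (h : LcmPair M i X j Y) (hij : M i j = 2) :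
    ∃ Z, X = M.gen j * Z ∧ Y = M.gen i * Z := by
  cases h with
  | refl => simp at hij
  | comm j Z h => exact ⟨Z, rfl, rfl⟩
  | braid j Z h => omega

theorem of_label_three (h : LcmPair M i X j Y) (hij : M i j = 3) :
    ∃ Z, X = M.gen j * (M.gen i * Z) ∧ Y = M.gen i * (M.gen j * Z) := by
  cases h with
  | refl => simp at hij
  | comm j Z h => omega
  | braid j Z h => exact ⟨Z, rfl, rfl⟩

/-- The mixed case of `trans`. The hypothesis `P` is Garside's lemma for shorter tails, used to peel
letters off the two factorizations of the middle word. If `i` and `k` are joined, then `i, k, j` is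
a path and the common multiple found is the six-letter one of type A₃. -/
theorem trans_comm_braid (n : ℕ)
    (P : ∀ i X j Y, len X < n → M.gen i * X = M.gen j * Y → LcmPair M i X j Y)
    (hM : M.IsSimplyLaced) {U V : M.ArtinMonoid} (hij : M i j = 2) (hjk : M j k = 3)
    (hU : len U < n) (h : M.gen i * U = M.gen k * (M.gen j * V)) :
    LcmPair M i (M.gen j * U) k (M.gen j * (M.gen k * V)) := by
  have hik : i ≠ k := by
    rintro rfl
    rw [M.symmetric] at hjk
    omega
  have hkj : M k j = 3 := M.symmetric j k ▸ hjk
  rcases hM.label i k hik with hik | hik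
  · obtain ⟨T, rfl, hT⟩ := (P _ _ _ _ hU h).of_label_two hik
    simp only [len_mul, len_gen] at hU
    have hl := congrArg len hT
    simp only [len_mul, len_gen] at hl
    obtain ⟨S, rfl, rfl⟩ := (P _ _ _ _ (by omega) hT.symm).of_label_two
      (M.symmetric i j ▸ hij)
    rw [gen_braid_assoc hjk, ← gen_comm_assoc hik, ← gen_comm_assoc hij]
    exact comm _ _ _ hik
  · have hki : M k i = 3 := M.symmetric i k ▸ hik
    obtain ⟨T, rfl, hT⟩ := (P _ _ _ _ hU h).of_label_three hik
    have hl := congrArg len hT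
    simp only [len_mul, len_gen] at hU hl
    obtain ⟨S, hS, rfl⟩ := (P _ _ _ _ (by simp; omega) hT.symm).of_label_two hij
    obtain ⟨Q, rfl, rfl⟩ := (P _ _ _ _ (by omega) hS).of_label_three hkj
    have e1 : M.gen j * (M.gen k * (M.gen i * (M.gen j * (M.gen k * Q)))) =
        M.gen k * (M.gen i * (M.gen j * (M.gen k * (M.gen i * Q)))) := by
      rw [gen_comm_assoc hij, gen_braid_assoc hjk, gen_braid_assoc hki, gen_comm_assoc hij]
    have e2 : M.gen j * (M.gen k * (M.gen i * (M.gen k * (M.gen j * Q)))) =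
        M.gen i * (M.gen k * (M.gen j * (M.gen k * (M.gen i * Q)))) := by
      rw [gen_braid_assoc hki, gen_comm_assoc hij Q, ← gen_comm_assoc hij, gen_braid_assoc hjk]
    rw [e1, e2]
    exact braid _ _ _ hik

/-- Since triangles are excluded, `i, j, k` is a path with middle node `j`. Peeling off letters with
`P` exhibits the six-letter common multiple of type A₃, which is then rewritten to start with `i k`
or `k i`. -/
theorem trans_braid_braid (n : ℕ)
    (P : ∀ i X j Y, len X < n → M.gen i * X = M.gen j * Y → LcmPair M i X j Y)
    (hM : M.IsSimplyLaced) {U V : M.ArtinMonoid} (hij : M i j = 3) (hjk : M j k = 3)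
    (hik : i ≠ k)
    (hU : len U + 1 < n) (h : M.gen i * (M.gen j * U) = M.gen k * (M.gen j * V)) :
    LcmPair M i (M.gen j * (M.gen i * U)) k (M.gen j * (M.gen k * V)) := by
  have hik := (hM.label i k hik).resolve_right (hM.no_triangle i j k hij hjk)
  have hji : M j i = 3 := M.symmetric i j ▸ hij
  have hkj : M k j = 3 := M.symmetric j k ▸ hjk
  have hki : M k i = 2 := M.symmetric i k ▸ hik
  have hl := congrArg len h
  simp only [len_mul, len_gen] at hl
  obtain ⟨T, h1, h2⟩ := (P _ _ _ _ (by simp; omega) h).of_label_two hik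
  obtain ⟨S, rfl, rfl⟩ := (P _ _ _ _ (by omega) h1).of_label_three hjk
  obtain ⟨Q, rfl, h3⟩ := (P _ _ _ _ (by omega) h2).of_label_three hji
  simp only [len_mul, len_gen] at hU hl
  have h4 := (P _ _ _ _ (by simp; omega) h3).eq_of_refl
  obtain ⟨O, rfl, rfl⟩ := (P _ _ _ _ (by omega) h4).of_label_two hki
  have e1 : M.gen j * (M.gen i * (M.gen k * (M.gen j * (M.gen i * O)))) =
      M.gen k * (M.gen j * (M.gen k * (M.gen i * (M.gen j * O)))) := by
    rw [gen_comm_assoc hik, gen_braid_assoc hij, gen_braid_assoc hjk]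
  have e2 : M.gen j * (M.gen k * (M.gen i * (M.gen j * (M.gen k * O)))) =
      M.gen i * (M.gen j * (M.gen k * (M.gen i * (M.gen j * O)))) := by
    rw [gen_comm_assoc hki, gen_braid_assoc hkj, gen_braid_assoc hji, gen_comm_assoc hik]
  rw [e1, e2]
  exact comm _ _ _ hik

theorem trans (n : ℕ)
    (P : ∀ i X j Y, len X < n → M.gen i * X = M.gen j * Y → LcmPair M i X j Y)
    (hM : M.IsSimplyLaced) (hX : len X ≤ n) (hXY : LcmPair M i X j Y)
    (hYZ : LcmPair M j Y k Z) : LcmPair M i X k Z := by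
  have hlen := congrArg len hXY.eq
  simp only [len_mul, len_gen] at hlen
  -- The middle tail gets a second name, so that the two case distinctions leave an equation between
  -- its two factorizations, to which `P` applies.
  obtain ⟨Y', hY'⟩ : ∃ Y', Y' = Y := ⟨Y, rfl⟩
  rw [← hY'] at hYZ
  cases hXY with
  | refl => exact hY' ▸ hYZ
  | comm j U hij =>
    cases hYZ with
    | refl => exact hY' ▸ comm i j U hij
    | comm k V hjk =>
      simp only [len_mul, len_gen] at hX
      by_cases hik : i = k
      · subst hik
        rw [(P _ _ _ _ (by
          have := congrArg len hY'
          simp only [len_mul, len_gen] at this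
          omega) hY').eq_of_refl]
        exact refl _ _
      have h := P _ _ _ _ (by omega) hY'.symm
      have hji : M j i = 2 := M.symmetric i j ▸ hij
      rcases hM.label i k hik with hik | hik
      · obtain ⟨T, rfl, rfl⟩ := h.of_label_two hik
        rw [gen_comm_assoc hjk, gen_comm_assoc hji]
        exact comm _ _ _ hik
      · obtain ⟨T, rfl, rfl⟩ := h.of_label_three hik
        rw [gen_comm_assoc hjk, gen_comm_assoc hji, gen_comm_assoc hji, gen_comm_assoc hjk]
        exact braid _ _ _ hik
    | braid k V hjk =>
      simp only [len_mul, len_gen] at hX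
      exact trans_comm_braid n P hM hij hjk (by omega) hY'.symm
  | braid j U hij =>
    simp only [len_mul, len_gen] at hX
    cases hYZ with
    | refl => exact hY' ▸ braid i j U hij
    | comm k V hjk =>
      have := congrArg len hY'
      simp only [len_mul, len_gen] at this
      exact (trans_comm_braid n P hM (M.symmetric k j ▸ hjk) (M.symmetric j i ▸ hij) (by omega)
        hY').symm
    | braid k V hjk =>
      by_cases hik : i = k
      · subst hik
        have := congrArg len hY'
        simp only [len_mul, len_gen] at this
        have h1 := (P _ _ _ _ (by simp; omega) hY').eq_of_refl
        rw [(P _ _ _ _ (by omega) h1).eq_of_refl]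
        exact refl _ _
      · exact trans_braid_braid n P hM hij hjk hik (by omega) hY'.symm

end LcmPair

/-- Two positive words are both empty, or their heads and tails form an `LcmPair`. -/
def WordPair (M : CoxeterMatrix I) (a b : FreeMonoid I) : Prop :=
  (a = 1 ∧ b = 1) ∨ ∃ i X j Y, a = FreeMonoid.of i * X ∧ b = FreeMonoid.of j * Y ∧
    LcmPair M i (PresentedMonoid.mk _ X) j (PresentedMonoid.mk _ Y)

theorem WordPair.refl (a : FreeMonoid I) : WordPair M a a := by
  cases a using FreeMonoid.casesOn with
  | one => exact Or.inl ⟨rfl, rfl⟩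
  | of_mul i X => exact Or.inr ⟨i, X, i, X, rfl, rfl, .refl _ _⟩

theorem len_mk (a : FreeMonoid I) : len (PresentedMonoid.mk M.BraidRel a) = a.length := by
  induction a with
  | one => simp
  | of i => exact len_gen i
  | mul a b ha hb => simp [ha, hb]

/-- Induction along the generation of the braid congruence. Only the transitivity rule is not
formal: there the bound on the length leaves tails of length at most `n`, as `LcmPair.trans`
requires. -/
theorem wordPair_of_rel (hM : M.IsSimplyLaced) (n : ℕ)
    (P : ∀ i X j Y, len X < n → M.gen i * X = M.gen j * Y → LcmPair M i X j Y)
    {a b : FreeMonoid I} (h : ConGen.Rel M.BraidRel a b) (hn : a.length ≤ n + 1) :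
    WordPair M a b := by
  induction h with
  | of a b h =>
    obtain ⟨i, j, rfl, rfl⟩ := h
    rcases eq_or_ne i j with rfl | hij
    · exact .refl _
    rcases hM.label i j hij with h | h
    · refine Or.inr ⟨i, .of j, j, .of i, ?_, ?_, ?_⟩
      · simp [braidWord, h, alternatingWord]
      · simp [braidWord, M.symmetric j i, h, alternatingWord]
      · simpa using! LcmPair.comm i j 1 h
    -- A braid word ends in its second letter, so with three letters it also begins with it; hence
    -- the order `j, i`.
    · refine Or.inr ⟨j, .of i * .of j, i, .of j * .of i, ?_, ?_, ?_⟩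
      · simp [braidWord, h, alternatingWord]
      · simp [braidWord, M.symmetric j i, h, alternatingWord]
      · simpa using! LcmPair.braid j i 1 (M.symmetric i j ▸ h)
  | refl a => exact .refl _
  | @symm a b h ih =>
    have hl : a.length = b.length := by
      rw [← len_mk (M := M), ← len_mk (M := M)]
      exact congrArg len (PresentedMonoid.mk_eq_mk_iff.2 h)
    rcases ih (hl ▸ hn) with ⟨rfl, rfl⟩ | ⟨i, X, j, Y, rfl, rfl, h'⟩
    · exact Or.inl ⟨rfl, rfl⟩
    · exact Or.inr ⟨j, Y, i, X, rfl, rfl, h'.symm⟩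
  | @trans a b c h1 h2 ih1 ih2 =>
    have hl : a.length = b.length := by
      rw [← len_mk (M := M), ← len_mk (M := M)]
      exact congrArg len (PresentedMonoid.mk_eq_mk_iff.2 h1)
    rcases ih1 hn with ⟨rfl, rfl⟩ | ⟨i, X, j, Y, rfl, rfl, h⟩
    · exact ih2 (hl ▸ hn)
    · rcases ih2 (hl ▸ hn) with ⟨h', _⟩ | ⟨j', Y', k, Z, h', rfl, h2⟩
      · exact absurd (congrArg FreeMonoid.length h') (by simp)
      · obtain ⟨rfl, rfl⟩ : j = j' ∧ Y = Y' := by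
          have := congrArg FreeMonoid.toList h'
          simpa using this
        refine Or.inr ⟨i, X, k, Z, rfl, rfl, LcmPair.trans n P hM ?_ h h2⟩
        rw [len_mk]
        simp only [FreeMonoid.length_mul, FreeMonoid.length_of] at hn
        omega
  | @mul a b c d h1 h2 ih1 ih2 =>
    simp only [FreeMonoid.length_mul] at hn
    rcases ih1 (by omega) with ⟨rfl, rfl⟩ | ⟨i, X, j, Y, rfl, rfl, h⟩
    · simpa using ih2 (by omega)
    · refine Or.inr ⟨i, X * c, j, Y * d, mul_assoc _ _ _, mul_assoc _ _ _, ?_⟩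
      rw [map_mul, map_mul, ← PresentedMonoid.mk_eq_mk_iff.2 h2]
      exact h.mul_right _

/-- Garside's lemma. -/
theorem IsSimplyLaced.lcmPair (hM : M.IsSimplyLaced) {i j : I} {X Y : M.ArtinMonoid}
    (h : M.gen i * X = M.gen j * Y) : LcmPair M i X j Y := by
  obtain ⟨n, hn⟩ : ∃ n, len X < n := ⟨_, Nat.lt_succ_self _⟩
  induction n generalizing i j X Y with
  | zero => omega
  | succ n ih =>
    obtain ⟨a, rfl⟩ := PresentedMonoid.surjective_mk X
    obtain ⟨b, rfl⟩ := PresentedMonoid.surjective_mk Y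
    have h' : PresentedMonoid.mk M.BraidRel (.of i * a) = PresentedMonoid.mk _ (.of j * b) := h
    rw [len_mk] at hn
    rcases wordPair_of_rel hM n (fun i X j Y hX h ↦ ih h hX) (PresentedMonoid.mk_eq_mk_iff.1 h')
      (by simp; omega) with ⟨h, _⟩ | ⟨i', X', j', Y', h1, h2, h⟩
    · exact absurd (congrArg FreeMonoid.length h) (by simp)
    · obtain ⟨rfl, rfl⟩ : i = i' ∧ a = X' := by simpa using congrArg FreeMonoid.toList h1
      obtain ⟨rfl, rfl⟩ : j = j' ∧ b = Y' := by simpa using congrArg FreeMonoid.toList h2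
      exact h

theorem IsSimplyLaced.mul_left_cancel (hM : M.IsSimplyLaced) {x y z : M.ArtinMonoid}
    (h : x * y = x * z) : y = z := by
  induction x using gen_mul_induction with
  | one => simpa using h
  | mul i x ih =>
    rw [mul_assoc, mul_assoc] at h
    exact ih (hM.lcmPair h).eq_of_refl

theorem IsSimplyLaced.mul_right_cancel (hM : M.IsSimplyLaced) {x y z : M.ArtinMonoid}
    (h : y * x = z * x) : y = z := by
  have := congrArg rev h
  rw [rev_mul, rev_mul] at this
  rw [← rev_rev y, hM.mul_left_cancel this, rev_rev]

/-! ### Roots of a simply laced diagram with positive definite form -/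

/-- All labels are `2` or `3`, and the canonical form is positive definite. -/
structure IsFiniteSimplyLaced {I : Type*} (M : CoxeterMatrix I) : Prop where
  label : ∀ i j, i ≠ j → M i j = 2 ∨ M i j = 3
  pos : ∀ x, x ≠ 0 → 0 < M.rootForm x x

/-- The simple root of a node. -/
abbrev root {I : Type*} (i : I) : I →₀ ℝ := Finsupp.single i 1

variable {I : Type*} {M : CoxeterMatrix I}

theorem rootForm_root_self (i : I) : M.rootForm (root i) (root i) = 1 := by
  rw [rootForm_single]
  simp

theorem rootForm_root_of_two {i j : I} (h : M i j = 2) : M.rootForm (root i) (root j) = 0 := by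
  rw [rootForm_single, h]
  simp

theorem rootForm_root_of_three {i j : I} (h : M i j = 3) :
    M.rootForm (root i) (root j) = -(1 / 2) := by
  rw [rootForm_single, h]
  simp

theorem simpleReflection_apply (i : I) (v : I →₀ ℝ) :
    M.simpleReflection i v = v - (2 * M.rootForm (root i) v) • root i := by
  rw [simpleReflection, Module.reflection_apply]
  simp

theorem rootForm_simpleReflection (i : I) (v w : I →₀ ℝ) :
    M.rootForm (M.simpleReflection i v) (M.simpleReflection i w) = M.rootForm v w := by
  simp only [simpleReflection_apply, map_sub, map_smul, LinearMap.sub_apply, LinearMap.smul_apply,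
    rootForm_root_self, smul_eq_mul, M.rootForm_comm v (root i)]
  ring

variable (M) in
/-- The action of the Artin monoid on the span of the simple roots. -/
def act : M.ArtinMonoid →* (I →₀ ℝ) ≃ₗ[ℝ] (I →₀ ℝ) :=
  M.reflectionGroup.subtype.comp M.toReflectionGroup

theorem act_gen (i : I) : M.act (M.gen i) = M.simpleReflection i := by
  simp [act, reflectionGen]

theorem act_mul_apply (x y : M.ArtinMonoid) (v : I →₀ ℝ) :
    M.act (x * y) v = M.act x (M.act y v) := by
  rw [map_mul, LinearEquiv.mul_apply]

theorem act_one_apply (v : I →₀ ℝ) : M.act 1 v = v := by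
  rw [map_one, LinearEquiv.coe_one, id]

theorem act_rev (x : M.ArtinMonoid) : M.act (rev x) = (M.act x)⁻¹ := by
  simp [act, toReflectionGroup_rev]

theorem act_eq_iff {x y : M.ArtinMonoid} :
    M.act x = M.act y ↔ M.toReflectionGroup x = M.toReflectionGroup y :=
  Subtype.ext_iff.symm

theorem act_gen_root_self (i : I) : M.act (M.gen i) (root i) = -root i := by
  rw [act_gen, simpleReflection_apply, rootForm_root_self]
  module

theorem act_gen_root_of_two {i j : I} (h : M i j = 2) : M.act (M.gen i) (root j) = root j := by
  rw [act_gen, simpleReflection_apply, rootForm_root_of_two h]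
  module

theorem act_gen_root_of_three {i j : I} (h : M i j = 3) :
    M.act (M.gen i) (root j) = root i + root j := by
  rw [act_gen, simpleReflection_apply, rootForm_root_of_three h]
  module

theorem rootForm_act (x : M.ArtinMonoid) (v w : I →₀ ℝ) :
    M.rootForm (M.act x v) (M.act x w) = M.rootForm v w := by
  induction x using gen_mul_induction with
  | one => simp only [act_one_apply]
  | mul i x ih => rw [act_mul_apply, act_mul_apply, act_gen, rootForm_simpleReflection, ih]

/-- The real vector with given integral coordinates. -/
def latticeVec : (I →₀ ℤ) →+ (I →₀ ℝ) := Finsupp.mapRange.addMonoidHom (Int.castAddHom ℝ)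

theorem latticeVec_apply (u : I →₀ ℤ) (i : I) : latticeVec u i = u i := by
  simp [latticeVec]

theorem latticeVec_single (i : I) (n : ℤ) : latticeVec (Finsupp.single i n) = (n : ℝ) • root i := by
  simp [latticeVec]

theorem latticeVec_ne_zero {u : I →₀ ℤ} (h : u ≠ 0) : latticeVec u ≠ 0 := by
  contrapose! h
  ext i
  have := DFunLike.congr_fun h i
  simpa [latticeVec_apply] using this

theorem IsFiniteSimplyLaced.two_mul_rootForm_root (hM : M.IsFiniteSimplyLaced) (i j : I) :
    ∃ n : ℤ, 2 * M.rootForm (root i) (root j) = n := by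
  rcases eq_or_ne i j with rfl | h
  · exact ⟨2, by rw [rootForm_root_self]; norm_num⟩
  rcases hM.label i j h with h | h
  · exact ⟨0, by rw [rootForm_root_of_two h]; norm_num⟩
  · exact ⟨-1, by rw [rootForm_root_of_three h]; norm_num⟩

theorem IsFiniteSimplyLaced.rootForm_root_nonpos (hM : M.IsFiniteSimplyLaced) {i j : I}
    (h : i ≠ j) : M.rootForm (root i) (root j) ≤ 0 := by
  rcases hM.label i j h with h | h
  · rw [rootForm_root_of_two h]
  · rw [rootForm_root_of_three h]; norm_num

theorem IsFiniteSimplyLaced.two_mul_rootForm_root_latticeVec (hM : M.IsFiniteSimplyLaced) (i : I)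
    (v : I →₀ ℤ) : ∃ n : ℤ, 2 * M.rootForm (root i) (latticeVec v) = n := by
  induction v using Finsupp.induction_linear with
  | zero => exact ⟨0, by simp⟩
  | add u v hu hv =>
    obtain ⟨m, hm⟩ := hu
    obtain ⟨n, hn⟩ := hv
    exact ⟨m + n, by rw [map_add, map_add, mul_add, hm, hn, Int.cast_add]⟩
  | single j a =>
    obtain ⟨n, hn⟩ := hM.two_mul_rootForm_root i j
    refine ⟨a * n, ?_⟩
    rw [latticeVec_single, map_smul, smul_eq_mul, Int.cast_mul, ← hn]
    ring

theorem IsFiniteSimplyLaced.two_mul_rootForm_latticeVec (hM : M.IsFiniteSimplyLaced)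
    (u v : I →₀ ℤ) : ∃ n : ℤ, 2 * M.rootForm (latticeVec u) (latticeVec v) = n := by
  induction u using Finsupp.induction_linear with
  | zero => exact ⟨0, by simp⟩
  | add u v hu hv =>
    obtain ⟨m, hm⟩ := hu
    obtain ⟨n, hn⟩ := hv
    exact ⟨m + n, by rw [map_add, map_add, LinearMap.add_apply, mul_add, hm, hn, Int.cast_add]⟩
  | single i a =>
    obtain ⟨n, hn⟩ := hM.two_mul_rootForm_root_latticeVec i v
    refine ⟨a * n, ?_⟩
    rw [latticeVec_single, map_smul, LinearMap.smul_apply, smul_eq_mul, Int.cast_mul, ← hn]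
    ring

theorem IsFiniteSimplyLaced.rootForm_latticeVec_self (hM : M.IsFiniteSimplyLaced)
    (u : I →₀ ℤ) : ∃ n : ℤ, M.rootForm (latticeVec u) (latticeVec u) = n := by
  induction u using Finsupp.induction_linear with
  | zero => exact ⟨0, by simp⟩
  | add u v hu hv =>
    obtain ⟨m, hm⟩ := hu
    obtain ⟨n, hn⟩ := hv
    obtain ⟨k, hk⟩ := hM.two_mul_rootForm_latticeVec u v
    refine ⟨m + n + k, ?_⟩
    rw [map_add, map_add, map_add, LinearMap.add_apply, LinearMap.add_apply, hm, hn,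
      M.rootForm_comm (latticeVec v), Int.cast_add, Int.cast_add, ← hk]
    ring
  | single i a =>
    refine ⟨a * a, ?_⟩
    rw [latticeVec_single, map_smul, map_smul, LinearMap.smul_apply, rootForm_root_self]
    simp

theorem IsFiniteSimplyLaced.one_le_rootForm_latticeVec (hM : M.IsFiniteSimplyLaced)
    {u : I →₀ ℤ} (hu : u ≠ 0) : 1 ≤ M.rootForm (latticeVec u) (latticeVec u) := by
  obtain ⟨n, hn⟩ := hM.rootForm_latticeVec_self u
  have h := hM.pos _ (latticeVec_ne_zero hu)
  rw [hn] at h ⊢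
  exact_mod_cast h

theorem rootForm_eq_sum (x y : I →₀ ℝ) :
    M.rootForm x y = x.sum fun i a ↦ y.sum fun j b ↦ a * (b * M.rootForm (root i) (root j)) := by
  conv_lhs => rw [← Finsupp.sum_single x, ← Finsupp.sum_single y]
  rw [Finsupp.sum, map_sum, LinearMap.sum_apply]
  refine Finset.sum_congr rfl fun i _ ↦ ?_
  rw [Finsupp.sum, map_sum]
  refine Finset.sum_congr rfl fun j _ ↦ ?_
  rw [← Finsupp.smul_single_one i, ← Finsupp.smul_single_one j, map_smul, map_smul,
    LinearMap.smul_apply, smul_eq_mul, smul_eq_mul]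
  ring

/-- Write `u = p - n` with nonnegative integral parts of disjoint support. Then `⟨p, n⟩ ≤ 0`,
because different simple roots have nonpositive inner product. If both parts were nonzero,
integrality would give `⟨u, u⟩ ≥ ⟨p, p⟩ + ⟨n, n⟩ ≥ 2`. -/
theorem IsFiniteSimplyLaced.sign_of_rootForm_eq_one (hM : M.IsFiniteSimplyLaced) (u : I →₀ ℤ)
    (hu : M.rootForm (latticeVec u) (latticeVec u) = 1) :
    0 ≤ latticeVec u ∨ latticeVec u ≤ 0 := by
  classical
  obtain ⟨p, hp⟩ : ∃ p : I →₀ ℤ, ∀ i, p i = max (u i) 0 :=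
    ⟨u.mapRange (fun a ↦ max a 0) (by simp), fun i ↦ by simp⟩
  obtain ⟨n, hn⟩ : ∃ n : I →₀ ℤ, ∀ i, n i = max (-u i) 0 :=
    ⟨u.mapRange (fun a ↦ max (-a) 0) (by simp), fun i ↦ by simp⟩
  have hpn : u = p - n := by
    ext i
    rw [Finsupp.sub_apply, hp, hn]
    omega
  by_cases hp0 : p = 0
  · right
    intro i
    rw [latticeVec_apply, hpn, hp0]
    simp [hn]
  by_cases hn0 : n = 0
  · left
    intro i
    rw [latticeVec_apply, hpn, hn0]
    simp [hp]
  exfalso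
  have h1 := hM.one_le_rootForm_latticeVec hp0
  have h2 := hM.one_le_rootForm_latticeVec hn0
  have h3 : M.rootForm (latticeVec p) (latticeVec n) ≤ 0 := by
    rw [rootForm_eq_sum]
    refine Finset.sum_nonpos fun i _ ↦ Finset.sum_nonpos fun j _ ↦ ?_
    rw [latticeVec_apply, latticeVec_apply, hp, hn]
    rcases eq_or_ne i j with rfl | hij
    · rcases le_total (u i) 0 with h | h
      · rw [max_eq_right h]; simp
      · rw [max_eq_right (by omega : -u i ≤ 0)]; simp
    · have a : (0 : ℝ) ≤ ((max (u i) 0 : ℤ) : ℝ) := by exact_mod_cast le_max_right _ _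
      have b : (0 : ℝ) ≤ ((max (-u j) 0 : ℤ) : ℝ) := by exact_mod_cast le_max_right _ _
      exact mul_nonpos_of_nonneg_of_nonpos a
        (mul_nonpos_of_nonneg_of_nonpos b (hM.rootForm_root_nonpos hij))
  rw [hpn, map_sub, map_sub, map_sub, LinearMap.sub_apply, LinearMap.sub_apply,
    M.rootForm_comm (latticeVec n) (latticeVec p)] at hu
  linarith

theorem IsFiniteSimplyLaced.act_latticeVec (hM : M.IsFiniteSimplyLaced) (x : M.ArtinMonoid)
    (u : I →₀ ℤ) : ∃ v, M.act x (latticeVec u) = latticeVec v := by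
  induction x using gen_mul_induction with
  | one => exact ⟨u, act_one_apply _⟩
  | mul i x ih =>
    obtain ⟨v, hv⟩ := ih
    obtain ⟨n, hn⟩ := hM.two_mul_rootForm_root_latticeVec i v
    exact ⟨v - Finsupp.single i n, by
      rw [act_mul_apply, hv, act_gen, simpleReflection_apply, hn, map_sub, latticeVec_single]⟩

theorem IsFiniteSimplyLaced.act_root_eq_latticeVec (hM : M.IsFiniteSimplyLaced)
    (x : M.ArtinMonoid) (i : I) : ∃ v, M.act x (root i) = latticeVec v := by
  simpa [latticeVec_single] using hM.act_latticeVec x (Finsupp.single i 1)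

/-- Every root is positive or negative. -/
theorem IsFiniteSimplyLaced.act_root_sign (hM : M.IsFiniteSimplyLaced) (x : M.ArtinMonoid)
    (i : I) : 0 ≤ M.act x (root i) ∨ M.act x (root i) ≤ 0 := by
  obtain ⟨v, hv⟩ := hM.act_root_eq_latticeVec x i
  rw [hv]
  refine hM.sign_of_rootForm_eq_one v ?_
  rw [← hv, rootForm_act, rootForm_root_self]

theorem root_ne_zero (i : I) : root i ≠ 0 := by simp [root]

theorem root_nonneg (i : I) : 0 ≤ root i := by
  intro j
  rcases eq_or_ne i j with rfl | h
  · simp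
  · simp [h]

theorem act_ne_zero (x : M.ArtinMonoid) {v : I →₀ ℝ} (hv : v ≠ 0) : M.act x v ≠ 0 :=
  (LinearEquiv.map_ne_zero_iff _).2 hv

theorem not_act_root_nonneg_and_nonpos (x : M.ArtinMonoid) (i : I)
    (h : 0 ≤ M.act x (root i)) (h' : M.act x (root i) ≤ 0) : False :=
  act_ne_zero x (root_ne_zero i) (le_antisymm h' h)

/-- The sum of the three simple roots of a triangle would have norm `3 - 6 · (1/2) = 0`. -/
theorem IsFiniteSimplyLaced.isSimplyLaced (hM : M.IsFiniteSimplyLaced) : M.IsSimplyLaced where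
  label := hM.label
  no_triangle i j k hij hjk hik := by
    have h := hM.pos (root i + root j + root k) (by
      intro h
      have h1 := DFunLike.congr_fun h i
      have h2 := root_nonneg j i
      have h3 := root_nonneg k i
      simp only [Finsupp.add_apply, Finsupp.single_eq_same, Finsupp.coe_zero, Pi.zero_apply]
        at h1 h2 h3
      linarith)
    simp only [map_add, LinearMap.add_apply, rootForm_root_self, M.rootForm_comm (root j) (root i),
      M.rootForm_comm (root k) (root i), M.rootForm_comm (root k) (root j),
      rootForm_root_of_three hij, rootForm_root_of_three hjk, rootForm_root_of_three hik] at h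
    norm_num at h

/-- The form is nondegenerate, so it represents the height functional. The resulting vector serves
to bound lengths in `exists_bound`. -/
theorem IsFiniteSimplyLaced.exists_height [Finite I] (hM : M.IsFiniteSimplyLaced) :
    ∃ v : I →₀ ℝ, ∀ i, M.rootForm v (root i) = 1 := by
  have hinj : Function.Injective M.rootForm := by
    rw [injective_iff_map_eq_zero]
    intro x hx
    by_contra h
    have := hM.pos x h
    rw [hx] at this
    simp at this
  have hsurj := (LinearMap.injective_iff_surjective_of_finrank_eq_finrank
    (Subspace.dual_finrank_eq (K := ℝ) (V := I →₀ ℝ)).symm).1 hinj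
  obtain ⟨v, hv⟩ := hsurj (Finsupp.linearCombination ℝ fun _ ↦ (1 : ℝ))
  exact ⟨v, fun i ↦ by rw [hv]; simp⟩

/-! ### Reduced elements -/

/-- Elements of the Artin monoid built by multiplying with generators from the right, each of which
increases the number of inversions. -/
inductive Red (M : CoxeterMatrix I) : M.ArtinMonoid → Prop
  | one : Red M 1
  | mul_gen {x : M.ArtinMonoid} {i : I} (hx : Red M x) (h : 0 ≤ M.act x (root i)) :
      Red M (x * M.gen i)

theorem act_mul_gen_root_self (x : M.ArtinMonoid) (i : I) :
    M.act (x * M.gen i) (root i) = -M.act x (root i) := by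
  rw [act_mul_apply, act_gen_root_self, map_neg]

/-- The exchange property, inside the monoid. If the last letter of `x` is `j ≠ i`, the signs of the
images of the roots spanned by `i` and `j` force further letters from this pair at the end of `x`,
until one commutation or braid move brings `i` to the end. -/
theorem IsFiniteSimplyLaced.exists_red_mul_gen (hM : M.IsFiniteSimplyLaced) {x : M.ArtinMonoid}
    (hx : Red M x) {i : I} (h : M.act x (root i) ≤ 0) :
    ∃ y, Red M y ∧ x = y * M.gen i := by
  obtain ⟨n, hn⟩ : ∃ n, len x < n := ⟨_, Nat.lt_succ_self _⟩
  induction n generalizing x i with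
  | zero => omega
  | succ n ih =>
    cases hx with
    | one =>
      rw [act_one_apply] at h
      exact absurd (le_antisymm h (root_nonneg i)) (root_ne_zero i)
    | @mul_gen y j hy hj =>
      simp only [len_mul, len_gen] at hn
      rcases eq_or_ne j i with rfl | hij
      · exact ⟨y, hy, rfl⟩
      rw [act_mul_apply] at h
      rcases hM.label j i hij with hji | hji
      · rw [act_gen_root_of_two hji] at h
        obtain ⟨z, hz, rfl⟩ := ih hy h (by omega)
        refine ⟨z * M.gen j, hz.mul_gen ?_, by rw [mul_assoc, mul_assoc, gen_comm hji]⟩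
        rwa [act_mul_apply, act_gen_root_of_two (M.symmetric i j ▸ hji)] at hj
      · have hij' : M i j = 3 := M.symmetric i j ▸ hji
        rw [act_gen_root_of_three hji, map_add] at h
        -- Here `y` makes the sum of the roots of `j` and `i` negative and keeps that of `j`
        -- positive, so it makes that of `i` negative.
        have hyi : M.act y (root i) ≤ 0 := by
          refine le_trans ?_ h
          simpa using hj
        obtain ⟨z, hz, rfl⟩ := ih hy hyi (by omega)
        rw [act_mul_apply, act_gen_root_of_three hij', map_add] at hj
        rw [act_mul_apply, act_mul_apply, act_gen_root_of_three hij', act_gen_root_self, ← map_add,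
          add_neg_cancel_comm] at h
        simp only [len_mul, len_gen] at hn
        obtain ⟨u, hu, rfl⟩ := ih hz h (by omega)
        rw [act_mul_gen_root_self, neg_nonpos] at h
        rw [act_mul_gen_root_self, act_mul_apply, act_gen_root_of_three hji, map_add,
          add_neg_cancel_comm] at hj
        -- At this point `x = u j i j`, which equals `u i j i`.
        refine ⟨u * M.gen i * M.gen j, (hu.mul_gen hj).mul_gen ?_, ?_⟩
        · rw [act_mul_apply, act_gen_root_of_three hij', map_add]
          exact add_nonneg hj h
        · simp only [mul_assoc]
          rw [gen_braid hij']

theorem act_mul_gen_cancel {x y : M.ArtinMonoid} {i : I}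
    (h : M.act (x * M.gen i) = M.act (y * M.gen i)) : M.act x = M.act y := by
  rw [map_mul, map_mul] at h
  exact mul_right_cancel h

/-- Matsumoto's theorem in this setting. Whether a reduced element can end in `i` is read off from
its action on the root of `i`, so equal actions allow the same last letter, which is then cancelled.
-/
theorem IsFiniteSimplyLaced.red_ext (hM : M.IsFiniteSimplyLaced) {x y : M.ArtinMonoid}
    (hx : Red M x) (hy : Red M y) (h : M.act x = M.act y) : x = y := by
  induction hx generalizing y with
  | one =>
    cases hy with
    | one => rfl
    | @mul_gen z i hz hi =>
      have e := act_mul_gen_root_self z i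
      rw [← h, act_one_apply] at e
      rw [← neg_nonpos, ← e] at hi
      exact absurd (le_antisymm hi (root_nonneg i)) (root_ne_zero i)
  | @mul_gen x i hx hi ih =>
    have e := act_mul_gen_root_self x i
    rw [h] at e
    obtain ⟨z, hz, rfl⟩ := hM.exists_red_mul_gen hy (by rw [e]; simpa using hi)
    rw [ih hz (act_mul_gen_cancel h)]

theorem act_mul_gen_mul_gen (x : M.ArtinMonoid) (i : I) :
    M.act (x * M.gen i * M.gen i) = M.act x := by
  rw [act_eq_iff]
  simp [mul_assoc, reflectionGen_mul_self]

/-- The deletion property: a new last letter that fails to keep the word reduced cancels, in the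
reflection group, against an equal last letter obtained by exchange. -/
theorem IsFiniteSimplyLaced.red_or_exists (hM : M.IsFiniteSimplyLaced) (x : M.ArtinMonoid) :
    Red M x ∨ ∃ z, Red M z ∧ M.act z = M.act x ∧ len z < len x := by
  induction x using mul_gen_induction with
  | one => exact Or.inl .one
  | mul i x ih =>
    rcases ih with h | ⟨z, hz, hzx, hl⟩
    · rcases hM.act_root_sign x i with hi | hi
      · exact Or.inl (h.mul_gen hi)
      · obtain ⟨y, hy, rfl⟩ := hM.exists_red_mul_gen h hi
        exact Or.inr ⟨y, hy, (act_mul_gen_mul_gen y i).symm, by simp⟩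
    · right
      rcases hM.act_root_sign z i with hi | hi
      · exact ⟨_, hz.mul_gen hi, by rw [map_mul, hzx, ← map_mul], by simpa using hl⟩
      · obtain ⟨y, hy, rfl⟩ := hM.exists_red_mul_gen hz hi
        refine ⟨y, hy, ?_, by simp at hl ⊢; omega⟩
        rw [map_mul M.act x, ← hzx, ← map_mul, act_mul_gen_mul_gen]

theorem IsFiniteSimplyLaced.exists_red (hM : M.IsFiniteSimplyLaced) (x : M.ArtinMonoid) :
    ∃ z, Red M z ∧ M.act z = M.act x ∧ len z ≤ len x := by
  rcases hM.red_or_exists x with h | ⟨z, hz, h, hl⟩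
  · exact ⟨x, h, rfl, le_rfl⟩
  · exact ⟨z, hz, h, hl.le⟩

/-- Reduced elements are the shortest lifts. In this form the notion is visibly symmetric, hence
stable under reversal and under passing to left and right factors. -/
theorem IsFiniteSimplyLaced.red_iff (hM : M.IsFiniteSimplyLaced) {x : M.ArtinMonoid} :
    Red M x ↔ ∀ z, M.act z = M.act x → len x ≤ len z := by
  constructor
  · intro hx z hz
    obtain ⟨z', hz', h, hl⟩ := hM.exists_red z
    rwa [hM.red_ext hx hz' (by rw [h, hz])]
  · intro h
    rcases hM.red_or_exists x with h' | ⟨z, hz, h', hl⟩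
    · exact h'
    · exact absurd (h z h') (by omega)

theorem IsFiniteSimplyLaced.red_rev (hM : M.IsFiniteSimplyLaced) {x : M.ArtinMonoid}
    (hx : Red M x) : Red M (rev x) := by
  rw [hM.red_iff] at hx ⊢
  intro z hz
  have := hx (rev z) (by rw [act_rev, hz, act_rev, inv_inv])
  simpa using this

theorem IsFiniteSimplyLaced.red_left (hM : M.IsFiniteSimplyLaced) {x y : M.ArtinMonoid}
    (h : Red M (x * y)) : Red M x := by
  rw [hM.red_iff] at h ⊢
  intro z hz
  have := h (z * y) (by rw [map_mul, hz, map_mul])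
  simpa using this

theorem IsFiniteSimplyLaced.red_right (hM : M.IsFiniteSimplyLaced) {x y : M.ArtinMonoid}
    (h : Red M (x * y)) : Red M y := by
  rw [hM.red_iff] at h ⊢
  intro z hz
  have := h (x * z) (by rw [map_mul, hz, map_mul])
  simpa using this

theorem IsFiniteSimplyLaced.act_root_nonneg_of_red (hM : M.IsFiniteSimplyLaced)
    {x : M.ArtinMonoid} {i : I} (h : Red M (x * M.gen i)) : 0 ≤ M.act x (root i) := by
  rcases hM.act_root_sign x i with hi | hi
  · exact hi
  · obtain ⟨y, hy, rfl⟩ := hM.exists_red_mul_gen (hM.red_left h) hi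
    have := hM.red_iff.1 h y (act_mul_gen_mul_gen y i).symm
    simp at this

theorem IsFiniteSimplyLaced.act_root_nonpos_of_red (hM : M.IsFiniteSimplyLaced)
    {x : M.ArtinMonoid} {i : I} (h : Red M (x * M.gen i)) :
    M.act (x * M.gen i) (root i) ≤ 0 := by
  rw [act_mul_gen_root_self, neg_nonpos]
  exact hM.act_root_nonneg_of_red h

/-! ### Diagram automorphisms acting on roots and reduced elements -/

/-- The linear map that permutes the simple roots by a diagram automorphism. -/
def permLin (σ : M.diagramAut) : (I →₀ ℝ) ≃ₗ[ℝ] (I →₀ ℝ) :=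
  Finsupp.domLCongr (σ : Equiv.Perm I)

@[simp]
theorem permLin_root (σ : M.diagramAut) (i : I) : permLin σ (root i) = root (σ • i) := by
  simp [permLin, root, Subgroup.smul_def]

theorem permLin_one : permLin (1 : M.diagramAut) = 1 := by
  ext v
  simp [permLin]
  rfl

theorem permLin_mul (σ τ : M.diagramAut) : permLin (σ * τ) = permLin σ * permLin τ := by
  apply LinearEquiv.toLinearMap_injective
  apply Finsupp.lhom_ext'
  intro i
  ext1
  simp only [LinearMap.comp_apply, Finsupp.lsingle_apply, LinearEquiv.coe_coe,
    LinearEquiv.mul_apply]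
  rw [permLin_root, permLin_root, permLin_root, mul_smul]

theorem permLin_nonneg (σ : M.diagramAut) {v : I →₀ ℝ} (hv : 0 ≤ v) : 0 ≤ permLin σ v := by
  intro i
  simpa [permLin] using hv _

theorem permLin_nonpos (σ : M.diagramAut) {v : I →₀ ℝ} (hv : v ≤ 0) : permLin σ v ≤ 0 := by
  intro i
  simpa [permLin] using hv _

theorem rootForm_permLin (σ : M.diagramAut) (v w : I →₀ ℝ) :
    M.rootForm (permLin σ v) (permLin σ w) = M.rootForm v w := by
  suffices h : M.rootForm.compl₁₂ (permLin σ).toLinearMap (permLin σ).toLinearMap = M.rootForm by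
    conv_rhs => rw [← h]
    rfl
  apply Finsupp.lhom_ext'
  intro i
  ext1
  apply Finsupp.lhom_ext'
  intro j
  ext1
  simp only [LinearMap.comp_apply, Finsupp.lsingle_apply, LinearEquiv.coe_coe,
    LinearMap.compl₁₂_apply]
  rw [permLin_root, permLin_root, rootForm_single, rootForm_single, apply_diagramAut]

theorem simpleReflection_smul (σ : M.diagramAut) (i : I) (v : I →₀ ℝ) :
    M.simpleReflection (σ • i) (permLin σ v) = permLin σ (M.simpleReflection i v) := by
  rw [simpleReflection_apply, simpleReflection_apply, ← permLin_root, rootForm_permLin, map_sub,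
    map_smul]

theorem act_monoidMap (σ : M.diagramAut) (x : M.ArtinMonoid) (v : I →₀ ℝ) :
    M.act (M.monoidMap σ x) (permLin σ v) = permLin σ (M.act x v) := by
  induction x using gen_mul_induction with
  | one => simp
  | mul i x ih =>
    rw [map_mul, act_mul_apply, act_mul_apply, ih, monoidMap_gen, act_gen, act_gen,
      simpleReflection_smul]

theorem Red.monoidMap {x : M.ArtinMonoid} (hx : Red M x) (σ : M.diagramAut) :
    Red M (M.monoidMap σ x) := by
  induction hx with
  | one => rw [map_one]; exact .one
  | @mul_gen x i hx hi ih =>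
    rw [map_mul, monoidMap_gen]
    refine ih.mul_gen ?_
    rw [← permLin_root, act_monoidMap]
    exact permLin_nonneg σ hi

/-- For the height vector `v`, each letter of a reduced `x` lowers `⟨v, x v⟩` by twice the height of
a positive root, hence by at least 2. On the other hand `⟨v + x v, v + x v⟩ ≥ 0` gives `⟨v, x v⟩ ≥
-⟨v, v⟩`, so the length is at most `⟨v, v⟩`. -/
theorem IsFiniteSimplyLaced.exists_bound [Finite I] (hM : M.IsFiniteSimplyLaced) :
    ∃ n : ℕ, ∀ x, Red M x → len x ≤ n := by
  obtain ⟨v, hv⟩ := hM.exists_height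
  have hsum (y : I →₀ ℝ) : M.rootForm v y = y.sum fun _ b ↦ b := by
    conv_lhs => rw [← Finsupp.sum_single y]
    rw [Finsupp.sum, map_sum]
    refine Finset.sum_congr rfl fun j _ ↦ ?_
    rw [← Finsupp.smul_single_one j, map_smul, hv]
    simp
  have key (x : M.ArtinMonoid) (hx : Red M x) :
      M.rootForm v (M.act x v) ≤ M.rootForm v v - 2 * len x := by
    induction hx with
    | one => simp
    | @mul_gen x i hx hi ih =>
      obtain ⟨u, hu⟩ := hM.act_root_eq_latticeVec x i
      have h1 : 1 ≤ M.rootForm v (M.act x (root i)) := by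
        have hne := act_ne_zero x (root_ne_zero i)
        rw [hsum]
        obtain ⟨j, hj⟩ := DFunLike.ne_iff.1 hne
        refine le_trans ?_ (Finset.single_le_sum (fun k _ ↦ hi k) (Finsupp.mem_support_iff.2 hj))
        have hij := hi j
        rw [hu, latticeVec_apply] at hj hij ⊢
        simp only [Finsupp.coe_zero, Pi.zero_apply] at hj hij
        have : 0 < u j := lt_of_le_of_ne (by exact_mod_cast hij) (by
          intro h
          rw [← h] at hj
          simp at hj)
        exact_mod_cast this
      rw [act_mul_apply, act_gen, simpleReflection_apply, M.rootForm_comm (root i) v, hv, map_sub,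
        map_smul, map_sub, map_smul, smul_eq_mul, len_mul, len_gen]
      push_cast
      linarith
  obtain ⟨n, hn⟩ := exists_nat_ge (M.rootForm v v)
  refine ⟨n, fun x hx ↦ ?_⟩
  have h1 := key x hx
  have h2 : 0 ≤ M.rootForm (v + M.act x v) (v + M.act x v) := by
    by_cases h : v + M.act x v = 0
    · simp [h]
    · exact (hM.pos _ h).le
  simp only [map_add, LinearMap.add_apply, rootForm_act, M.rootForm_comm (M.act x v) v] at h2
  have : (len x : ℝ) ≤ n := by linarith
  exact_mod_cast this

section

variable {I : Type*} {M : CoxeterMatrix I}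

/-- The two sides of a braid relation start with the two generators. -/
theorem exists_gen_mul_eq_braidWord {J : Type*} {N : CoxeterMatrix J} {k l : J}
    (h : N k l ≠ 0) : ∃ u v : N.ArtinMonoid,
      N.gen k * u = ((braidWord N k l).map N.gen).prod ∧ N.gen k * u = N.gen l * v := by
  obtain ⟨n, hn⟩ := Nat.exists_eq_succ_of_ne_zero h
  have e := prod_braidWord_gen (M := N) k l
  have e' := e
  simp only [braidWord, N.symmetric l k] at e e' ⊢
  rw [hn, Nat.succ_eq_add_one, CoxeterSystem.alternatingWord_succ',
    CoxeterSystem.alternatingWord_succ'] at e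
  simp only [List.map_cons, List.prod_cons] at e
  rw [hn, Nat.succ_eq_add_one, CoxeterSystem.alternatingWord_succ'] at e' ⊢
  split_ifs at e e' ⊢
  · exact ⟨_, _, e.symm, e.symm⟩
  · exact ⟨_, _, rfl, e⟩

/-! ### The Garside element -/

/-- A reduced element that makes all simple roots negative. -/
structure IsGarside (D : M.ArtinMonoid) : Prop where
  red : Red M D
  neg : ∀ i, M.act D (root i) ≤ 0

theorem map_nonpos_of_nonneg {F : Type*} [FunLike F (I →₀ ℝ) (I →₀ ℝ)]
    [LinearMapClass F ℝ (I →₀ ℝ) (I →₀ ℝ)] (f : F) (h : ∀ i, f (root i) ≤ 0) {v : I →₀ ℝ}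
    (hv : 0 ≤ v) : f v ≤ 0 := by
  rw [← Finsupp.sum_single v, Finsupp.sum, map_sum]
  refine Finset.sum_nonpos fun i _ ↦ ?_
  rw [← Finsupp.smul_single_one i, map_smul]
  intro j
  exact mul_nonpos_of_nonneg_of_nonpos (hv i) (h i j)

/-- Take a reduced element of maximal length: a simple root with positive image would allow one more
letter. -/
theorem IsFiniteSimplyLaced.exists_isGarside [Finite I] (hM : M.IsFiniteSimplyLaced) :
    ∃ D : M.ArtinMonoid, IsGarside D := by
  obtain ⟨n, hn⟩ := hM.exists_bound
  have hb : BddAbove (len '' {x | Red M x}) := ⟨n, by rintro _ ⟨x, hx, rfl⟩; exact hn x hx⟩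
  obtain ⟨D, hD, h⟩ := Nat.sSup_mem (Set.Nonempty.image len (s := {x | Red M x}) ⟨1, Red.one⟩) hb
  change Red M D at hD
  refine ⟨D, hD, fun i ↦ (hM.act_root_sign D i).resolve_left fun hi ↦ ?_⟩
  have := le_csSup hb ⟨_, hD.mul_gen hi, rfl⟩
  rw [← h, len_mul, len_gen] at this
  omega

/-- Letters of `y` are split off from the right. If `D = z y` and `i y` is reduced, then `y⁻¹` keeps
the root of `i` positive, so `z = D y⁻¹` makes it negative and `z` ends in `i`. -/
theorem IsGarside.exists_eq_mul (hM : M.IsFiniteSimplyLaced) {D y : M.ArtinMonoid}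
    (hD : IsGarside D) (hy : Red M y) : ∃ z, D = z * y := by
  induction y using gen_mul_induction with
  | one => exact ⟨D, (mul_one D).symm⟩
  | mul i y ih =>
    obtain ⟨z, hz⟩ := ih (hM.red_right hy)
    have h1 : Red M (rev y * M.gen i) := by simpa using hM.red_rev hy
    have h2 : M.act z (root i) = M.act D (M.act (rev y) (root i)) := by
      rw [hz, act_mul_apply, ← act_mul_apply y, map_mul, act_rev, mul_inv_cancel]
      rfl
    have h3 : M.act z (root i) ≤ 0 := by
      rw [h2]
      exact map_nonpos_of_nonneg _ hD.neg (hM.act_root_nonneg_of_red h1)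
    obtain ⟨w, -, rfl⟩ := hM.exists_red_mul_gen (hM.red_left (hz ▸ hD.red)) h3
    exact ⟨w, by rw [hz, mul_assoc]⟩

/-- Uniqueness of the longest reduced element, whence its invariance under reversal and diagram
automorphisms. -/
theorem IsGarside.eq_of_len_le (hM : M.IsFiniteSimplyLaced) {D y : M.ArtinMonoid}
    (hD : IsGarside D) (hy : Red M y) (h : len D ≤ len y) : y = D := by
  obtain ⟨z, rfl⟩ := hD.exists_eq_mul hM hy
  rw [len_mul] at h
  rw [eq_one_of_len (x := z) (by omega), one_mul]

theorem IsGarside.rev_eq (hM : M.IsFiniteSimplyLaced) {D : M.ArtinMonoid} (hD : IsGarside D) :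
    rev D = D :=
  hD.eq_of_len_le hM (hM.red_rev hD.red) (len_rev D).ge

theorem IsGarside.monoidMap_eq (hM : M.IsFiniteSimplyLaced) {D : M.ArtinMonoid}
    (hD : IsGarside D) (σ : M.diagramAut) : M.monoidMap σ D = D :=
  hD.eq_of_len_le hM (hD.red.monoidMap σ) (len_monoidMap σ D).ge

/-- Conjugation by `D` maps generators to generators. Write `D = i x`. The shorter `x` is not a
Garside element, so some `x j` is reduced; it has the length of `D` and hence equals `D`. Therefore
`i D = i x j = D j`; reversing gives the claim. -/
theorem IsGarside.exists_mul_gen (hM : M.IsFiniteSimplyLaced) {D : M.ArtinMonoid}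
    (hD : IsGarside D) (i : I) : ∃ j, D * M.gen i = M.gen j * D := by
  obtain ⟨x, -, hx⟩ := hM.exists_red_mul_gen hD.red (hD.neg i)
  have hr : D = M.gen i * rev x := by
    conv_lhs => rw [← hD.rev_eq hM, hx]
    simp
  have hred : Red M (rev x) := hM.red_right (hr ▸ hD.red)
  obtain ⟨j, hj⟩ : ∃ j, 0 ≤ M.act (rev x) (root j) := by
    by_contra! h
    have hG : IsGarside (rev x) :=
      ⟨hred, fun j ↦ (hM.act_root_sign _ j).resolve_left (h j)⟩
    have := hG.eq_of_len_le hM hD.red (by rw [hr]; simp)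
    have := congrArg len this
    rw [hr] at this
    simp at this
  have e := hD.eq_of_len_le hM (hred.mul_gen hj) (by rw [hr]; simp [add_comm])
  refine ⟨j, ?_⟩
  have e2 : M.gen i * D = D * M.gen j := by
    conv_lhs => rw [← e, ← mul_assoc, ← hr]
  have := congrArg rev e2
  rwa [rev_mul, rev_mul, hD.rev_eq hM, rev_gen, rev_gen] at this

theorem IsGarside.exists_mul (hM : M.IsFiniteSimplyLaced) {D : M.ArtinMonoid}
    (hD : IsGarside D) (x : M.ArtinMonoid) : ∃ y, D * x = y * D := by
  induction x using mul_gen_induction with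
  | one => exact ⟨1, by simp⟩
  | mul i x ih =>
    obtain ⟨y, hy⟩ := ih
    obtain ⟨j, hj⟩ := hD.exists_mul_gen hM i
    exact ⟨y * M.gen j, by rw [← mul_assoc, hy, mul_assoc, hj, mul_assoc]⟩

theorem IsGarside.exists_pow_mul (hM : M.IsFiniteSimplyLaced) {D : M.ArtinMonoid}
    (hD : IsGarside D) (k : ℕ) (i : I) : ∃ j, D ^ k * M.gen i = M.gen j * D ^ k := by
  induction k with
  | zero => exact ⟨i, by simp⟩
  | succ k ih =>
    obtain ⟨j, hj⟩ := ih
    obtain ⟨l, hl⟩ := hD.exists_mul_gen hM j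
    exact ⟨l, by rw [pow_succ', mul_assoc, hj, ← mul_assoc, hl, mul_assoc]⟩

theorem red_gen (i : I) : Red M (M.gen i) := by
  have := Red.one.mul_gen (M := M) (i := i) (by rw [act_one_apply]; exact root_nonneg i)
  rwa [one_mul] at this

/-- One more factor `D` absorbs one more letter: if `Dᵏ = y x`, `Dᵏ i = j Dᵏ` and `D = z j`, then
`Dᵏ⁺¹ = z j Dᵏ = z Dᵏ i = z y x i`. This yields the common left multiples of the Ore condition. -/
theorem IsGarside.exists_pow_eq_mul (hM : M.IsFiniteSimplyLaced) {D : M.ArtinMonoid}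
    (hD : IsGarside D) (x : M.ArtinMonoid) : ∃ k y, D ^ k = y * x := by
  induction x using mul_gen_induction with
  | one => exact ⟨0, 1, by simp⟩
  | mul i x ih =>
    obtain ⟨k, y, hy⟩ := ih
    obtain ⟨j, hj⟩ := hD.exists_pow_mul hM k i
    obtain ⟨z, hz⟩ := hD.exists_eq_mul hM (red_gen j)
    refine ⟨k + 1, z * y, ?_⟩
    rw [pow_succ']
    conv_lhs => rw [hz]
    rw [mul_assoc, ← hz, ← hj, hy, mul_assoc, mul_assoc]

/-! ### Passage to the Artin group -/

/-- A cancellative monoid with common left multiples embeds into a group: homomorphisms to groups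
separate its elements. -/
theorem exists_injective_group_of_ore.{u} (N : Type u) [Monoid N]
    (hl : ∀ x y z : N, x * y = x * z → y = z) (hr : ∀ x y z : N, y * x = z * x → y = z)
    (ho : ∀ x y : N, ∃ u v, u * x = v * y) :
    ∃ (G : Type u) (_ : Group G) (f : N →* G), Function.Injective f := by
  choose u v huv using ho
  let _ : OreLocalization.OreSet (⊤ : Submonoid N) :=
    { ore_right_cancel := fun a b s h ↦ ⟨1, by rw [hr _ _ _ h]⟩
      oreNum := fun r s ↦ v r s
      oreDenom := fun r s ↦ ⟨u r s, trivial⟩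
      ore_eq := fun r s ↦ huv r s }
  have hu (x : N) : IsUnit (OreLocalization.numeratorHom (S := (⊤ : Submonoid N)) x) :=
    OreLocalization.numerator_isUnit (⟨x, trivial⟩ : (⊤ : Submonoid N))
  refine ⟨(OreLocalization (⊤ : Submonoid N) N)ˣ, inferInstance,
    IsUnit.liftRight OreLocalization.numeratorHom hu, fun x y h ↦ ?_⟩
  have h1 := congrArg Units.val h
  rw [IsUnit.coe_liftRight, IsUnit.coe_liftRight, OreLocalization.numeratorHom_apply,
    OreLocalization.numeratorHom_apply, OreLocalization.oreDiv_eq_iff] at h1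
  obtain ⟨s, t, h2, h3⟩ := h1
  simp only [OneMemClass.coe_one, mul_one] at h3
  subst h3
  exact (hl _ _ _ h2).symm

/-- The universal property of the Artin group, in terms of the Artin monoid. -/
def groupLift {G : Type*} [Group G] (f : M.ArtinMonoid →* G) : M.ArtinGroup →* G :=
  PresentedGroup.toGroup (f := fun i ↦ f (M.gen i)) (by
    rintro _ ⟨⟨i, j⟩, rfl⟩
    have e := congrArg f (prod_braidWord_gen (M := M) i j)
    rw [map_list_prod, map_list_prod, List.map_map, List.map_map] at e
    rw [map_mul, map_inv, mul_inv_eq_one, map_list_prod, map_list_prod, List.map_map,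
      List.map_map]
    simpa [Function.comp_def] using e)

@[simp]
theorem groupLift_artinGen {G : Type*} [Group G] (f : M.ArtinMonoid →* G) (i : I) :
    groupLift f (M.artinGen i) = f (M.gen i) :=
  PresentedGroup.toGroup.of _

@[simp]
theorem groupLift_toArtinGroup {G : Type*} [Group G] (f : M.ArtinMonoid →* G)
    (x : M.ArtinMonoid) : groupLift f (M.toArtinGroup x) = f x := by
  suffices e : (groupLift f).comp M.toArtinGroup = f from DFunLike.congr_fun e x
  exact monoidHom_ext fun i ↦ by simp

theorem groupHom_ext {G : Type*} [Group G] {f g : M.ArtinGroup →* G}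
    (h : ∀ i, f (M.artinGen i) = g (M.artinGen i)) : f = g :=
  PresentedGroup.ext h

/-- The Ore condition gives an injective homomorphism to some group, and every homomorphism to a
group factors through the Artin group. -/
theorem IsFiniteSimplyLaced.toArtinGroup_injective [Finite I] (hM : M.IsFiniteSimplyLaced) :
    Function.Injective M.toArtinGroup := by
  obtain ⟨D, hD⟩ := hM.exists_isGarside
  obtain ⟨G, _, f, hf⟩ := exists_injective_group_of_ore M.ArtinMonoid
    (fun _ _ _ ↦ hM.isSimplyLaced.mul_left_cancel) (fun _ _ _ ↦ hM.isSimplyLaced.mul_right_cancel)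
    (fun x y ↦ by
      obtain ⟨k, u, hu⟩ := hD.exists_pow_eq_mul hM x
      obtain ⟨l, v, hv⟩ := hD.exists_pow_eq_mul hM y
      exact ⟨D ^ l * u, D ^ k * v, by
        rw [mul_assoc, ← hu, mul_assoc, ← hv, ← pow_add, ← pow_add, add_comm]⟩)
  intro x y h
  apply hf
  rw [← groupLift_toArtinGroup f, ← groupLift_toArtinGroup f, h]

theorem artinGroup_induction {p : M.ArtinGroup → Prop} (g : M.ArtinGroup) (one : p 1)
    (mul : ∀ g i, p g → p (g * M.artinGen i)) (mul_inv : ∀ g i, p g → p (g * (M.artinGen i)⁻¹)) :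
    p g := by
  have hg : g ∈ Subgroup.closure (Set.range (PresentedGroup.of (rels := M.braidRelators))) := by
    rw [PresentedGroup.closure_range_of]
    trivial
  induction hg using Subgroup.closure_induction_right with
  | one => exact one
  | mul_right x _ y hy h =>
    obtain ⟨i, rfl⟩ := hy
    exact mul _ _ h
  | mul_inv_cancel x _ y hy h =>
    obtain ⟨i, rfl⟩ := hy
    exact mul_inv _ _ h

/-- Every group element is a left fraction whose denominator is a power of `D`. An inverse letter
costs one more `D`, which moves past the numerator and is divisible by that letter. -/
theorem IsGarside.exists_pow_mul_eq (hM : M.IsFiniteSimplyLaced) {D : M.ArtinMonoid}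
    (hD : IsGarside D) (g : M.ArtinGroup) :
    ∃ k y, M.toArtinGroup (D ^ k) * g = M.toArtinGroup y := by
  induction g using artinGroup_induction with
  | one => exact ⟨0, 1, by simp⟩
  | mul g i ih =>
    obtain ⟨k, y, h⟩ := ih
    exact ⟨k, y * M.gen i, by rw [← mul_assoc, h, map_mul, toArtinGroup_gen]⟩
  | mul_inv g i ih =>
    obtain ⟨k, y, h⟩ := ih
    obtain ⟨z, hz⟩ := hD.exists_eq_mul hM (red_gen i)
    obtain ⟨y', hy'⟩ := hD.exists_mul hM y
    refine ⟨k + 1, y' * z, ?_⟩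
    rw [pow_succ', map_mul, mul_assoc, ← mul_assoc _ g, h, ← mul_assoc, ← map_mul, hy',
      mul_inv_eq_iff_eq_mul, ← toArtinGroup_gen, ← map_mul, mul_assoc, ← hz]

/-! ### Divisibility by parabolic elements -/

open scoped Classical in
/-- The homomorphism that detects whether an element involves only generators from `J`. -/
def supportHom (hM : M.IsFiniteSimplyLaced) (J : Set I) : M.ArtinMonoid →* ℕ :=
  monoidLift (fun i ↦ if i ∈ J then 1 else 0) fun i j ↦ by
    rcases eq_or_ne i j with rfl | h
    · rfl
    rcases hM.label i j h with h | h
    · simp [braidWord, M.symmetric j i, h, alternatingWord, mul_comm, -mul_ite]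
    · simp only [braidWord, M.symmetric j i, h, alternatingWord]
      by_cases hi : i ∈ J <;> by_cases hj : j ∈ J <;> simp [hi, hj]

theorem supportHom_gen (hM : M.IsFiniteSimplyLaced) {J : Set I} {i : I} :
    supportHom hM J (M.gen i) = 1 ↔ i ∈ J := by
  simp [supportHom]

theorem supportHom_rev (hM : M.IsFiniteSimplyLaced) (J : Set I) (x : M.ArtinMonoid) :
    supportHom hM J (rev x) = supportHom hM J x := by
  induction x using gen_mul_induction with
  | one => simp
  | mul i x ih => simp [ih, mul_comm]

theorem supportHom_mul (hM : M.IsFiniteSimplyLaced) {J : Set I} {x y : M.ArtinMonoid} :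
    supportHom hM J (x * y) = 1 ↔ supportHom hM J x = 1 ∧ supportHom hM J y = 1 := by
  rw [map_mul, _root_.mul_eq_one]

/-- This gives the least common multiple property of the longest element on the nodes `J` without
constructing that element. For `u = w j i`, induction lets `x` be divisible by `w j` and by a second
reduced element in the same rank-two coset; cancelling the common prefix, Garside's lemma makes `x`
divisible by their least common multiple, and so by `u`. -/
theorem Red.dvd (hM : M.IsFiniteSimplyLaced) {J : Set I} {x u : M.ArtinMonoid}
    (hx : ∀ j ∈ J, M.gen j ∣ x) (hu : Red M u) (huJ : supportHom hM J u = 1) : u ∣ x := by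
  obtain ⟨n, hn⟩ : ∃ n, len u < n := ⟨_, Nat.lt_succ_self _⟩
  induction n generalizing u with
  | zero => omega
  | succ n ih =>
    rcases eq_or_ne u 1 with rfl | hu1
    · exact one_dvd x
    obtain ⟨i, v, rfl⟩ := exists_eq_mul_gen hu1
    obtain ⟨hvJ, hi⟩ := (supportHom_mul hM).1 huJ
    rw [supportHom_gen] at hi
    rcases eq_or_ne v 1 with rfl | hv1
    · rw [one_mul]
      exact hx i hi
    obtain ⟨j, w, rfl⟩ := exists_eq_mul_gen hv1
    obtain ⟨hwJ, hj⟩ := (supportHom_mul hM).1 hvJ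
    rw [supportHom_gen] at hj
    simp only [len_mul, len_gen] at hn
    have hwj := hM.red_left hu
    have hw := hM.red_left hwj
    have hij : i ≠ j := by
      rintro rfl
      have h1 := hM.act_root_nonneg_of_red hu
      have h2 := hM.act_root_nonpos_of_red hwj
      exact not_act_root_nonneg_and_nonpos _ _ h1 h2
    obtain ⟨y, hy⟩ := ih hwj hvJ (by simp; omega)
    have hjy : M.gen j ∣ M.gen j * y := dvd_mul_right _ _
    have join (h : w * M.gen i ∣ x) :
        ∃ X Y, LcmPair M i X j Y ∧ x = w * (M.gen i * X) := by
      obtain ⟨X, hX⟩ := h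
      rw [hX, mul_assoc, mul_assoc] at hy
      have hy := hM.isSimplyLaced.mul_left_cancel hy
      exact ⟨X, y, hM.isSimplyLaced.lcmPair hy, by rw [hX, mul_assoc]⟩
    rcases hM.label i j hij with hl | hl
    · have hwi : Red M (w * M.gen i * M.gen j) := by
        rwa [mul_assoc, gen_comm hl, ← mul_assoc]
      obtain ⟨X, Y, hXY, rfl⟩ := join (ih (hM.red_left hwi)
        ((supportHom_mul hM).2 ⟨hwJ, (supportHom_gen hM).2 hi⟩) (by simp; omega))
      obtain ⟨Z, rfl, -⟩ := hXY.of_label_two hl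
      exact ⟨Z, by rw [gen_comm_assoc hl, mul_assoc, mul_assoc]⟩
    · rcases hM.act_root_sign w i with hwi | hwi
      · obtain ⟨X, Y, hXY, rfl⟩ := join (ih (hw.mul_gen hwi)
          ((supportHom_mul hM).2 ⟨hwJ, (supportHom_gen hM).2 hi⟩) (by simp; omega))
        obtain ⟨Z, rfl, -⟩ := hXY.of_label_three hl
        exact ⟨M.gen j * Z, by rw [gen_braid_assoc hl]; simp only [mul_assoc]⟩
      -- Now `w = z i`, so `u = z i j i = z j i j`: both `z i` and `z j` divide `x`, and `u` is
      -- their least common multiple.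
      · obtain ⟨z, hz, rfl⟩ := hM.exists_red_mul_gen hw hwi
        have hzJ := ((supportHom_mul hM).1 hwJ).1
        simp only [len_mul, len_gen] at hn
        have e : z * M.gen i * M.gen j * M.gen i = z * M.gen j * M.gen i * M.gen j := by
          simp only [mul_assoc, gen_braid hl]
        have hzj : Red M (z * M.gen j) := hM.red_left (hM.red_left (e ▸ hu))
        obtain ⟨X, hX⟩ := ih hzj ((supportHom_mul hM).2 ⟨hzJ, (supportHom_gen hM).2 hj⟩)
          (by simp; omega)
        obtain ⟨Y, hY⟩ := ih hw hwJ (by simp; omega)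
        have hXY : M.gen i * Y = M.gen j * X := by
          rw [hX, mul_assoc, mul_assoc] at hY
          exact (hM.isSimplyLaced.mul_left_cancel hY).symm
        obtain ⟨Z, rfl, -⟩ := (hM.isSimplyLaced.lcmPair hXY).of_label_three hl
        exact ⟨Z, by rw [hY]; simp only [mul_assoc]⟩

theorem Red.exists_eq_mul (hM : M.IsFiniteSimplyLaced) {J : Set I} {x u : M.ArtinMonoid}
    (hx : ∀ j ∈ J, ∃ y, x = y * M.gen j) (hu : Red M u) (huJ : supportHom hM J u = 1) :
    ∃ y, x = y * u := by
  have h : rev u ∣ rev x := by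
    refine Red.dvd hM (fun j hj ↦ ?_) (hM.red_rev hu) (by rwa [supportHom_rev])
    obtain ⟨y, rfl⟩ := hx j hj
    exact ⟨rev y, by simp⟩
  obtain ⟨y, hy⟩ := h
  refine ⟨rev y, ?_⟩
  rw [← rev_rev x, hy, rev_mul, rev_rev]

end

section

variable {I : Type*} {M : CoxeterMatrix I}

/-! ### Products of pairwise commuting generators -/

theorem act_prod_of_pairwise {w : List I} (hw : w.Pairwise fun i j ↦ M i j = 2) (v : I →₀ ℝ) :
    M.act (w.map M.gen).prod v = v - (w.map fun i ↦ (2 * M.rootForm (root i) v) • root i).sum := by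
  induction w with
  | nil => simp
  | cons i w ih =>
    rw [List.pairwise_cons] at hw
    have h0 : M.rootForm (root i)
        (w.map fun i ↦ (2 * M.rootForm (root i) v) • root i).sum = 0 := by
      rw [map_list_sum, List.map_map]
      refine List.sum_eq_zero fun a ha ↦ ?_
      obtain ⟨j, hj, rfl⟩ := List.mem_map.1 ha
      rw [Function.comp_apply, map_smul, rootForm_root_of_two (hw.1 j hj), smul_zero]
    rw [List.map_cons, List.prod_cons, act_mul_apply, ih hw.2, act_gen, simpleReflection_apply,
      map_sub, h0, List.map_cons, List.sum_cons]
    module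

theorem Red.mul_prod_of_pairwise {w : List I} (hw : w.Pairwise fun i j ↦ M i j = 2)
    {x : M.ArtinMonoid} (hx : Red M x) (h : ∀ i ∈ w, 0 ≤ M.act x (root i)) :
    Red M (x * (w.map M.gen).prod) := by
  induction w generalizing x with
  | nil => simpa using hx
  | cons i w ih =>
    rw [List.pairwise_cons] at hw
    rw [List.map_cons, List.prod_cons, ← mul_assoc]
    refine ih hw.2 (hx.mul_gen (h i (by simp))) fun j hj ↦ ?_
    rw [act_mul_apply, act_gen_root_of_two (hw.1 j hj)]
    exact h j (by simp [hj])

/-! ### Orbits of an admissible group of diagram automorphisms -/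

/-- No node is joined by an edge to another node of its orbit. -/
def IsAdmissible (A : Subgroup M.diagramAut) : Prop := ∀ (a : A) (i : I), M i (a • i) ≠ 3

/-- The elements of the Artin monoid that are fixed by a group of diagram automorphisms. -/
def IsFixed (A : Subgroup M.diagramAut) (x : M.ArtinMonoid) : Prop :=
  ∀ a : A, M.monoidMap a x = x

variable {A : Subgroup M.diagramAut}

theorem IsFixed.one : IsFixed A (1 : M.ArtinMonoid) := fun _ ↦ map_one _

theorem IsFixed.mul {x y : M.ArtinMonoid} (hx : IsFixed A x) (hy : IsFixed A y) :
    IsFixed A (x * y) := fun a ↦ by rw [map_mul, hx, hy]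

theorem IsFixed.of_mul_left (hM : M.IsSimplyLaced) {x y : M.ArtinMonoid} (hx : IsFixed A x)
    (hxy : IsFixed A (x * y)) : IsFixed A y := fun a ↦ by
  have h := hxy a
  rw [map_mul, hx] at h
  exact hM.mul_left_cancel h

theorem IsFixed.of_mul_right (hM : M.IsSimplyLaced) {x y : M.ArtinMonoid} (hy : IsFixed A y)
    (hxy : IsFixed A (x * y)) : IsFixed A x := fun a ↦ by
  have h := hxy a
  rw [map_mul, hy] at h
  exact hM.mul_right_cancel h

theorem mem_orbit_smul {k : M.QuotientNode A} {i : I} (hi : i ∈ k.orbit) (a : A) :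
    a • i ∈ k.orbit := by
  rw [MulAction.orbitRel.Quotient.mem_orbit] at hi ⊢
  rw [← hi]
  exact Quotient.sound' ⟨a, rfl⟩

theorem exists_smul_of_mem_orbit {k : M.QuotientNode A} {i j : I} (hi : i ∈ k.orbit)
    (hj : j ∈ k.orbit) : ∃ a : A, j = a • i := by
  rw [MulAction.orbitRel.Quotient.mem_orbit] at hi hj
  obtain ⟨a, ha⟩ := Quotient.exact' (hj.trans hi.symm)
  exact ⟨a, ha.symm⟩

theorem IsAdmissible.label_of_mem_orbit (hA : IsAdmissible A) (hM : M.IsFiniteSimplyLaced)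
    {k : M.QuotientNode A} {i j : I} (hi : i ∈ k.orbit) (hj : j ∈ k.orbit) (hij : i ≠ j) :
    M i j = 2 := by
  obtain ⟨a, rfl⟩ := exists_smul_of_mem_orbit hi hj
  exact (hM.label _ _ hij).resolve_right (hA a i)

theorem eq_of_dvd_of_len_eq {x y : M.ArtinMonoid} (h : x ∣ y) (hl : len x = len y) : x = y := by
  obtain ⟨z, rfl⟩ := h
  rw [len_mul] at hl
  rw [eq_one_of_len (x := z) (by omega), mul_one]

theorem notMem_orbit_of_ne {k l : M.QuotientNode A} (h : k ≠ l) {i : I} (hi : i ∈ k.orbit) :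
    i ∉ l.orbit := by
  rw [MulAction.orbitRel.Quotient.mem_orbit] at hi ⊢
  rw [hi]
  exact h

theorem IsFixed.act_permLin {x : M.ArtinMonoid} (hx : IsFixed A x) (a : A) (v : I →₀ ℝ) :
    M.act x (permLin (a : M.diagramAut) v) = permLin (a : M.diagramAut) (M.act x v) := by
  conv_lhs => rw [← hx a]
  exact act_monoidMap _ _ _

variable [Finite I]

/-- The nodes of an orbit. -/
def orbitFinset (k : M.QuotientNode A) : Finset I := (Set.toFinite k.orbit).toFinset

@[simp]
theorem mem_orbitFinset {k : M.QuotientNode A} {i : I} : i ∈ orbitFinset k ↔ i ∈ k.orbit := by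
  simp [orbitFinset]

theorem orbitRoot_eq_sum (k : M.QuotientNode A) :
    M.orbitRoot A k = ∑ i ∈ orbitFinset k, root i :=
  finsum_mem_eq_finite_toFinset_sum _ _

theorem orbitFinset_nonempty (k : M.QuotientNode A) : (orbitFinset k).Nonempty := by
  obtain ⟨i, hi⟩ := k.nonempty_orbit
  exact ⟨i, mem_orbitFinset.2 hi⟩

/-- The product of the generators in an orbit. -/
def orbitGen (k : M.QuotientNode A) : M.ArtinMonoid := ((orbitFinset k).toList.map M.gen).prod

theorem IsAdmissible.pairwise_orbit (hA : IsAdmissible A) (hM : M.IsFiniteSimplyLaced)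
    (k : M.QuotientNode A) : (orbitFinset k).toList.Pairwise fun i j ↦ M i j = 2 := by
  refine (Finset.nodup_toList _).pairwise_of_forall_ne fun i hi j hj hij ↦ ?_
  rw [Finset.mem_toList, mem_orbitFinset] at hi hj
  exact hA.label_of_mem_orbit hM hi hj hij

theorem IsAdmissible.act_orbitGen (hA : IsAdmissible A) (hM : M.IsFiniteSimplyLaced)
    (k : M.QuotientNode A) (v : I →₀ ℝ) :
    M.act (orbitGen k) v =
      v - ∑ i ∈ orbitFinset k, (2 * M.rootForm (root i) v) • root i := by
  rw [orbitGen, act_prod_of_pairwise (hA.pairwise_orbit hM k), Finset.sum_map_toList]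

theorem IsAdmissible.red_mul_orbitGen (hA : IsAdmissible A) (hM : M.IsFiniteSimplyLaced)
    (k : M.QuotientNode A) {x : M.ArtinMonoid} (hx : Red M x)
    (h : ∀ i ∈ k.orbit, 0 ≤ M.act x (root i)) : Red M (x * orbitGen k) :=
  hx.mul_prod_of_pairwise (hA.pairwise_orbit hM k) fun i hi ↦
    h i (mem_orbitFinset.1 (Finset.mem_toList.1 hi))

theorem IsAdmissible.red_orbitGen (hA : IsAdmissible A) (hM : M.IsFiniteSimplyLaced)
    (k : M.QuotientNode A) : Red M (orbitGen k) := by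
  rw [← one_mul (orbitGen k)]
  exact hA.red_mul_orbitGen hM k .one fun i _ ↦ by
    rw [act_one_apply]
    exact root_nonneg i

theorem supportHom_orbitGen (hM : M.IsFiniteSimplyLaced) {k : M.QuotientNode A} {J : Set I}
    (h : k.orbit ⊆ J) : supportHom hM J (orbitGen k) = 1 := by
  rw [orbitGen, map_list_prod]
  refine List.prod_eq_one fun a ha ↦ ?_
  simp only [List.map_map, List.mem_map, Finset.mem_toList, mem_orbitFinset] at ha
  obtain ⟨i, hi, rfl⟩ := ha
  exact (supportHom_gen hM).2 (h hi)

theorem IsAdmissible.rootForm_root_of_mem_orbit (hA : IsAdmissible A)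
    (hM : M.IsFiniteSimplyLaced) {k : M.QuotientNode A} {i : I} (hi : i ∈ k.orbit) :
    M.rootForm (root i) (M.orbitRoot A k) = 1 := by
  rw [orbitRoot_eq_sum, map_sum, Finset.sum_eq_single i]
  · exact rootForm_root_self i
  · intro j hj hji
    exact rootForm_root_of_two (hA.label_of_mem_orbit hM hi (mem_orbitFinset.1 hj) hji.symm)
  · simp [hi]

theorem IsAdmissible.act_orbitGen_root (hA : IsAdmissible A) (hM : M.IsFiniteSimplyLaced)
    {k : M.QuotientNode A} {i : I} (hi : i ∈ k.orbit) :
    M.act (orbitGen k) (root i) = -root i := by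
  rw [hA.act_orbitGen hM, Finset.sum_eq_single i]
  · rw [rootForm_root_self]
    module
  · intro j hj hji
    rw [rootForm_root_of_two (hA.label_of_mem_orbit hM (mem_orbitFinset.1 hj) hi hji)]
    module
  · simp [hi]

theorem IsAdmissible.gen_dvd_orbitGen (hA : IsAdmissible A) (hM : M.IsFiniteSimplyLaced)
    {k : M.QuotientNode A} {i : I} (hi : i ∈ k.orbit) : M.gen i ∣ orbitGen k := by
  have h : M.act (rev (orbitGen k)) (root i) ≤ 0 := by
    have e := hA.act_orbitGen_root hM hi
    have : M.act (rev (orbitGen k)) (M.act (orbitGen k) (root i)) = root i := by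
      rw [act_rev]
      exact LinearEquiv.symm_apply_apply _ _
    rw [e, map_neg, neg_eq_iff_eq_neg] at this
    rw [this, neg_nonpos]
    exact root_nonneg i
  obtain ⟨y, -, hy⟩ := hM.exists_red_mul_gen (hM.red_rev (hA.red_orbitGen hM k)) h
  exact ⟨rev y, by rw [← rev_rev (orbitGen k), hy]; simp⟩

theorem IsAdmissible.orbitGen_dvd (hA : IsAdmissible A) (hM : M.IsFiniteSimplyLaced)
    {k : M.QuotientNode A} {x : M.ArtinMonoid} (h : ∀ i ∈ k.orbit, M.gen i ∣ x) :
    orbitGen k ∣ x :=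
  Red.dvd hM h (hA.red_orbitGen hM k) (supportHom_orbitGen hM subset_rfl)

/-- Every generator of the orbit divides each translate of the product, so the product divides its
translates; the lengths agree. No reordering of the listed factors is needed. -/
theorem IsAdmissible.isFixed_orbitGen (hA : IsAdmissible A) (hM : M.IsFiniteSimplyLaced)
    (k : M.QuotientNode A) : IsFixed A (orbitGen k) := by
  intro a
  refine (eq_of_dvd_of_len_eq (hA.orbitGen_dvd hM fun i hi ↦ ?_) (by simp)).symm
  have := map_dvd (M.monoidMap a) (hA.gen_dvd_orbitGen hM (mem_orbit_smul hi a⁻¹))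
  rw [monoidMap_gen] at this
  convert this using 2
  exact (smul_inv_smul a i).symm

/-! ### The simple roots of the quotient diagram -/

theorem permLin_orbitRoot (a : A) (k : M.QuotientNode A) :
    permLin (a : M.diagramAut) (M.orbitRoot A k) = M.orbitRoot A k := by
  rw [orbitRoot_eq_sum, map_sum]
  refine Finset.sum_bij (fun i _ ↦ a • i) ?_ ?_ ?_ ?_
  · intro i hi
    rw [mem_orbitFinset] at hi ⊢
    exact mem_orbit_smul hi a
  · intro i _ j _ h
    exact MulAction.injective a h
  · intro i hi
    rw [mem_orbitFinset] at hi
    exact ⟨a⁻¹ • i, mem_orbitFinset.2 (mem_orbit_smul hi a⁻¹), smul_inv_smul a i⟩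
  · intro i _
    rw [permLin_root]
    rfl

theorem orbitRoot_nonneg (k : M.QuotientNode A) : 0 ≤ M.orbitRoot A k := by
  rw [orbitRoot_eq_sum]
  exact Finset.sum_nonneg fun i _ ↦ root_nonneg i

theorem orbitRoot_apply_of_mem {k : M.QuotientNode A} {i : I} (hi : i ∈ k.orbit) :
    M.orbitRoot A k i = 1 := by
  classical
  rw [orbitRoot_eq_sum, Finsupp.finsetSum_apply, Finset.sum_eq_single i]
  · simp
  · intro j _ hj
    simp [hj]
  · simp [hi]

theorem orbitRoot_apply_of_notMem {k : M.QuotientNode A} {i : I} (hi : i ∉ k.orbit) :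
    M.orbitRoot A k i = 0 := by
  classical
  rw [orbitRoot_eq_sum, Finsupp.finsetSum_apply]
  refine Finset.sum_eq_zero fun j hj ↦ ?_
  rw [mem_orbitFinset] at hj
  have : j ≠ i := fun h ↦ hi (h ▸ hj)
  simp [this]

theorem orbitRoot_ne_zero (k : M.QuotientNode A) : M.orbitRoot A k ≠ 0 := by
  intro h
  obtain ⟨i, hi⟩ := k.nonempty_orbit
  have := orbitRoot_apply_of_mem hi
  rw [h] at this
  simp at this

theorem IsFixed.act_orbitRoot_nonpos {x : M.ArtinMonoid} (hx : IsFixed A x)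
    {k : M.QuotientNode A} {i : I} (hi : i ∈ k.orbit) (h : M.act x (root i) ≤ 0) :
    M.act x (M.orbitRoot A k) ≤ 0 := by
  rw [orbitRoot_eq_sum, map_sum]
  refine Finset.sum_nonpos fun j hj ↦ ?_
  obtain ⟨a, rfl⟩ := exists_smul_of_mem_orbit hi (mem_orbitFinset.1 hj)
  have := permLin_nonpos (a : M.diagramAut) h
  rwa [← hx.act_permLin, permLin_root] at this

theorem IsFixed.act_orbitRoot_nonneg {x : M.ArtinMonoid} (hx : IsFixed A x)
    {k : M.QuotientNode A} {i : I} (hi : i ∈ k.orbit) (h : 0 ≤ M.act x (root i)) :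
    0 ≤ M.act x (M.orbitRoot A k) := by
  rw [orbitRoot_eq_sum, map_sum]
  refine Finset.sum_nonneg fun j hj ↦ ?_
  obtain ⟨a, rfl⟩ := exists_smul_of_mem_orbit hi (mem_orbitFinset.1 hj)
  have := permLin_nonneg (a : M.diagramAut) h
  rwa [← hx.act_permLin, permLin_root] at this

/-- A fixed element commutes with the permutations of the simple roots, so the images of the roots
in one orbit have a common sign, namely that of the image of `μ_k`. -/
theorem IsFixed.act_root_nonneg (hM : M.IsFiniteSimplyLaced) {x : M.ArtinMonoid}
    (hx : IsFixed A x) {k : M.QuotientNode A} (h : 0 ≤ M.act x (M.orbitRoot A k)) {i : I}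
    (hi : i ∈ k.orbit) : 0 ≤ M.act x (root i) :=
  (hM.act_root_sign x i).resolve_right fun h' ↦
    act_ne_zero x (orbitRoot_ne_zero k) (le_antisymm (hx.act_orbitRoot_nonpos hi h') h)

theorem IsFixed.act_root_nonpos (hM : M.IsFiniteSimplyLaced) {x : M.ArtinMonoid}
    (hx : IsFixed A x) {k : M.QuotientNode A} (h : M.act x (M.orbitRoot A k) ≤ 0) {i : I}
    (hi : i ∈ k.orbit) : M.act x (root i) ≤ 0 :=
  (hM.act_root_sign x i).resolve_left fun h' ↦
    act_ne_zero x (orbitRoot_ne_zero k) (le_antisymm h (hx.act_orbitRoot_nonneg hi h'))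

theorem rootForm_orbitRoot_of_const {k : M.QuotientNode A} {v : I →₀ ℝ} {c : ℝ}
    (h : ∀ i ∈ k.orbit, M.rootForm (root i) v = c) :
    M.rootForm (M.orbitRoot A k) v = (orbitFinset k).card * c := by
  rw [orbitRoot_eq_sum, map_sum, LinearMap.sum_apply,
    Finset.sum_congr rfl fun i hi ↦ h i (mem_orbitFinset.1 hi), Finset.sum_const, nsmul_eq_mul]

theorem IsAdmissible.rootForm_orbitRoot_self (hA : IsAdmissible A) (hM : M.IsFiniteSimplyLaced)
    (k : M.QuotientNode A) :
    M.rootForm (M.orbitRoot A k) (M.orbitRoot A k) = (orbitFinset k).card := by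
  rw [rootForm_orbitRoot_of_const fun i hi ↦ hA.rootForm_root_of_mem_orbit hM hi, mul_one]

theorem IsAdmissible.act_orbitGen_of_const (hA : IsAdmissible A) (hM : M.IsFiniteSimplyLaced)
    {k : M.QuotientNode A} {v : I →₀ ℝ} {c : ℝ} (h : ∀ i ∈ k.orbit, M.rootForm (root i) v = c) :
    M.act (orbitGen k) v = v - (2 * c) • M.orbitRoot A k := by
  rw [hA.act_orbitGen hM, orbitRoot_eq_sum, Finset.smul_sum]
  congr 1
  exact Finset.sum_congr rfl fun i hi ↦ by rw [h i (mem_orbitFinset.1 hi)]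

theorem rootForm_root_orbitRoot_const {k l : M.QuotientNode A} {i j : I} (hi : i ∈ k.orbit)
    (hj : j ∈ k.orbit) :
    M.rootForm (root i) (M.orbitRoot A l) = M.rootForm (root j) (M.orbitRoot A l) := by
  obtain ⟨a, rfl⟩ := exists_smul_of_mem_orbit hi hj
  rw [← rootForm_permLin (a : M.diagramAut), permLin_orbitRoot, permLin_root]
  rfl

/-- The number `c` counts the neighbors in `l` of a node in `k`; by transitivity it is the same for
all nodes of `k`. -/
theorem IsFiniteSimplyLaced.exists_neighbor_count (hM : M.IsFiniteSimplyLaced)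
    {k l : M.QuotientNode A} (hkl : k ≠ l) :
    ∃ c : ℕ, ∀ i ∈ k.orbit, M.rootForm (root i) (M.orbitRoot A l) = -(c / 2) := by
  obtain ⟨i, hi⟩ := k.nonempty_orbit
  suffices h : ∃ c : ℕ, M.rootForm (root i) (M.orbitRoot A l) = -(c / 2) by
    obtain ⟨c, hc⟩ := h
    exact ⟨c, fun j hj ↦ by rw [← hc, rootForm_root_orbitRoot_const hi hj]⟩
  have h (j : I) : ∃ c : ℕ, j ∈ l.orbit → M.rootForm (root i) (root j) = -(c / 2) := by
    by_cases hj : j ∈ l.orbit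
    · have hij : i ≠ j := by
        rintro rfl
        exact notMem_orbit_of_ne hkl hi hj
      rcases hM.label i j hij with h | h
      · exact ⟨0, fun _ ↦ by rw [rootForm_root_of_two h]; simp⟩
      · exact ⟨1, fun _ ↦ by rw [rootForm_root_of_three h]; simp⟩
    · exact ⟨0, fun h ↦ absurd h hj⟩
  choose c hc using h
  refine ⟨∑ j ∈ orbitFinset l, c j, ?_⟩
  rw [orbitRoot_eq_sum, map_sum, Finset.sum_congr rfl fun j hj ↦ hc j (mem_orbitFinset.1 hj),
    Finset.sum_neg_distrib, Nat.cast_sum, Finset.sum_div]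

/-- The Cartan integers of a pair of orbits and the label determined by them. -/
theorem IsAdmissible.exists_cartan (hA : IsAdmissible A) (hM : M.IsFiniteSimplyLaced)
    {k l : M.QuotientNode A} (hkl : k ≠ l) :
    ∃ c d : ℕ, M.act (orbitGen k) (M.orbitRoot A l) = M.orbitRoot A l + (c : ℝ) • M.orbitRoot A k ∧
      M.act (orbitGen l) (M.orbitRoot A k) = M.orbitRoot A k + (d : ℝ) • M.orbitRoot A l ∧
      M.orbitWeight A k l = c * d ∧
      (c = 0 ∧ d = 0 ∧ M.quotientDiagram A k l = 2 ∨ c * d = 1 ∧ M.quotientDiagram A k l = 3 ∨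
        c * d = 2 ∧ M.quotientDiagram A k l = 4 ∨ c * d = 3 ∧ M.quotientDiagram A k l = 6) := by
  obtain ⟨c, hc⟩ := hM.exists_neighbor_count hkl
  obtain ⟨d, hd⟩ := hM.exists_neighbor_count hkl.symm
  have h1 := rootForm_orbitRoot_of_const hc
  have h2 := rootForm_orbitRoot_of_const hd
  have hk : (0 : ℝ) < (orbitFinset k).card := by exact_mod_cast (orbitFinset_nonempty k).card_pos
  have hl : (0 : ℝ) < (orbitFinset l).card := by exact_mod_cast (orbitFinset_nonempty l).card_pos
  have h3 := hA.rootForm_orbitRoot_self hM k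
  have h4 := hA.rootForm_orbitRoot_self hM l
  -- Both sides count the edges between the two orbits.
  have hcd : ((orbitFinset k).card : ℝ) * c = (orbitFinset l).card * d := by
    rw [M.rootForm_comm, h2] at h1
    linarith
  have hw : M.orbitWeight A k l = c * d := by
    rw [orbitWeight, h1, h3, h4, div_eq_iff (by positivity)]
    linear_combination (orbitFinset k).card * (c : ℝ) * hcd
  -- The vector `2 μ_l + c μ_k` has norm `|l| (4 - c d)`, which must be positive.
  have hlt : c * d < 4 := by
    have hne : (2 : ℝ) • M.orbitRoot A l + (c : ℝ) • M.orbitRoot A k ≠ 0 := by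
      intro h
      obtain ⟨i, hi⟩ := l.nonempty_orbit
      have := DFunLike.congr_fun h i
      simp [orbitRoot_apply_of_mem hi, orbitRoot_apply_of_notMem
        (notMem_orbit_of_ne hkl.symm hi)] at this
    have hp := hM.pos _ hne
    simp only [map_add, map_smul, LinearMap.add_apply, LinearMap.smul_apply, smul_eq_mul, h3, h4,
      M.rootForm_comm (M.orbitRoot A l) (M.orbitRoot A k), h1] at hp
    have : (orbitFinset l).card * ((c : ℝ) * d) < (orbitFinset l).card * 4 := by
      linear_combination hp - (c : ℝ) * hcd
    exact_mod_cast lt_of_mul_lt_mul_left this hl.le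
  refine ⟨c, d, ?_, ?_, hw, ?_⟩
  · rw [hA.act_orbitGen_of_const hM hc]
    module
  · rw [hA.act_orbitGen_of_const hM hd]
    module
  have hm : M.quotientDiagram A k l = labelOfWeight (c * d) := by
    rw [← hw]
    exact if_neg hkl
  have hz : c * d = 0 → c = 0 ∧ d = 0 := by
    intro h
    rcases Nat.mul_eq_zero.1 h with rfl | rfl
    · refine ⟨rfl, ?_⟩
      have : (d : ℝ) = 0 := by simpa [hl.ne'] using hcd
      exact_mod_cast this
    · refine ⟨?_, rfl⟩
      have : (c : ℝ) = 0 := by simpa [hk.ne'] using hcd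
      exact_mod_cast this
  rw [hm]
  have hcast : ((c : ℝ) * d) = ((c * d : ℕ) : ℝ) := by push_cast; rfl
  rw [hcast]
  obtain ⟨n, hn⟩ : ∃ n, n = c * d := ⟨_, rfl⟩
  rw [← hn] at hlt hz ⊢
  interval_cases n
  · exact Or.inl ⟨(hz rfl).1, (hz rfl).2, by simp [labelOfWeight]⟩
  · exact Or.inr (Or.inl ⟨rfl, by simp [labelOfWeight]⟩)
  · exact Or.inr (Or.inr (Or.inl ⟨rfl, by norm_num [labelOfWeight]⟩))
  · exact Or.inr (Or.inr (Or.inr ⟨rfl, by norm_num [labelOfWeight]⟩))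

end

section

variable {I : Type*} {M : CoxeterMatrix I} {A : Subgroup M.diagramAut} [Finite I]

/-! ### Alternating products of orbit generators -/

/-- The alternating product of two orbit generators, with the given number of factors. -/
def altProd (k l : M.QuotientNode A) (n : ℕ) : M.ArtinMonoid :=
  ((alternatingWord k l n).map orbitGen).prod

theorem altProd_zero (k l : M.QuotientNode A) : altProd k l 0 = 1 := rfl

theorem altProd_succ (k l : M.QuotientNode A) (n : ℕ) :
    altProd k l (n + 1) = altProd l k n * orbitGen l := by
  simp [altProd, CoxeterSystem.alternatingWord_succ]

theorem altProd_succ' (k l : M.QuotientNode A) (n : ℕ) :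
    altProd k l (n + 1) = orbitGen (if Even n then l else k) * altProd k l n := by
  simp [altProd, CoxeterSystem.alternatingWord_succ']

theorem IsAdmissible.act_orbitGen_orbitRoot_self (hA : IsAdmissible A)
    (hM : M.IsFiniteSimplyLaced) (k : M.QuotientNode A) :
    M.act (orbitGen k) (M.orbitRoot A k) = -M.orbitRoot A k := by
  rw [hA.act_orbitGen_of_const hM fun i hi ↦ hA.rootForm_root_of_mem_orbit hM hi]
  module

theorem IsAdmissible.isFixed_altProd (hA : IsAdmissible A) (hM : M.IsFiniteSimplyLaced)
    (k l : M.QuotientNode A) (n : ℕ) : IsFixed A (altProd k l n) := by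
  induction n generalizing k l with
  | zero => exact .one
  | succ n ih =>
    rw [altProd_succ]
    exact (ih l k).mul (hA.isFixed_orbitGen hM l)

/-- The images of the simple root `μ_l` under the alternating products of `k` and `l` stay
nonnegative until the number of factors reaches the label of `k, l`. -/
theorem IsAdmissible.act_altProd_sign (hA : IsAdmissible A) (hM : M.IsFiniteSimplyLaced)
    {k l : M.QuotientNode A} (hkl : k ≠ l) :
    (∀ n < M.quotientDiagram A k l, 0 ≤ M.act (altProd l k n) (M.orbitRoot A l)) ∧
      M.act (altProd l k (M.quotientDiagram A k l)) (M.orbitRoot A l) ≤ 0 := by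
  obtain ⟨c, d, hc, hd, -, h⟩ := hA.exists_cartan hM hkl
  have hk := hA.act_orbitGen_orbitRoot_self hM k
  have hl := hA.act_orbitGen_orbitRoot_self hM l
  have hu := orbitRoot_nonneg k
  have hv := orbitRoot_nonneg l
  set u := M.orbitRoot A k
  set v := M.orbitRoot A l
  -- In coordinates `(a, b)` for `μ_k, μ_l`, the orbit generator of `k` replaces `a` by `c b - a`
  -- and that of `l` replaces `b` by `d a - b`. From `(0, 1)` the vector runs through positive roots
  -- of a rank-two system, up to positive multiples, until it becomes negative at the label.
  have even (n : ℕ) (hn : Even n) (a b : ℝ) (h : M.act (altProd l k n) v = a • u + b • v) :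
      M.act (altProd l k (n + 1)) v = (c * b - a) • u + b • v := by
    rw [altProd_succ', if_pos hn, act_mul_apply, h, map_add, map_smul, map_smul, hk, hc]
    module
  have odd (n : ℕ) (hn : ¬ Even n) (a b : ℝ) (h : M.act (altProd l k n) v = a • u + b • v) :
      M.act (altProd l k (n + 1)) v = a • u + (d * a - b) • v := by
    rw [altProd_succ', if_neg hn, act_mul_apply, h, map_add, map_smul, map_smul, hl, hd]
    module
  have h0 : M.act (altProd l k 0) v = (0 : ℝ) • u + (1 : ℝ) • v := by
    rw [altProd_zero, act_one_apply]
    module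
  have h1 := even 0 (by decide) _ _ h0
  have h2 := odd 1 (by decide) _ _ h1
  have h3 := even 2 (by decide) _ _ h2
  have h4 := odd 3 (by decide) _ _ h3
  have h5 := even 4 (by decide) _ _ h4
  have h6 := odd 5 (by decide) _ _ h5
  have hc0 : (0 : ℝ) ≤ c := Nat.cast_nonneg c
  have pos {a b : ℝ} (ha : 0 ≤ a) (hb : 0 ≤ b) : 0 ≤ a • u + b • v :=
    add_nonneg (smul_nonneg ha hu) (smul_nonneg hb hv)
  have neg {a b : ℝ} (ha : a ≤ 0) (hb : b ≤ 0) : a • u + b • v ≤ 0 :=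
    add_nonpos (smul_nonpos_of_nonpos_of_nonneg ha hu) (smul_nonpos_of_nonpos_of_nonneg hb hv)
  rcases h with ⟨rfl, rfl, hm⟩ | ⟨hw, hm⟩ | ⟨hw, hm⟩ | ⟨hw, hm⟩ <;> rw [hm]
  · refine ⟨fun n hn ↦ ?_, ?_⟩
    · interval_cases n
      · rw [h0]; exact pos (by norm_num) (by norm_num)
      · rw [h1]; exact pos (by norm_num) (by norm_num)
    · rw [h2]; exact neg (by norm_num) (by norm_num)
  all_goals
    have hw' : (c : ℝ) * d = ((c * d : ℕ) : ℝ) := by push_cast; rfl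
    rw [hw] at hw'
    push_cast at hw'
  · have e2 : (d : ℝ) * (c * 1 - 0) - 1 = 0 := by linear_combination hw'
    rw [e2] at h2 h3
    refine ⟨fun n hn ↦ ?_, ?_⟩
    · interval_cases n
      · rw [h0]; exact pos (by norm_num) (by norm_num)
      · rw [h1]; exact pos (by linarith) (by norm_num)
      · rw [h2]; exact pos (by linarith) (by norm_num)
    · rw [h3]; exact neg (by linarith) (by norm_num)
  · have e2 : (d : ℝ) * (c * 1 - 0) - 1 = 1 := by linear_combination hw'
    rw [e2] at h2 h3 h4
    have e3 : (c : ℝ) * 1 - (c * 1 - 0) = 0 := by ring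
    rw [e3] at h3 h4
    refine ⟨fun n hn ↦ ?_, ?_⟩
    · interval_cases n
      · rw [h0]; exact pos (by norm_num) (by norm_num)
      · rw [h1]; exact pos (by linarith) (by norm_num)
      · rw [h2]; exact pos (by linarith) (by norm_num)
      · rw [h3]; exact pos (by norm_num) (by norm_num)
    · rw [h4]; exact neg (by norm_num) (by norm_num)
  · have e2 : (d : ℝ) * (c * 1 - 0) - 1 = 2 := by linear_combination hw'
    rw [e2] at h2 h3 h4 h5 h6
    have e3 : (c : ℝ) * 2 - (c * 1 - 0) = c := by ring
    rw [e3] at h3 h4 h5 h6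
    have e4 : (d : ℝ) * c - 2 = 1 := by linear_combination hw'
    rw [e4] at h4 h5 h6
    have e5 : (c : ℝ) * 1 - c = 0 := by ring
    rw [e5] at h5 h6
    refine ⟨fun n hn ↦ ?_, ?_⟩
    · interval_cases n
      · rw [h0]; exact pos (by norm_num) (by norm_num)
      · rw [h1]; exact pos (by linarith) (by norm_num)
      · rw [h2]; exact pos (by linarith) (by norm_num)
      · rw [h3]; exact pos hc0 (by norm_num)
      · rw [h4]; exact pos hc0 (by norm_num)
      · rw [h5]; exact pos (by norm_num) (by norm_num)
    · rw [h6]; exact neg (by norm_num) (by norm_num)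

theorem IsAdmissible.red_altProd (hA : IsAdmissible A) (hM : M.IsFiniteSimplyLaced)
    {k l : M.QuotientNode A} (hkl : k ≠ l) {n : ℕ} (hn : n ≤ M.quotientDiagram A k l) :
    Red M (altProd k l n) := by
  induction n generalizing k l with
  | zero => exact .one
  | succ n ih =>
    rw [altProd_succ]
    refine hA.red_mul_orbitGen hM l (ih hkl.symm ?_) fun i hi ↦
      (hA.isFixed_altProd hM l k n).act_root_nonneg hM ((hA.act_altProd_sign hM hkl).1 n hn) hi
    rw [CoxeterMatrix.symmetric]
    exact Nat.le_of_succ_le hn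

theorem supportHom_altProd (hM : M.IsFiniteSimplyLaced) {k l : M.QuotientNode A} {J : Set I}
    (hk : k.orbit ⊆ J) (hl : l.orbit ⊆ J) (n : ℕ) : supportHom hM J (altProd k l n) = 1 := by
  induction n generalizing k l with
  | zero => exact map_one _
  | succ n ih =>
    rw [altProd_succ, supportHom_mul]
    exact ⟨ih hl hk, supportHom_orbitGen hM hl⟩

theorem IsAdmissible.label_pos (hA : IsAdmissible A) (hM : M.IsFiniteSimplyLaced)
    (k l : M.QuotientNode A) : M.quotientDiagram A k l ≠ 0 := by
  rcases eq_or_ne k l with rfl | hkl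
  · rw [CoxeterMatrix.diagonal]
    exact one_ne_zero
  obtain ⟨c, d, -, -, -, h⟩ := hA.exists_cartan hM hkl
  rcases h with h | h | h | h <;> omega

/-- The alternating product of full length makes all simple roots of both orbits negative, like a
longest element. For `k` this is the final sign in `act_altProd_sign`; for `l` the last factor
negates `μ_l` and the remaining factors keep it positive. -/
theorem IsAdmissible.exists_altProd_eq_mul_gen (hA : IsAdmissible A)
    (hM : M.IsFiniteSimplyLaced) {k l : M.QuotientNode A} (hkl : k ≠ l) {i : I}
    (hi : i ∈ k.orbit ∪ l.orbit) :
    ∃ y, altProd k l (M.quotientDiagram A k l) = y * M.gen i := by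
  have hr := hA.red_altProd hM hkl le_rfl
  suffices h : M.act (altProd k l (M.quotientDiagram A k l)) (root i) ≤ 0 by
    obtain ⟨y, -, hy⟩ := hM.exists_red_mul_gen hr h
    exact ⟨y, hy⟩
  have hf := hA.isFixed_altProd hM k l (M.quotientDiagram A k l)
  rcases hi with hi | hi
  · refine hf.act_root_nonpos hM ?_ hi
    rw [CoxeterMatrix.symmetric]
    exact (hA.act_altProd_sign hM hkl.symm).2
  · obtain ⟨n, hn⟩ := Nat.exists_eq_succ_of_ne_zero (hA.label_pos hM k l)
    refine hf.act_root_nonpos hM ?_ hi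
    have h0 := (hA.act_altProd_sign hM hkl).1 n (by omega)
    rw [hn, altProd_succ, act_mul_apply, hA.act_orbitGen_orbitRoot_self hM, map_neg, neg_nonpos]
    exact h0

/-- The orbit generators satisfy the braid relations of the quotient diagram. -/
theorem IsAdmissible.altProd_comm (hA : IsAdmissible A) (hM : M.IsFiniteSimplyLaced)
    (k l : M.QuotientNode A) :
    altProd k l (M.quotientDiagram A k l) = altProd l k (M.quotientDiagram A l k) := by
  rcases eq_or_ne k l with rfl | hkl
  · rfl
  -- Each of the two alternating products is a right divisor of the other, so the cofactors have
  -- length zero.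
  have h (k l : M.QuotientNode A) (hkl : k ≠ l) : ∃ y,
      altProd k l (M.quotientDiagram A k l) = y * altProd l k (M.quotientDiagram A l k) :=
    Red.exists_eq_mul hM (J := k.orbit ∪ l.orbit)
      (fun i hi ↦ hA.exists_altProd_eq_mul_gen hM hkl hi) (hA.red_altProd hM hkl.symm le_rfl)
      (supportHom_altProd hM Set.subset_union_right Set.subset_union_left _)
  obtain ⟨y, hy⟩ := h k l hkl
  obtain ⟨z, hz⟩ := h l k hkl.symm
  have h1 := congrArg len hy
  have h2 := congrArg len hz
  rw [len_mul] at h1 h2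
  rw [hy, eq_one_of_len (x := y) (by omega), one_mul]

theorem IsAdmissible.altProd_dvd (hA : IsAdmissible A) (hM : M.IsFiniteSimplyLaced)
    {k l : M.QuotientNode A} (hkl : k ≠ l) {x : M.ArtinMonoid} (hk : orbitGen k ∣ x)
    (hl : orbitGen l ∣ x) : altProd k l (M.quotientDiagram A k l) ∣ x := by
  refine Red.dvd hM (J := k.orbit ∪ l.orbit) (fun i hi ↦ ?_) (hA.red_altProd hM hkl le_rfl)
    (supportHom_altProd hM Set.subset_union_left Set.subset_union_right _)
  rcases hi with hi | hi
  · exact (hA.gen_dvd_orbitGen hM hi).trans hk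
  · exact (hA.gen_dvd_orbitGen hM hi).trans hl

/-! ### The fixed submonoid of the Artin monoid -/

/-- The homomorphism between Artin monoids that sends the generator of an orbit to the product of
the generators in the orbit. -/
def unfold (hA : IsAdmissible A) (hM : M.IsFiniteSimplyLaced) :
    (M.quotientDiagram A).ArtinMonoid →* M.ArtinMonoid :=
  monoidLift orbitGen fun k l ↦ hA.altProd_comm hM k l

variable (hA : IsAdmissible A) (hM : M.IsFiniteSimplyLaced)

@[simp]
theorem unfold_gen (k : M.QuotientNode A) :
    unfold hA hM ((M.quotientDiagram A).gen k) = orbitGen k :=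
  monoidLift_gen _ _ k

theorem isFixed_unfold (c : (M.quotientDiagram A).ArtinMonoid) : IsFixed A (unfold hA hM c) := by
  induction c using gen_mul_induction with
  | one => rw [map_one]; exact .one
  | mul k c ih =>
    rw [map_mul, unfold_gen]
    exact (hA.isFixed_orbitGen hM k).mul ih

/-- If `i` divides a fixed `x`, so do all its translates, and therefore their product `orbitGen k`.
The cofactor is fixed by cancellation and shorter. -/
theorem exists_unfold_eq {x : M.ArtinMonoid} (hx : IsFixed A x) :
    ∃ c, unfold hA hM c = x := by
  obtain ⟨n, hn⟩ : ∃ n, len x < n := ⟨_, Nat.lt_succ_self _⟩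
  induction n generalizing x with
  | zero => omega
  | succ n ih =>
    rcases eq_or_ne x 1 with rfl | h1
    · exact ⟨1, map_one _⟩
    obtain ⟨i, y, hy⟩ := exists_eq_gen_mul h1
    let k : M.QuotientNode A := Quotient.mk'' i
    have hik : i ∈ k.orbit := MulAction.orbitRel.Quotient.mem_orbit.2 rfl
    have hdvd : orbitGen k ∣ x := by
      refine hA.orbitGen_dvd hM fun j hj ↦ ?_
      obtain ⟨a, rfl⟩ := exists_smul_of_mem_orbit hik hj
      exact ⟨M.monoidMap a y, by
        conv_lhs => rw [← hx a, hy, map_mul, monoidMap_gen]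
        rfl⟩
    obtain ⟨z, rfl⟩ := hdvd
    obtain ⟨w, hw⟩ := hA.gen_dvd_orbitGen hM hik
    obtain ⟨c, rfl⟩ := ih ((hA.isFixed_orbitGen hM k).of_mul_left hM.isSimplyLaced hx) (by
      rw [hw] at hn
      simp only [len_mul, len_gen] at hn
      omega)
    exact ⟨(M.quotientDiagram A).gen k * c, by rw [map_mul, unfold_gen]⟩

theorem eq_one_of_unfold_eq_one {c : (M.quotientDiagram A).ArtinMonoid}
    (h : unfold hA hM c = 1) : c = 1 := by
  by_contra hc
  obtain ⟨k, d, rfl⟩ := exists_eq_gen_mul hc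
  obtain ⟨i, hi⟩ := k.nonempty_orbit
  obtain ⟨w, hw⟩ := hA.gen_dvd_orbitGen hM hi
  have := congrArg len h
  rw [map_mul, unfold_gen, hw] at this
  simp at this

/-- Let `k a` and `l b` have the same image, with `k ≠ l`. The image is divisible by the alternating
product, which is the image of the braid word `k u = l v`, and the cofactor is fixed, hence the
image of some `c`. Cancelling in the monoid of Δ and using induction gives `a = u c` and `b = v c`.
Cancellation in the monoid of Ξ, whose labels may be 4 or 6, is never used. -/
theorem unfold_injective : Function.Injective (unfold hA hM) := by
  intro a b h
  obtain ⟨n, hn⟩ : ∃ n, len a < n := ⟨_, Nat.lt_succ_self _⟩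
  induction n generalizing a b with
  | zero => omega
  | succ n ih =>
    rcases eq_or_ne a 1 with rfl | ha
    · rw [map_one] at h
      exact (eq_one_of_unfold_eq_one hA hM h.symm).symm
    rcases eq_or_ne b 1 with rfl | hb
    · rw [map_one] at h
      exact absurd (eq_one_of_unfold_eq_one hA hM h) ha
    obtain ⟨k, a, rfl⟩ := exists_eq_gen_mul ha
    obtain ⟨l, b, rfl⟩ := exists_eq_gen_mul hb
    rw [map_mul, map_mul, unfold_gen, unfold_gen] at h
    rw [len_mul, len_gen] at hn
    rcases eq_or_ne k l with rfl | hkl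
    · rw [ih (hM.isSimplyLaced.mul_left_cancel h) (by omega)]
    obtain ⟨u, v, hu, huv⟩ := exists_gen_mul_eq_braidWord (hA.label_pos hM k l)
    have hdvd := hA.altProd_dvd hM hkl (dvd_mul_right _ (unfold hA hM a)) (h ▸ dvd_mul_right _ _)
    have halt : unfold hA hM ((M.quotientDiagram A).gen k * u) =
        altProd k l (M.quotientDiagram A k l) := by
      rw [hu, map_list_prod, List.map_map, altProd]
      congr 2
    rw [← halt] at hdvd
    obtain ⟨y, hy⟩ := hdvd
    obtain ⟨c, rfl⟩ := exists_unfold_eq hA hM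
      ((isFixed_unfold hA hM _).of_mul_left hM.isSimplyLaced
        (hy ▸ (hA.isFixed_orbitGen hM k).mul (isFixed_unfold hA hM a)))
    have h1 : a = u * c := by
      refine ih ?_ (by omega)
      rw [map_mul _ (CoxeterMatrix.gen _ k), unfold_gen, mul_assoc, ← map_mul] at hy
      exact hM.isSimplyLaced.mul_left_cancel hy
    have h2 : v * c = b := by
      refine ih ?_ ?_
      · rw [hy, huv, map_mul _ (CoxeterMatrix.gen _ l), unfold_gen, mul_assoc, ← map_mul] at h
        exact hM.isSimplyLaced.mul_left_cancel h
      · have := congrArg len huv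
        rw [h1] at hn
        simp only [len_mul, len_gen] at this hn ⊢
        omega
    rw [h1, ← h2, ← mul_assoc, huv, mul_assoc]

end

/-! ### Diagram automorphisms on the Artin group and on the reflection group -/

section Action

variable {I : Type*} {M : CoxeterMatrix I}

variable (M) in
/-- The action of a diagram automorphism on the Artin group. -/
def artinMap (σ : M.diagramAut) : M.ArtinGroup →* M.ArtinGroup :=
  groupLift (M.toArtinGroup.comp (M.monoidMap σ))

@[simp]
theorem artinMap_gen (σ : M.diagramAut) (i : I) :
    M.artinMap σ (M.artinGen i) = M.artinGen (σ • i) := by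
  simp [artinMap]

theorem artinMap_toArtinGroup (σ : M.diagramAut) (x : M.ArtinMonoid) :
    M.artinMap σ (M.toArtinGroup x) = M.toArtinGroup (M.monoidMap σ x) := by
  simp [artinMap]

theorem artinMap_mul (σ τ : M.diagramAut) :
    M.artinMap (σ * τ) = (M.artinMap σ).comp (M.artinMap τ) :=
  groupHom_ext fun i ↦ by simp [mul_smul]

theorem artinMap_one : M.artinMap 1 = MonoidHom.id _ :=
  groupHom_ext fun i ↦ by simp

variable (M) in
/-- The action of the group of diagram automorphisms on the Artin group. -/
def artinAut : M.diagramAut →* MulAut M.ArtinGroup where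
  toFun σ := (M.artinMap σ).toMulEquiv (M.artinMap σ⁻¹)
    (by rw [← artinMap_mul, inv_mul_cancel, artinMap_one])
    (by rw [← artinMap_mul, mul_inv_cancel, artinMap_one])
  map_one' := by
    ext x
    exact DFunLike.congr_fun artinMap_one x
  map_mul' σ τ := by
    ext x
    exact DFunLike.congr_fun (artinMap_mul σ τ) x

theorem artinAut_apply (σ : M.diagramAut) (x : M.ArtinGroup) :
    M.artinAut σ x = M.artinMap σ x := rfl

theorem act_monoidMap_eq_conj (σ : M.diagramAut) (x : M.ArtinMonoid) :
    M.act (M.monoidMap σ x) = permLin σ * M.act x * (permLin σ)⁻¹ := by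
  rw [eq_mul_inv_iff_mul_eq]
  ext1 v
  exact act_monoidMap σ x v

theorem exists_act_eq (w : M.reflectionGroup) : ∃ x, M.act x = w := by
  obtain ⟨x, rfl⟩ := toReflectionGroup_surjective w
  exact ⟨x, rfl⟩

variable (M) in
/-- The permutation representation of the group of diagram automorphisms. -/
def permLinHom : M.diagramAut →* ((I →₀ ℝ) ≃ₗ[ℝ] (I →₀ ℝ)) where
  toFun := permLin
  map_one' := permLin_one
  map_mul' := permLin_mul

theorem permLin_conj_mem (σ : M.diagramAut) {w : (I →₀ ℝ) ≃ₗ[ℝ] (I →₀ ℝ)}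
    (hw : w ∈ M.reflectionGroup) :
    M.permLinHom σ * w * (M.permLinHom σ)⁻¹ ∈ M.reflectionGroup := by
  obtain ⟨x, rfl⟩ := exists_act_eq ⟨w, hw⟩
  have := (M.toReflectionGroup (M.monoidMap σ x)).2
  exact act_monoidMap_eq_conj σ x ▸ this

variable (M) in
/-- The action of the group of diagram automorphisms on the reflection group. -/
def reflectionAut : M.diagramAut →* MulAut M.reflectionGroup where
  toFun σ :=
    { toFun := fun w ↦ ⟨M.permLinHom σ * w.1 * (M.permLinHom σ)⁻¹, permLin_conj_mem σ w.2⟩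
      invFun := fun w ↦ ⟨M.permLinHom σ⁻¹ * w.1 * (M.permLinHom σ⁻¹)⁻¹, permLin_conj_mem σ⁻¹ w.2⟩
      left_inv := fun w ↦ by
        ext1
        simp [mul_assoc]
      right_inv := fun w ↦ by
        ext1
        simp [mul_assoc]
      map_mul' := fun v w ↦ by
        ext1
        simp [mul_assoc] }
  map_one' := by
    ext1 w
    ext1
    simp
  map_mul' σ τ := by
    ext1 w
    ext1
    simp [mul_assoc]

theorem reflectionAut_toReflectionGroup (σ : M.diagramAut) (x : M.ArtinMonoid) :
    M.reflectionAut σ (M.toReflectionGroup x) = M.toReflectionGroup (M.monoidMap σ x) :=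
  Subtype.ext (act_monoidMap_eq_conj σ x).symm

theorem reflectionAut_gen (σ : M.diagramAut) (i : I) :
    M.reflectionAut σ (M.reflectionGen i) = M.reflectionGen (σ • i) := by
  rw [← toReflectionGroup_gen, reflectionAut_toReflectionGroup, monoidMap_gen,
    toReflectionGroup_gen]

theorem artinToReflection_artinAut (σ : M.diagramAut) (x : M.ArtinGroup) :
    M.artinToReflection (M.artinAut σ x) = M.reflectionAut σ (M.artinToReflection x) := by
  suffices h : M.artinToReflection.comp (M.artinMap σ) =
      (M.reflectionAut σ).toMonoidHom.comp M.artinToReflection from DFunLike.congr_fun h x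
  exact groupHom_ext fun i ↦ by simp [reflectionAut_gen]

theorem monoidMap_rev (σ : M.diagramAut) (x : M.ArtinMonoid) :
    M.monoidMap σ (rev x) = rev (M.monoidMap σ x) := by
  induction x using gen_mul_induction with
  | one => simp
  | mul i x ih => simp [ih]

theorem act_monoidMap_congr (σ : M.diagramAut) {x y : M.ArtinMonoid} (h : M.act x = M.act y) :
    M.act (M.monoidMap σ x) = M.act (M.monoidMap σ y) := by
  rw [act_monoidMap_eq_conj, act_monoidMap_eq_conj, h]

/-- The translates of a reduced lift are again reduced, so by uniqueness a fixed group element has a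
fixed reduced lift. -/
theorem IsFixed.exists_red {A : Subgroup M.diagramAut} (hM : M.IsFiniteSimplyLaced) {x : M.ArtinMonoid}
    (hx : ∀ a : A, M.act (M.monoidMap a x) = M.act x) :
    ∃ z, Red M z ∧ IsFixed A z ∧ M.act z = M.act x := by
  obtain ⟨z, hz, hzx, -⟩ := hM.exists_red x
  refine ⟨z, hz, fun a ↦ hM.red_ext (hz.monoidMap a) hz ?_, hzx⟩
  rw [act_monoidMap_congr _ hzx, hx, hzx]

/-- A multiplicative correspondence that is bijective gives an isomorphism of groups. -/
theorem nonempty_mulEquiv_of_rel {G H : Type*} [Group G] [Group H] (R : G → H → Prop)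
    (mul : ∀ g h g' h', R g h → R g' h' → R (g * g') (h * h'))
    (left : ∀ g, ∃ h, R g h) (right : ∀ h, ∃ g, R g h)
    (inj : ∀ g h g' h', R g h → R g' h' → (g = g' ↔ h = h')) : Nonempty (G ≃* H) := by
  choose f hf using left
  refine ⟨MulEquiv.ofBijective (MonoidHom.mk' f fun g g' ↦ ?_) ⟨fun g g' h ↦ ?_, fun h ↦ ?_⟩⟩
  · exact (inj _ _ _ _ (hf _) (mul _ _ _ _ (hf g) (hf g'))).1 rfl
  · exact (inj _ _ _ _ (hf g) (hf g')).2 h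
  · obtain ⟨g, hg⟩ := right h
    exact ⟨g, (inj _ _ _ _ (hf g) hg).1 rfl⟩

end Action

variable {I : Type*} {M : CoxeterMatrix I} {A : Subgroup M.diagramAut} [Finite I]
  (hA : IsAdmissible A) (hM : M.IsFiniteSimplyLaced)

/-! ### The fixed subgroup of the Artin group -/

/-- The homomorphism between Artin groups that sends the generator of an orbit to the product of
the generators in the orbit. -/
def unfoldGroup : (M.quotientDiagram A).ArtinGroup →* M.ArtinGroup :=
  groupLift (M.toArtinGroup.comp (unfold hA hM))

theorem unfoldGroup_toArtinGroup (c : (M.quotientDiagram A).ArtinMonoid) :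
    unfoldGroup hA hM ((M.quotientDiagram A).toArtinGroup c) = M.toArtinGroup (unfold hA hM c) := by
  simp [unfoldGroup]

include hA hM in
-- The Ore condition for Ξ is pulled back from Δ: powers of the invariant element `D` are common
-- left multiples of the two images, and their cofactors are fixed, hence lie in the image of
-- `unfold`.
theorem exists_mul_eq_mul (c d : (M.quotientDiagram A).ArtinMonoid) :
    ∃ u v, u * c = v * d := by
  obtain ⟨D, hD⟩ := hM.exists_isGarside
  have hDf (n : ℕ) : IsFixed A (D ^ n) := fun a ↦ by rw [map_pow, hD.monoidMap_eq hM]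
  obtain ⟨p, y, hy⟩ := hD.exists_pow_eq_mul hM (unfold hA hM c)
  obtain ⟨q, z, hz⟩ := hD.exists_pow_eq_mul hM (unfold hA hM d)
  have hyf := (isFixed_unfold hA hM c).of_mul_right hM.isSimplyLaced (hy ▸ hDf p)
  have hzf := (isFixed_unfold hA hM d).of_mul_right hM.isSimplyLaced (hz ▸ hDf q)
  obtain ⟨u, hu⟩ := exists_unfold_eq hA hM ((hDf q).mul hyf)
  obtain ⟨v, hv⟩ := exists_unfold_eq hA hM ((hDf p).mul hzf)
  refine ⟨u, v, unfold_injective hA hM ?_⟩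
  rw [map_mul, map_mul, hu, hv, mul_assoc, ← hy, mul_assoc, ← hz, ← pow_add, ← pow_add, add_comm]

include hA hM in
theorem exists_toArtinGroup_mul_eq (h : (M.quotientDiagram A).ArtinGroup) :
    ∃ c d, (M.quotientDiagram A).toArtinGroup c * h = (M.quotientDiagram A).toArtinGroup d := by
  induction h using artinGroup_induction with
  | one => exact ⟨1, 1, by simp⟩
  | mul h k ih =>
    obtain ⟨c, d, e⟩ := ih
    exact ⟨c, d * (M.quotientDiagram A).gen k, by rw [← mul_assoc, e, map_mul, toArtinGroup_gen]⟩
  | mul_inv h k ih =>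
    obtain ⟨c, d, e⟩ := ih
    obtain ⟨u, v, huv⟩ := exists_mul_eq_mul hA hM d ((M.quotientDiagram A).gen k)
    refine ⟨u * c, v, ?_⟩
    rw [map_mul, mul_assoc, ← mul_assoc _ h, e, ← mul_assoc, ← map_mul, huv, map_mul,
      toArtinGroup_gen, mul_inv_cancel_right]

/-- Write `h = c⁻¹ d` with `c, d` from the monoid. If the image of `h` is trivial, then `c` and `d`
have the same image in the Artin group of Δ, hence in its monoid, and `c = d`. -/
theorem unfoldGroup_injective : Function.Injective (unfoldGroup hA hM) := by
  rw [injective_iff_map_eq_one]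
  intro h hh
  obtain ⟨c, d, e⟩ := exists_toArtinGroup_mul_eq hA hM h
  have e' := congrArg (unfoldGroup hA hM) e
  rw [map_mul, hh, mul_one, unfoldGroup_toArtinGroup, unfoldGroup_toArtinGroup] at e'
  have := unfold_injective hA hM (hM.toArtinGroup_injective e')
  rwa [this, mul_eq_left] at e

theorem range_unfoldGroup :
    (unfoldGroup hA hM).range = fixedSubgroup (M.artinAut.comp A.subtype) := by
  have hfix (c) (a : A) : M.artinAut a (M.toArtinGroup (unfold hA hM c)) =
      M.toArtinGroup (unfold hA hM c) := by
    rw [artinAut_apply, artinMap_toArtinGroup, isFixed_unfold hA hM c a]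
  apply le_antisymm
  · rintro _ ⟨h, rfl⟩ a
    change M.artinAut a _ = _
    induction h using artinGroup_induction with
    | one => simp
    | mul h k ih =>
      rw [← toArtinGroup_gen, map_mul, map_mul, ih, unfoldGroup_toArtinGroup, hfix]
    | mul_inv h k ih =>
      rw [← toArtinGroup_gen, map_mul, map_inv, map_mul, map_inv, ih, unfoldGroup_toArtinGroup,
        hfix]
  -- A fixed `g` is `D⁻ᵏ y` with `D` fixed, so `y` is fixed too; both `Dᵏ` and `y` unfold from Ξ.
  · intro g hg
    have hg' (a : A) : M.artinAut a g = g := hg a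
    obtain ⟨D, hD⟩ := hM.exists_isGarside
    have hDf (n : ℕ) : IsFixed A (D ^ n) := fun a ↦ by rw [map_pow, hD.monoidMap_eq hM]
    obtain ⟨k, y, hy⟩ := hD.exists_pow_mul_eq hM g
    have hyf : IsFixed A y := by
      intro a
      apply hM.toArtinGroup_injective
      rw [← artinMap_toArtinGroup, ← hy, map_mul, artinMap_toArtinGroup, hDf, ← artinAut_apply,
        hg']
    obtain ⟨c, hc⟩ := exists_unfold_eq hA hM (hDf k)
    obtain ⟨d, rfl⟩ := exists_unfold_eq hA hM hyf
    refine ⟨((M.quotientDiagram A).toArtinGroup c)⁻¹ * (M.quotientDiagram A).toArtinGroup d, ?_⟩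
    rw [map_mul, map_inv, unfoldGroup_toArtinGroup, unfoldGroup_toArtinGroup, hc, ← hy,
      inv_mul_cancel_left]

/-- The fixed subgroup of the Artin group is the Artin group of the quotient diagram. -/
def fixedArtinEquiv :
    fixedSubgroup (M.artinAut.comp A.subtype) ≃* (M.quotientDiagram A).ArtinGroup :=
  ((MonoidHom.ofInjective (unfoldGroup_injective hA hM)).trans
    (MulEquiv.subgroupCongr (range_unfoldGroup hA hM))).symm

/-! ### The fixed subgroup of the reflection group -/

/-- A nontrivial reduced fixed element ends in some `i`, and then sends the sum of the roots in the
orbit of `i` to a nonpositive vector, so it cannot fix this sum. -/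
theorem IsFixed.act_eq_one (hM : M.IsFiniteSimplyLaced) {x : M.ArtinMonoid} (hx : IsFixed A x)
    (h : ∀ k : M.QuotientNode A, M.act x (M.orbitRoot A k) = M.orbitRoot A k) : M.act x = 1 := by
  obtain ⟨z, hz, hzf, hzx⟩ := IsFixed.exists_red hM (A := A) fun a ↦ by rw [hx a]
  rw [← hzx] at h ⊢
  rcases eq_or_ne z 1 with rfl | h1
  · exact map_one _
  obtain ⟨i, y, rfl⟩ := exists_eq_mul_gen h1
  let k : M.QuotientNode A := Quotient.mk'' i
  have hik : i ∈ k.orbit := MulAction.orbitRel.Quotient.mem_orbit.2 rfl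
  have := hzf.act_orbitRoot_nonpos hik (hM.act_root_nonpos_of_red hz)
  rw [h] at this
  exact absurd (le_antisymm this (orbitRoot_nonneg k)) (orbitRoot_ne_zero k)

/-- The isometric embedding of the span of the simple roots of the quotient diagram. -/
def unfoldLin (A : Subgroup M.diagramAut) : (M.QuotientNode A →₀ ℝ) →ₗ[ℝ] (I →₀ ℝ) :=
  -- Simple roots of the quotient diagram are unit vectors, whereas for an admissible group `⟨μ_k,
  -- μ_k⟩ = |k|`; the factor normalizes.
  Finsupp.linearCombination ℝ fun k ↦ (√(orbitFinset k).card)⁻¹ • M.orbitRoot A k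

theorem unfoldLin_root (k : M.QuotientNode A) :
    unfoldLin A (root k) = (√(orbitFinset k).card)⁻¹ • M.orbitRoot A k := by
  simp [unfoldLin]

theorem orbitFinset_card_pos (k : M.QuotientNode A) : (0 : ℝ) < (orbitFinset k).card := by
  exact_mod_cast (orbitFinset_nonempty k).card_pos

theorem unfoldLin_apply {k : M.QuotientNode A} {i : I} (hi : i ∈ k.orbit)
    (x : M.QuotientNode A →₀ ℝ) : unfoldLin A x i = (√(orbitFinset k).card)⁻¹ * x k := by
  classical
  induction x using Finsupp.induction_linear with
  | zero => simp
  | add x y hx hy => simp [hx, hy, mul_add]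
  | single l a =>
    rw [← Finsupp.smul_single_one, map_smul, unfoldLin_root]
    rcases eq_or_ne k l with rfl | hkl
    · simp [orbitRoot_apply_of_mem hi, mul_comm]
    · simp [orbitRoot_apply_of_notMem (notMem_orbit_of_ne hkl hi), hkl]

theorem unfoldLin_injective : Function.Injective (unfoldLin A) := by
  rw [injective_iff_map_eq_zero]
  intro x hx
  ext k
  obtain ⟨i, hi⟩ := k.nonempty_orbit
  have h := unfoldLin_apply hi x
  rw [hx] at h
  have h0 := (Real.sqrt_pos.2 (orbitFinset_card_pos k)).ne'
  simpa [h0] using h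

theorem permLin_unfoldLin (a : A) (x : M.QuotientNode A →₀ ℝ) :
    permLin (a : M.diagramAut) (unfoldLin A x) = unfoldLin A x := by
  induction x using Finsupp.induction_linear with
  | zero => simp
  | add x y hx hy => rw [map_add, map_add, hx, hy]
  | single l c =>
    rw [← Finsupp.smul_single_one, map_smul, map_smul, unfoldLin_root, map_smul,
      permLin_orbitRoot]

include hA hM in
theorem rootForm_unfoldLin_root (k l : M.QuotientNode A) :
    M.rootForm (unfoldLin A (root k)) (unfoldLin A (root l)) =
      (M.quotientDiagram A).rootForm (root k) (root l) := by
  have hk := orbitFinset_card_pos k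
  have hl := orbitFinset_card_pos l
  have hsk := Real.sq_sqrt hk.le
  have hsl := Real.sq_sqrt hl.le
  have hk0 := Real.sqrt_pos.2 hk
  have hl0 := Real.sqrt_pos.2 hl
  rw [unfoldLin_root, unfoldLin_root, map_smul, map_smul, LinearMap.smul_apply, smul_eq_mul,
    smul_eq_mul]
  rcases eq_or_ne k l with rfl | hkl
  · rw [rootForm_root_self, hA.rootForm_orbitRoot_self hM]
    field_simp
    exact hsk.symm
  obtain ⟨c, d, -, -, hw, h⟩ := hA.exists_cartan hM hkl
  obtain ⟨b, hb⟩ := hM.exists_neighbor_count hkl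
  have hneg : M.rootForm (M.orbitRoot A k) (M.orbitRoot A l) ≤ 0 := by
    rw [rootForm_orbitRoot_of_const hb]
    have : (0 : ℝ) ≤ b := Nat.cast_nonneg b
    nlinarith
  rw [orbitWeight, hA.rootForm_orbitRoot_self hM, hA.rootForm_orbitRoot_self hM,
    div_eq_iff (by positivity)] at hw
  rw [rootForm_single]
  set B := M.rootForm (M.orbitRoot A k) (M.orbitRoot A l)
  set s := √((orbitFinset k).card : ℝ)
  set t := √((orbitFinset l).card : ℝ)
  -- The label determines only the square of the cosine; the sign comes from `⟨μ_k, μ_l⟩ ≤ 0`.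
  have key (r : ℝ) (hr : 0 ≤ r) (h4 : (c : ℝ) * d = 4 * r ^ 2) : t⁻¹ * (s⁻¹ * B) = -r := by
    rw [← hsk, ← hsl, h4] at hw
    have h5 : (-B) ^ 2 = (r * (s * t)) ^ 2 := by linear_combination hw / 4
    have h6 : -B = r * (s * t) := by
      rwa [sq_eq_sq₀ (by linarith) (by positivity)] at h5
    have h7 : B = -(r * (s * t)) := by linarith
    rw [h7]
    field_simp
  have hcast : ((c : ℝ) * d) = ((c * d : ℕ) : ℝ) := by push_cast; rfl
  rcases h with ⟨rfl, rfl, hm⟩ | ⟨hcd, hm⟩ | ⟨hcd, hm⟩ | ⟨hcd, hm⟩ <;> rw [hm]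
  · simpa using key 0 le_rfl (by simp)
  · have := key (1 / 2) (by norm_num) (by rw [hcast, hcd]; norm_num)
    simpa using this
  · have := key (√2 / 2) (by positivity) (by
      rw [hcast, hcd, div_pow, Real.sq_sqrt (by norm_num)]; norm_num)
    simpa using this
  · have := key (√3 / 2) (by positivity) (by
      rw [hcast, hcd, div_pow, Real.sq_sqrt (by norm_num)]; norm_num)
    simpa using this

include hA hM in
theorem rootForm_unfoldLin (x y : M.QuotientNode A →₀ ℝ) :
    M.rootForm (unfoldLin A x) (unfoldLin A y) = (M.quotientDiagram A).rootForm x y := by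
  suffices h : M.rootForm.compl₁₂ (unfoldLin A) (unfoldLin A) = (M.quotientDiagram A).rootForm by
    rw [← h]
    rfl
  apply Finsupp.lhom_ext'
  intro k
  ext1
  apply Finsupp.lhom_ext'
  intro l
  ext1
  exact rootForm_unfoldLin_root hA hM k l

/-- On invariant vectors the product of the commuting reflections in an orbit is the reflection in
`μ_k`, since all roots of the orbit have the same inner product with such a vector. -/
theorem act_unfold_unfoldLin (c : (M.quotientDiagram A).ArtinMonoid)
    (x : M.QuotientNode A →₀ ℝ) :
    M.act (unfold hA hM c) (unfoldLin A x) = unfoldLin A ((M.quotientDiagram A).act c x) := by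
  induction c using gen_mul_induction with
  | one => rw [map_one, act_one_apply, act_one_apply]
  | mul k c ih =>
    rw [map_mul, act_mul_apply, ih, act_mul_apply, unfold_gen, act_gen]
    generalize (M.quotientDiagram A).act c x = y
    obtain ⟨i, hi⟩ := k.nonempty_orbit
    have hconst : ∀ j ∈ k.orbit, M.rootForm (root j) (unfoldLin A y) =
        M.rootForm (root i) (unfoldLin A y) := by
      intro j hj
      obtain ⟨a, rfl⟩ := exists_smul_of_mem_orbit hi hj
      rw [← rootForm_permLin (a : M.diagramAut) (root i), permLin_unfoldLin, permLin_root]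
      rfl
    have h0 := Real.sqrt_pos.2 (orbitFinset_card_pos k)
    rw [hA.act_orbitGen_of_const hM hconst, simpleReflection_apply, map_sub, map_smul,
      ← rootForm_unfoldLin hA hM, unfoldLin_root, map_smul, LinearMap.smul_apply,
      rootForm_orbitRoot_of_const hconst, smul_smul]
    congr 2
    conv_rhs => rw [smul_eq_mul, ← Real.sq_sqrt (orbitFinset_card_pos k).le]
    rw [Real.sqrt_sq h0.le]
    field_simp

theorem act_unfold_eq_iff (c d : (M.quotientDiagram A).ArtinMonoid) :
    M.act (unfold hA hM c) = M.act (unfold hA hM d) ↔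
      (M.quotientDiagram A).act c = (M.quotientDiagram A).act d := by
  constructor
  · intro h
    ext1 x
    apply unfoldLin_injective
    rw [← act_unfold_unfoldLin hA hM, h, act_unfold_unfoldLin]
  · intro h
    have hf : IsFixed A (rev (unfold hA hM d) * unfold hA hM c) :=
      IsFixed.mul (fun a ↦ by rw [monoidMap_rev, isFixed_unfold]) (isFixed_unfold hA hM c)
    have h1 := hf.act_eq_one hM fun k ↦ by
      have hs : M.orbitRoot A k = √(orbitFinset k).card • unfoldLin A (root k) := by
        rw [unfoldLin_root, smul_inv_smul₀ (Real.sqrt_pos.2 (orbitFinset_card_pos k)).ne']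
      rw [hs, map_smul, act_mul_apply, act_unfold_unfoldLin, h, ← act_unfold_unfoldLin hA hM,
        act_rev]
      congr 1
      exact LinearEquiv.symm_apply_apply _ _
    rw [map_mul, act_rev, inv_mul_eq_one] at h1
    exact h1.symm

include hA hM in
/-- The fixed subgroup of the reflection group is the reflection group of the quotient diagram. -/
theorem nonempty_fixedReflectionEquiv :
    Nonempty (fixedSubgroup (M.reflectionAut.comp A.subtype) ≃*
      (M.quotientDiagram A).reflectionGroup) := by
  refine nonempty_mulEquiv_of_rel
    -- The correspondence pairs the two images of one monoid element, so no presentation of either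
    -- reflection group is needed.
    (fun w u ↦ ∃ c, M.toReflectionGroup (unfold hA hM c) = w ∧
      (M.quotientDiagram A).toReflectionGroup c = u) ?_ ?_ ?_ ?_
  · rintro w u w' u' ⟨c, hc, rfl⟩ ⟨d, hd, rfl⟩
    exact ⟨c * d, by rw [map_mul, map_mul, hc, hd]; rfl, map_mul _ _ _⟩
  · rintro ⟨w, hw⟩
    obtain ⟨x, rfl⟩ := toReflectionGroup_surjective w
    have hx (a : A) : M.act (M.monoidMap a x) = M.act x := by
      rw [act_eq_iff, ← reflectionAut_toReflectionGroup]
      exact hw a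
    obtain ⟨z, -, hz, hzx⟩ := IsFixed.exists_red hM hx
    obtain ⟨c, rfl⟩ := exists_unfold_eq hA hM hz
    exact ⟨_, c, act_eq_iff.1 hzx, rfl⟩
  · intro u
    obtain ⟨c, rfl⟩ := toReflectionGroup_surjective u
    refine ⟨⟨M.toReflectionGroup (unfold hA hM c), fun a ↦ ?_⟩, c, rfl, rfl⟩
    change M.reflectionAut a _ = _
    rw [reflectionAut_toReflectionGroup, isFixed_unfold]
  · rintro ⟨w, hw⟩ u ⟨w', hw'⟩ u' ⟨c, rfl, rfl⟩ ⟨d, rfl, rfl⟩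
    rw [Subtype.mk.injEq, ← act_eq_iff, ← act_eq_iff]
    exact act_unfold_eq_iff hA hM c d

/-! ### Dynkin diagrams -/

section Criteria

variable {I : Type*} {M : CoxeterMatrix I}

/-- A criterion for the form of a simply laced diagram to be positive definite: there is a positive
vector that has positive inner product with all simple roots. -/
theorem isFiniteSimplyLaced_of_vector [Fintype I]
    (hl : ∀ i j, i ≠ j → M i j = 2 ∨ M i j = 3) (v : I → ℤ) (hv : ∀ i, 0 < v i)
    (h : ∀ i, ∑ j, (if M i j = 3 then v j else 0) < 2 * v i) : M.IsFiniteSimplyLaced where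
  label := hl
  pos x hx := by
    classical
    have hv' (i : I) : (0 : ℝ) < v i := by exact_mod_cast hv i
    let B (i j : I) : ℝ := M.rootForm (root i) (root j)
    have hB (i j : I) : B i j = if i = j then 1 else if M i j = 3 then -(1 / 2) else 0 := by
      split_ifs with h1 h2
      · subst h1
        exact rootForm_root_self i
      · exact rootForm_root_of_three h2
      · exact rootForm_root_of_two ((hl i j h1).resolve_right h2)
    have hBv (i : I) : 0 < ∑ j, B i j * v j := by
      have e (j : I) : B i j * v j =
          (if i = j then (v j : ℝ) else 0) - (1 / 2) * (if M i j = 3 then (v j : ℝ) else 0) := by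
        rw [hB]
        by_cases h1 : i = j
        · subst h1
          simp
        · by_cases h2 : M i j = 3 <;> simp [h1, h2]
      rw [Finset.sum_congr rfl fun j _ ↦ e j, Finset.sum_sub_distrib, ← Finset.mul_sum,
        Finset.sum_ite_eq]
      have hi : ∑ j, (if M i j = 3 then (v j : ℝ) else 0) < 2 * v i := by exact_mod_cast h i
      simp only [Finset.mem_univ, if_true]
      linarith
    have hsymm (i j : I) : B i j = B j i := M.rootForm_comm _ _
    obtain ⟨y, hy⟩ : ∃ y : I → ℝ, ∀ i, x i = v i * y i :=
      ⟨fun i ↦ x i / v i, fun i ↦ by field_simp [(hv' i).ne']⟩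
    have hxy : M.rootForm x x = ∑ i, ∑ j, B i j * v i * v j * (y i * y j) := by
      rw [rootForm_eq_sum, Finsupp.sum_fintype _ _ (by simp)]
      refine Finset.sum_congr rfl fun i _ ↦ ?_
      rw [Finsupp.sum_fintype _ _ (by simp)]
      refine Finset.sum_congr rfl fun j _ ↦ ?_
      rw [hy, hy]
      ring
    -- With `x = v y` coordinatewise, off-diagonal coefficients are nonpositive, so replacing `y i *
    -- y j` by the mean of the squares can only lower the form. By symmetry the result is `∑ v i (y
    -- i)² ⟨e_i, v⟩`, which is positive.
    have hle (i j : I) : B i j * v i * v j * ((y i ^ 2 + y j ^ 2) / 2) ≤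
        B i j * v i * v j * (y i * y j) := by
      have hsq : 0 ≤ (y i - y j) ^ 2 := sq_nonneg _
      rcases eq_or_ne i j with rfl | hij
      · apply le_of_eq
        ring
      · have : B i j * v i * v j ≤ 0 := by
          have hBij : B i j ≤ 0 := by
            rw [hB, if_neg hij]
            split_ifs <;> norm_num
          exact mul_nonpos_of_nonpos_of_nonneg
            (mul_nonpos_of_nonpos_of_nonneg hBij (hv' i).le) (hv' j).le
        exact mul_le_mul_of_nonpos_left (by linarith) this
    have hdiag : ∑ i, ∑ j, B i j * v i * v j * ((y i ^ 2 + y j ^ 2) / 2) =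
        ∑ i, v i * y i ^ 2 * ∑ j, B i j * v j := by
      have e1 : ∑ i, ∑ j, B i j * v i * v j * (y j ^ 2 / 2) =
          ∑ i, ∑ j, B i j * v i * v j * (y i ^ 2 / 2) := by
        rw [Finset.sum_comm]
        refine Finset.sum_congr rfl fun i _ ↦ Finset.sum_congr rfl fun j _ ↦ ?_
        rw [hsymm]
        ring
      simp only [add_div, mul_add, Finset.sum_add_distrib, e1]
      rw [← Finset.sum_add_distrib]
      refine Finset.sum_congr rfl fun i _ ↦ ?_
      rw [Finset.mul_sum, ← Finset.sum_add_distrib]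
      refine Finset.sum_congr rfl fun j _ ↦ ?_
      ring
    rw [hxy]
    refine lt_of_lt_of_le ?_ (Finset.sum_le_sum fun i _ ↦ Finset.sum_le_sum fun j _ ↦ hle i j)
    rw [hdiag]
    obtain ⟨i, hi⟩ := DFunLike.ne_iff.1 hx
    have hyi : y i ≠ 0 := by
      intro h0
      rw [hy, h0] at hi
      simp at hi
    refine Finset.sum_pos' (fun j _ ↦ ?_) ⟨i, Finset.mem_univ i, ?_⟩
    · have := hBv j
      have := hv' j
      positivity
    · have := hBv i
      have := hv' i
      positivity

variable (M) in
/-- No diagram automorphism maps a node to one of its neighbors. -/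
def NoFlip : Prop := ∀ σ ∈ M.diagramAut, ∀ i, M i (σ i) ≠ 3

variable (M) in
/-- A proper coloring of the nodes by signs, for a connected diagram. -/
structure IsSignColoring (ε : I → ℤ) : Prop where
  sq : ∀ i, ε i * ε i = 1
  neg : ∀ i j, M i j = 3 → ε j = -ε i
  connected : ∀ g : I → ℤ, (∀ i j, M i j = 3 → g i = g j) → ∀ i j, g i = g j

/-- Composing the coloring with `σ` gives another proper coloring, and on a connected diagram two
such agree up to one global sign. -/
theorem IsSignColoring.apply_eq {ε : I → ℤ} (hε : IsSignColoring M ε) {σ : Equiv.Perm I}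
    (hσ : σ ∈ M.diagramAut) (i j : I) : ε (σ i) * ε i = ε (σ j) * ε j := by
  refine hε.connected (fun i ↦ ε (σ i) * ε i) (fun i j hij ↦ ?_) i j
  have h : M (σ i) (σ j) = 3 := (hσ i j).trans hij
  simp only [hε.neg _ _ hij, hε.neg _ _ h, neg_mul_neg]

theorem IsSignColoring.noFlip_of_fixed {ε : I → ℤ} (hε : IsSignColoring M ε) (p : I)
    (hp : ∀ σ ∈ M.diagramAut, σ p = p) : NoFlip M := by
  intro σ hσ i hi
  have h := hε.apply_eq hσ i p
  rw [hp σ hσ, hε.sq, hε.neg _ _ hi, neg_mul, hε.sq] at h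
  omega

/-- Moving one node to a neighbor means reversing all signs, so the sum of the signs equals its
negative. -/
theorem IsSignColoring.noFlip_of_sum [Fintype I] {ε : I → ℤ} (hε : IsSignColoring M ε)
    (hs : ∑ i, ε i ≠ 0) : NoFlip M := by
  intro σ hσ i hi
  have h (j : I) : ε (σ j) = -ε j := by
    have h := hε.apply_eq hσ i j
    rw [hε.neg _ _ hi, neg_mul, hε.sq] at h
    have h2 := congrArg (· * ε j) h
    simp only [mul_assoc, hε.sq] at h2
    linarith
  have := Equiv.sum_comp σ ε
  simp only [h, Finset.sum_neg_distrib] at this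
  omega

/-- A node with three different neighbors. -/
def IsBranch (M : CoxeterMatrix I) (i : I) : Prop :=
  ∃ a b c, a ≠ b ∧ a ≠ c ∧ b ≠ c ∧ M i a = 3 ∧ M i b = 3 ∧ M i c = 3

theorem IsSignColoring.noFlip_of_branch {ε : I → ℤ} (hε : IsSignColoring M ε) (p : I)
    (hp : IsBranch M p) (hu : ∀ i, IsBranch M i → i = p) : NoFlip M := by
  refine hε.noFlip_of_fixed p fun σ hσ ↦ hu _ ?_
  obtain ⟨a, b, c, hab, hac, hbc, ha, hb, hc⟩ := hp
  exact ⟨σ a, σ b, σ c, σ.injective.ne hab, σ.injective.ne hac, σ.injective.ne hbc,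
    (hσ _ _).trans ha, (hσ _ _).trans hb, (hσ _ _).trans hc⟩

/-- A simply laced diagram of finite type without flips, in terms of a vector that witnesses
positive definiteness. -/
theorem IsIsomorphic.isFiniteSimplyLaced {n : ℕ} {N : CoxeterMatrix (Fin n)}
    (h : M.IsIsomorphic N) (hl : ∀ i j, i ≠ j → N i j = 2 ∨ N i j = 3) (v : Fin n → ℤ)
    (hv : ∀ i, 0 < v i) (hN : ∀ i, ∑ j, (if N i j = 3 then v j else 0) < 2 * v i) :
    M.IsFiniteSimplyLaced := by
  obtain ⟨e, rfl⟩ := h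
  have := Fintype.ofEquiv _ e.symm
  refine isFiniteSimplyLaced_of_vector (fun i j hij ↦ ?_) (v ∘ e) (fun i ↦ hv _) fun i ↦ ?_
  · simpa [reindex_apply] using hl (e i) (e j) (e.injective.ne hij)
  · have := hN (e i)
    rw [← Equiv.sum_comp e] at this
    simpa [reindex_apply] using this

theorem IsIsomorphic.noFlip {J : Type*} {N : CoxeterMatrix J} (h : M.IsIsomorphic N)
    (hN : NoFlip N) : NoFlip M := by
  obtain ⟨e, rfl⟩ := h
  intro σ hσ i hi
  refine hN (e.symm.trans (σ.trans e)) (fun j k ↦ ?_) (e i) ?_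
  · simpa [reindex_apply] using hσ (e.symm j) (e.symm k)
  · simpa [reindex_apply] using hi

end Criteria

/-- Only an upper bound is needed, so `T` may contain indices outside the diagram as long as `w` is
nonnegative there. This removes case distinctions at the ends of chains. -/
theorem sum_fin_ite_le {n : ℕ} (p : Fin n → Prop) [DecidablePred p] (v : Fin n → ℤ) (w : ℕ → ℤ)
    (T : Finset ℕ) (hvw : ∀ j, p j → v j = w j) (hT : ∀ j, p j → (j : ℕ) ∈ T)
    (hw : ∀ t ∈ T, 0 ≤ w t) : ∑ j, (if p j then v j else 0) ≤ ∑ t ∈ T, w t := by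
  rw [← Finset.sum_filter, Finset.sum_congr rfl (g := fun j : Fin n ↦ w j)
    fun j hj ↦ hvw j (Finset.mem_filter.1 hj).2]
  rw [← Finset.sum_image (s := Finset.univ.filter p) (g := fun j : Fin n ↦ (j : ℕ)) (f := w)
    fun i _ j _ h ↦ Fin.ext h]
  refine Finset.sum_le_sum_of_subset_of_nonneg (fun t ht ↦ ?_) fun t ht _ ↦ hw t ht
  obtain ⟨j, hj, rfl⟩ := Finset.mem_image.1 ht
  exact hT j (Finset.mem_filter.1 hj).2

/-! #### Type A -/

theorem typeA_apply {n : ℕ} (i j : Fin n) : CoxeterMatrix.A n i j =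
    if i = j then 1 else if (j : ℕ) + 1 = i ∨ (i : ℕ) + 1 = j then 3 else 2 := rfl

theorem typeA_eq_three {n : ℕ} {i j : Fin n} :
    CoxeterMatrix.A n i j = 3 ↔ (j : ℕ) + 1 = i ∨ (i : ℕ) + 1 = j := by
  rw [typeA_apply]
  split_ifs with h1 h2
  · subst h1; simp
  · simp [h2]
  · simp [h2]

theorem IsIsomorphic.isFiniteSimplyLaced_typeA {I : Type*} {M : CoxeterMatrix I} {n : ℕ}
    (h : M.IsIsomorphic (CoxeterMatrix.A n)) : M.IsFiniteSimplyLaced := by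
  -- The coordinates of `2ρ`, the sum of the positive roots: a quadratic sequence with second
  -- difference `-2` that vanishes just beyond both ends.
  refine h.isFiniteSimplyLaced (fun i j hij ↦ ?_) (fun i ↦ ((i : ℤ) + 1) * (n - i)) (fun i ↦ ?_)
    fun i ↦ ?_
  · rw [typeA_apply, if_neg hij]
    split_ifs <;> simp
  · have : (i : ℤ) < n := by exact_mod_cast i.2
    exact mul_pos (by positivity) (by linarith)
  · have hi : (i : ℤ) < n := by exact_mod_cast i.2
    obtain ⟨i, hin⟩ := i
    simp only [typeA_eq_three] at hi ⊢
    rcases i with _ | i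
    · refine lt_of_le_of_lt (sum_fin_ite_le _ _ (fun t ↦ ((t : ℤ) + 1) * (n - t)) {1}
        (fun _ _ ↦ rfl) (fun j hj ↦ ?_) fun t ht ↦ ?_) ?_
      · simp at hj ⊢; omega
      · simp at ht; subst ht; push_cast; nlinarith
      · simp
    · refine lt_of_le_of_lt (sum_fin_ite_le _ _ (fun t ↦ ((t : ℤ) + 1) * (n - t)) {i, i + 2}
        (fun _ _ ↦ rfl) (fun j hj ↦ ?_) fun t ht ↦ ?_) ?_
      · simp at hj ⊢; omega
      · simp at ht
        have : (t : ℤ) ≤ n := by omega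
        exact mul_nonneg (by positivity) (by linarith)
      · rw [Finset.sum_pair (by omega)]
        push_cast
        nlinarith

/-- For odd `n` the alternating signs add up to 1. For even `n` the reflection of the chain
exchanges the two middle nodes. -/
theorem noFlip_typeA {n : ℕ} (hn : ¬ Even n) : NoFlip (CoxeterMatrix.A n) := by
  have hε : IsSignColoring (CoxeterMatrix.A n) fun i ↦ (-1) ^ (i : ℕ) :=
    { sq := fun i ↦ by rw [← mul_pow]; simp
      neg := fun i j h ↦ by
        rcases typeA_eq_three.1 h with h | h
        · rw [← h, pow_succ]; ring
        · rw [← h, pow_succ]; ring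
      connected := fun g hg ↦ by
        have h0 (k : ℕ) (hk : k < n) : g ⟨k, hk⟩ = g ⟨0, by omega⟩ := by
          induction k with
          | zero => rfl
          | succ k ih => rw [← ih (by omega), hg ⟨k + 1, hk⟩ ⟨k, by omega⟩ (typeA_eq_three.2 (Or.inl rfl))]
        exact fun i j ↦ (h0 i i.2).trans (h0 j j.2).symm }
  refine hε.noFlip_of_sum ?_
  rw [Fin.sum_univ_eq_sum_range fun i ↦ (-1 : ℤ) ^ i, neg_one_geom_sum, if_neg hn]
  exact one_ne_zero

/-! #### Type D -/

theorem typeD_apply {n : ℕ} (i j : Fin n) : typeD n i j =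
    if i = j then 1
    else if ((i : ℕ) + 1 = j ∧ (j : ℕ) + 1 < n) ∨ ((j : ℕ) + 1 = i ∧ (i : ℕ) + 1 < n)
      ∨ ((i : ℕ) + 3 = n ∧ (j : ℕ) + 1 = n) ∨ ((j : ℕ) + 3 = n ∧ (i : ℕ) + 1 = n) then 3
    else 2 := rfl

theorem typeD_eq_three {n : ℕ} {i j : Fin n} : typeD n i j = 3 ↔
    ((i : ℕ) + 1 = j ∧ (j : ℕ) + 1 < n) ∨ ((j : ℕ) + 1 = i ∧ (i : ℕ) + 1 < n)
      ∨ ((i : ℕ) + 3 = n ∧ (j : ℕ) + 1 = n) ∨ ((j : ℕ) + 3 = n ∧ (i : ℕ) + 1 = n) := by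
  rw [typeD_apply]
  split_ifs with h1 h2
  · subst h1
    simp only [OfNat.one_ne_ofNat, false_iff]
    omega
  · simp [h2]
  · simp [h2]

theorem IsIsomorphic.isFiniteSimplyLaced_typeD {I : Type*} {M : CoxeterMatrix I} {n : ℕ}
    (hn : 4 ≤ n) (h : M.IsIsomorphic (typeD n)) : M.IsFiniteSimplyLaced := by
  -- The coordinates of `4ρ`; the doubling avoids the fraction `n (n - 1) / 2` at the two tips.
  let w (t : ℕ) : ℤ := if t + 2 < n then 2 * ((t + 1) * (2 * n - t - 2)) else n * (n - 1)
  have hn' : (4 : ℤ) ≤ n := by exact_mod_cast hn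
  have hw (t : ℕ) : 0 < w t := by
    dsimp only [w]
    split_ifs with ht
    · have : (t : ℤ) + 2 < n := by exact_mod_cast ht
      have : (0 : ℤ) < 2 * n - t - 2 := by linarith
      positivity
    · have : (0 : ℤ) < n - 1 := by linarith
      positivity
  have chain (t : ℕ) (ht : t + 2 < n) : w t = 2 * ((t + 1) * (2 * n - t - 2)) := if_pos ht
  have tip (t : ℕ) (ht : ¬ t + 2 < n) : w t = n * (n - 1) := if_neg ht
  refine h.isFiniteSimplyLaced (fun i j hij ↦ ?_) (fun i ↦ w i) (fun i ↦ hw i) fun i ↦ ?_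
  · rw [typeD_apply, if_neg hij]
    split_ifs <;> simp
  · obtain ⟨i, hin⟩ := i
    simp only [typeD_eq_three]
    have bound (T : Finset ℕ) (hT : ∀ j : Fin n, _ → (j : ℕ) ∈ T) :=
      sum_fin_ite_le (fun j : Fin n ↦ (i + 1 = j ∧ (j : ℕ) + 1 < n) ∨ ((j : ℕ) + 1 = i ∧ i + 1 < n)
        ∨ (i + 3 = n ∧ (j : ℕ) + 1 = n) ∨ ((j : ℕ) + 3 = n ∧ i + 1 = n)) (fun j ↦ w j) w T
        (fun _ _ ↦ rfl) hT fun t _ ↦ (hw t).le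
    by_cases h1 : i + 3 < n
    · rcases i with _ | i
      · refine lt_of_le_of_lt (bound {1} fun j hj ↦ by simp; omega) ?_
        rw [Finset.sum_singleton, chain 1 (by omega), chain 0 (by omega)]
        push_cast
        linarith
      · refine lt_of_le_of_lt (bound {i, i + 2} fun j hj ↦ by simp; omega) ?_
        rw [Finset.sum_pair (by omega), chain i (by omega), chain (i + 2) (by omega),
          chain (i + 1) (by omega)]
        push_cast
        nlinarith
    by_cases h2 : i + 3 = n
    · obtain ⟨i, rfl⟩ := Nat.exists_eq_succ_of_ne_zero (show i ≠ 0 by omega)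
      refine lt_of_le_of_lt (bound {i, i + 2, i + 3} fun j hj ↦ by simp; omega) ?_
      rw [Finset.sum_insert (by simp), Finset.sum_pair (by omega), chain i (by omega),
        tip (i + 2) (by omega), tip (i + 3) (by omega), chain _ (by omega), ← h2]
      push_cast
      nlinarith
    · obtain ⟨m, rfl⟩ := Nat.exists_eq_add_of_le' (show 3 ≤ n by omega)
      refine lt_of_le_of_lt (bound {m} fun j hj ↦ by simp; omega) ?_
      rw [Finset.sum_singleton, chain m (by omega), tip i (by omega)]
      push_cast
      nlinarith

theorem noFlip_typeD {n : ℕ} (hn : 4 ≤ n) : NoFlip (typeD n) := by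
  have hε : IsSignColoring (typeD n) fun i ↦ if (i : ℕ) + 1 = n then (-1) ^ n
      else (-1) ^ (i : ℕ) :=
    { sq := fun i ↦ by split_ifs <;> rw [← mul_pow] <;> simp
      neg := fun i j h ↦ by
        obtain ⟨m, rfl⟩ := Nat.exists_eq_add_of_le' (show 3 ≤ n by omega)
        rcases typeD_eq_three.1 h with h | h | h | h
        · rw [if_neg (by omega), if_neg (by omega), ← h.1, pow_succ]; ring
        · rw [if_neg (by omega), if_neg (by omega), ← h.1, pow_succ]; ring
        · rw [if_pos (by omega), if_neg (by omega), show (i : ℕ) = m by omega]; ring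
        · rw [if_neg (by omega), if_pos (by omega), show (j : ℕ) = m by omega]; ring
      connected := fun g hg ↦ by
        have h0 (k : ℕ) (hk : k + 1 < n) : g ⟨k, by omega⟩ = g ⟨0, by omega⟩ := by
          induction k with
          | zero => rfl
          | succ k ih =>
            rw [← ih (by omega), hg ⟨k + 1, by omega⟩ ⟨k, by omega⟩
              (typeD_eq_three.2 (Or.inr (Or.inl ⟨rfl, hk⟩)))]
        have h1 (i : Fin n) : g i = g ⟨0, by omega⟩ := by
          by_cases hi : (i : ℕ) + 1 < n
          · exact h0 i hi
          · have hi' := i.2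
            rw [← h0 (n - 3) (by omega)]
            refine hg _ _ (typeD_eq_three.2 (Or.inr (Or.inr (Or.inr ⟨?_, ?_⟩)))) <;>
              (try dsimp only) <;> omega
        exact fun i j ↦ (h1 i).trans (h1 j).symm }
  -- The node `n - 3` is the only one with three neighbors, so it is fixed by all automorphisms,
  -- including the triality of D₄.
  refine hε.noFlip_of_branch ⟨n - 3, by omega⟩ ?_ ?_
  · refine ⟨⟨n - 4, by omega⟩, ⟨n - 2, by omega⟩, ⟨n - 1, by omega⟩, ?_, ?_, ?_, ?_, ?_, ?_⟩
    all_goals simp only [typeD_eq_three, ne_eq, Fin.mk.injEq]; omega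
  · rintro i ⟨a, b, c, hab, hac, hbc, ha, hb, hc⟩
    rw [typeD_eq_three] at ha hb hc
    rw [Ne, Fin.ext_iff] at hab hac hbc
    rw [Fin.ext_iff]
    simp only
    omega

/-! #### Type E -/

/-- The edges of the diagrams of type `E`. -/
def TypeEEdge (i j : ℕ) : Prop :=
  (i = 0 ∧ j = 2) ∨ (i = 2 ∧ j = 0) ∨ (i = 1 ∧ j = 3) ∨ (i = 3 ∧ j = 1) ∨
    (2 ≤ i ∧ i + 1 = j) ∨ (2 ≤ j ∧ j + 1 = i)

instance (i j : ℕ) : Decidable (TypeEEdge i j) := by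
  unfold TypeEEdge
  infer_instance

/-- A diagram has the edges of type `E`. -/
def HasTypeEEdges {n : ℕ} (N : CoxeterMatrix (Fin n)) : Prop :=
  ∀ i j, N i j = if i = j then 1 else if TypeEEdge i j then 3 else 2

theorem hasTypeEEdges_E₆ : HasTypeEEdges E₆ := by
  intro i j
  fin_cases i <;> fin_cases j <;> rfl

theorem hasTypeEEdges_E₇ : HasTypeEEdges E₇ := by
  intro i j
  fin_cases i <;> fin_cases j <;> rfl

theorem hasTypeEEdges_E₈ : HasTypeEEdges E₈ := by
  intro i j
  fin_cases i <;> fin_cases j <;> rfl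

theorem HasTypeEEdges.eq_three {n : ℕ} {N : CoxeterMatrix (Fin n)} (hN : HasTypeEEdges N)
    {i j : Fin n} : N i j = 3 ↔ TypeEEdge i j := by
  rw [hN i j]
  split_ifs with h1 h2
  · subst h1
    simp only [OfNat.one_ne_ofNat, TypeEEdge, false_iff]
    omega
  · simp [h2]
  · simp [h2]

theorem HasTypeEEdges.isFiniteSimplyLaced {I : Type*} {M : CoxeterMatrix I} {n : ℕ}
    {N : CoxeterMatrix (Fin n)} (hN : HasTypeEEdges N) (h : M.IsIsomorphic N) (v : Fin n → ℤ)
    (hv : ∀ i, 0 < v i)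
    (hE : ∀ i : Fin n, ∑ j : Fin n, (if TypeEEdge i j then v j else 0) < 2 * v i) :
    M.IsFiniteSimplyLaced := by
  refine h.isFiniteSimplyLaced (fun i j hij ↦ ?_) v hv fun i ↦ ?_
  · rw [hN, if_neg hij]
    split_ifs <;> simp
  · simpa only [hN.eq_three] using hE i

/-- The vector consists of the coordinates of `2ρ`, for which each required inequality holds with
gap 2; likewise for E₇ and E₈. -/
theorem IsIsomorphic.isFiniteSimplyLaced_E₆ {I : Type*} {M : CoxeterMatrix I}
    (h : M.IsIsomorphic E₆) : M.IsFiniteSimplyLaced :=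
  hasTypeEEdges_E₆.isFiniteSimplyLaced h ![16, 22, 30, 42, 30, 16] (by decide) (by decide)

theorem IsIsomorphic.isFiniteSimplyLaced_E₇ {I : Type*} {M : CoxeterMatrix I}
    (h : M.IsIsomorphic E₇) : M.IsFiniteSimplyLaced :=
  hasTypeEEdges_E₇.isFiniteSimplyLaced h ![34, 49, 66, 96, 75, 52, 27] (by decide) (by decide)

theorem IsIsomorphic.isFiniteSimplyLaced_E₈ {I : Type*} {M : CoxeterMatrix I}
    (h : M.IsIsomorphic E₈) : M.IsFiniteSimplyLaced :=
  hasTypeEEdges_E₈.isFiniteSimplyLaced h ![92, 136, 182, 270, 220, 168, 114, 58] (by decide)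
    (by decide)

theorem HasTypeEEdges.noFlip {n : ℕ} {N : CoxeterMatrix (Fin n)} (hN : HasTypeEEdges N)
    (hn : 5 ≤ n) : NoFlip N := by
  have hε : IsSignColoring N fun i ↦ if (i : ℕ) = 0 then -1 else if (i : ℕ) = 1 then 1
      else (-1) ^ (i : ℕ) :=
    { sq := fun i ↦ by split_ifs <;> simp [← mul_pow]
      neg := fun i j h ↦ by
        rcases hN.eq_three.1 h with ⟨h, h'⟩ | ⟨h, h'⟩ | ⟨h, h'⟩ | ⟨h, h'⟩ | ⟨h, h'⟩ | ⟨h, h'⟩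
        · simp [h, h']
        · simp [h, h']
        · simp [h, h']
        · simp [h, h']
        · rw [if_neg (by omega), if_neg (by omega), if_neg (by omega), if_neg (by omega), ← h',
            pow_succ]
          ring
        · rw [if_neg (by omega), if_neg (by omega), if_neg (by omega), if_neg (by omega), ← h',
            pow_succ]
          ring
      connected := fun g hg ↦ by
        have edge (i j : ℕ) (hi : i < n) (hj : j < n) (h : TypeEEdge i j) :
            g ⟨i, hi⟩ = g ⟨j, hj⟩ := hg _ _ (hN.eq_three.2 h)
        have h0 (k : ℕ) (hk : k + 2 < n) : g ⟨k + 2, hk⟩ = g ⟨2, by omega⟩ := by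
          induction k with
          | zero => rfl
          | succ k ih =>
            rw [← ih (by omega)]
            exact edge _ _ _ _ (by unfold TypeEEdge; omega)
        have h1 (i : Fin n) : g i = g ⟨2, by omega⟩ := by
          obtain ⟨i, hi⟩ := i
          rcases i with _ | _ | i
          · exact edge _ _ _ _ (by decide)
          · exact (edge 1 3 hi (by omega) (by decide)).trans (h0 1 (by omega))
          · exact h0 i hi
        exact fun i j ↦ (h1 i).trans (h1 j).symm }
  refine hε.noFlip_of_branch ⟨3, by omega⟩ ?_ ?_
  · refine ⟨⟨1, by omega⟩, ⟨2, by omega⟩, ⟨4, by omega⟩, ?_, ?_, ?_, ?_, ?_, ?_⟩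
    all_goals simp [hN.eq_three, TypeEEdge]
  · rintro i ⟨a, b, c, hab, hac, hbc, ha, hb, hc⟩
    rw [hN.eq_three, TypeEEdge] at ha hb hc
    rw [Ne, Fin.ext_iff] at hab hac hbc
    rw [Fin.ext_iff]
    dsimp only
    omega

/-! #### Simply laced Dynkin diagrams -/

variable {I : Type*} {M : CoxeterMatrix I}

theorem IsSimplyLacedDynkin.finite (hM : M.IsSimplyLacedDynkin) : Finite I := by
  rcases hM with ⟨n, -, e, -⟩ | ⟨n, -, e, -⟩ | ⟨e, -⟩ | ⟨e, -⟩ | ⟨e, -⟩ <;>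
    exact Finite.of_equiv _ e.symm

theorem IsSimplyLacedDynkin.isFiniteSimplyLaced (hM : M.IsSimplyLacedDynkin) :
    M.IsFiniteSimplyLaced := by
  rcases hM with ⟨n, -, h⟩ | ⟨n, hn, h⟩ | h | h | h
  · exact h.isFiniteSimplyLaced_typeA
  · exact h.isFiniteSimplyLaced_typeD hn
  · exact h.isFiniteSimplyLaced_E₆
  · exact h.isFiniteSimplyLaced_E₇
  · exact h.isFiniteSimplyLaced_E₈

theorem IsSimplyLacedDynkin.noFlip (hM : M.IsSimplyLacedDynkin)
    (hexcl : ¬ ∃ n : ℕ, 1 ≤ n ∧ M.IsIsomorphic (CoxeterMatrix.A (2 * n))) : NoFlip M := by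
  rcases hM with ⟨n, hn, h⟩ | ⟨n, hn, h⟩ | h | h | h
  · refine h.noFlip (noFlip_typeA fun he ↦ hexcl ?_)
    obtain ⟨m, rfl⟩ := even_iff_two_dvd.1 he
    exact ⟨m, by omega, h⟩
  · exact h.noFlip (noFlip_typeD hn)
  · exact h.noFlip (hasTypeEEdges_E₆.noFlip (by norm_num))
  · exact h.noFlip (hasTypeEEdges_E₇.noFlip (by norm_num))
  · exact h.noFlip (hasTypeEEdges_E₈.noFlip (by norm_num))

end CoxeterMatrix

end

/-! ### The main theorem -/

theorem lemma1p1 {I : Type*} (M : CoxeterMatrix I) (hM : M.IsSimplyLacedDynkin)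
    (A : Subgroup M.diagramAut) (hA : A ≠ ⊥)
    (hexcl : ¬ ∃ n : ℕ, 1 ≤ n ∧ M.IsIsomorphic (CoxeterMatrix.A (2 * n))) :
    ∃ (α : A →* MulAut M.ArtinGroup) (β : A →* MulAut M.reflectionGroup),
      (∀ (a : A) (i : I), α a (M.artinGen i) = M.artinGen (a • i)) ∧
      (∀ (a : A) (i : I), β a (M.reflectionGen i) = M.reflectionGen (a • i)) ∧
      (∀ (a : A) (x : M.ArtinGroup),
        M.artinToReflection (α a x) = β a (M.artinToReflection x)) ∧
      Nonempty (fixedSubgroup α ≃* (M.quotientDiagram A).ArtinGroup) ∧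
      Nonempty (fixedSubgroup β ≃* (M.quotientDiagram A).reflectionGroup) := by
  have := hM.finite
  have hF := hM.isFiniteSimplyLaced
  -- This is where the exclusion of type A₂ₙ enters.
  have hadm : CoxeterMatrix.IsAdmissible A := fun a i ↦ hM.noFlip hexcl _ a.1.2 i
  refine ⟨M.artinAut.comp A.subtype, M.reflectionAut.comp A.subtype, fun a i ↦ ?_, fun a i ↦ ?_,
    fun a x ↦ ?_, ⟨CoxeterMatrix.fixedArtinEquiv hadm hF⟩,
    CoxeterMatrix.nonempty_fixedReflectionEquiv hadm hF⟩
  · exact CoxeterMatrix.artinMap_gen _ i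
  · exact CoxeterMatrix.reflectionAut_gen _ i
  · exact CoxeterMatrix.artinToReflection_artinAut _ x
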